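/- Conventions. Let $X$ be a scheme. An $\mathscr{O}_X$-algebra is a sheaf of associative unital $\mathscr{O}_X$-algebras. An $\mathscr{O}_X$-algebra $\mathscr{A}$ is an *Azumaya algebra* if it is finite locally free as an $\mathscr{O}_X$-module, all its stalks are nonzero, and the canonical homomorphism $\mathscr{A}\otimes_{\mathscr{O}_X}\mathscr{A}^{\circ}\to \mathscr{E}nd_{\mathscr{O}_X\text{-mod}}(\mathscr{A})$, $a\otimes b\mapsto (x\mapsto axb)$, is an isomorphism. Let $\operatorname{Az}(X)$ be the category of Azumaya algebras on $X$ with homomorphisms of $\mathscr{O}_X$-algebras. Theorem (Pinching Azumaya algebras). Let $w:X'\to X$, $g:X'\to Y'$, $f:X\to Y$, $u:Y'\to Y$ be morphisms of schemes with $fw=ug$ such that this square is both cartesian and cocartesian in the category of schemes, and such that $f$ is affine and $u$ is a closed immersion. Put $h=fw=ug$. (1) Pullback along $g$ and along $w$ preserves Azumaya algebras. Let $\operatorname{Az}(Y')\times_{\operatorname{Az}(X')}\operatorname{Az}(X)$ be the category of triples $(\mathscr{B}',\tau,\mathscr{A})$ with $\mathscr{B}'\in\operatorname{Az}(Y')$,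 $\mathscr{A}\in\operatorname{Az}(X)$ and $\tau:g^*\mathscr{B}'\to w^*\mathscr{A}$ an isomorphism of algebras; morphisms are pairs of algebra homomorphisms compatible with the isomorphisms $\tau$. For such a triple let $$\Psi(\mathscr{B}',\tau,\mathscr{A})=u_*\mathscr{B}'\times_{h_*\tau}f_*\mathscr{A}$$ be the fiber product of $u_*\mathscr{B}'\to u_*g_*g^*\mathscr{B}'=h_*g^*\mathscr{B}'\xrightarrow{h_*\tau}h_*w^*\mathscr{A}$ and $f_*\mathscr{A}\to f_*w_*w^*\mathscr{A}=h_*w^*\mathscr{A}$, with componentwise algebra structure. Then $\Psi(\mathscr{B}',\tau,\mathscr{A})$ is an Azumaya algebra on $Y$, and the functor $$\Psi:\operatorname{Az}(Y')\times_{\operatorname{Az}(X')}\operatorname{Az}(X)\longrightarrow\operatorname{Az}(Y)$$ is an equivalence of categories. (2) A quasicoherent $\mathscr{O}_Y$-algebra $\mathscr{B}$ is an Azumaya algebra on $Y$ if and only if $u^*\mathscr{B}\in\operatorname{Az}(Y')$ and $f^*\mathscr{B}\in\operatorname{Az}(X)$. -/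

import Mathlib

open CategoryTheory AlgebraicGeometry TopologicalSpace Opposite
open scoped TensorProduct

universe u

noncomputable section

namespace Pinching

open AlgebraicGeometry.Scheme.Modules (pushforward pullback pullbackPushforwardAdjunction)

variable {X Y : Scheme.{u}}

/-- Restriction of sections of an `𝒪_X`-module. -/
def res (M : X.Modules) {U V : X.Opens} (h : U ≤ V) : Γ(M, V) →+ Γ(M, U) :=
  (M.presheaf.map (homOfLE h).op).hom

/-- Restriction of regular functions. -/
def resO (X : Scheme.{u}) {U V : X.Opens} (h : U ≤ V) : Γ(X, V) →+* Γ(X, U) :=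
  (X.presheaf.map (homOfLE h).op).hom

lemma res_smul (M : X.Modules) {U V : X.Opens} (h : U ≤ V) (r : Γ(X, V)) (x : Γ(M, V)) :
    res M h (r • x) = resO X h r • res M h x :=
  M.map_smul _ r x

@[simp]
lemma res_self (M : X.Modules) {U : X.Opens} (h : U ≤ U) (x : Γ(M, U)) : res M h x = x :=
  congr($(M.presheaf.map_id (op U)) x)

@[simp]
lemma res_res (M : X.Modules) {U V W : X.Opens} (h : U ≤ V) (h' : V ≤ W) (x : Γ(M, W)) :
    res M h (res M h' x) = res M (h.trans h') x :=
  congr($(M.presheaf.map_comp (homOfLE h').op (homOfLE h).op) x).symm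

@[simp]
lemma resO_self {U : X.Opens} (h : U ≤ U) (x : Γ(X, U)) : resO X h x = x :=
  congr($(X.presheaf.map_id (op U)) x)

@[simp]
lemma resO_resO {U V W : X.Opens} (h : U ≤ V) (h' : V ≤ W) (x : Γ(X, W)) :
    resO X h (resO X h' x) = resO X (h.trans h') x :=
  congr($(X.presheaf.map_comp (homOfLE h').op (homOfLE h).op) x).symm

lemma app_res {M N : X.Modules} (φ : M ⟶ N) {U V : X.Opens} (h : U ≤ V) (x : Γ(M, V)) :
    φ.app U (res M h x) = res N h (φ.app V x) :=
  congr($(φ.mapPresheaf.naturality (homOfLE h).op) x)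

/-- A morphism of `𝒪_X`-modules from its values on sections. -/
def ofApp {M N : X.Modules} (φ : ∀ U : X.Opens, Γ(M, U) →+ Γ(N, U))
    (hres : ∀ (U V : X.Opens) (h : U ≤ V) (x : Γ(M, V)), φ U (res M h x) = res N h (φ V x))
    (hsmul : ∀ (U : X.Opens) (r : Γ(X, U)) (x : Γ(M, U)), φ U (r • x) = r • φ U x) : M ⟶ N :=
  SheafOfModules.Hom.mk (PresheafOfModules.homMk
    { app := fun U ↦ AddCommGrpCat.ofHom (φ U.unop)
      naturality := fun U V i ↦ by
        ext x
        exact hres _ _ (leOfHom i.unop) x }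
    (fun U r x ↦ hsmul U.unop r x))

@[simp]
lemma ofApp_app {M N : X.Modules} (φ : ∀ U : X.Opens, Γ(M, U) →+ Γ(N, U)) (hres) (hsmul)
    (U : X.Opens) (x : Γ(M, U)) : (ofApp φ hres hsmul).app U x = φ U x := rfl

lemma hom_ext' {M N : X.Modules} {φ ψ : M ⟶ N}
    (h : ∀ (U : X.Opens) (x : Γ(M, U)), φ.app U x = ψ.app U x) : φ = ψ :=
  Scheme.Modules.hom_ext _ _ fun U ↦ by ext x; exact h U x



section Pullback

variable (f : X ⟶ Y)

/-- The canonical map `M(U) → (f^*M)(f⁻¹U)`. -/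
def toPullback (M : Y.Modules) (U : Y.Opens) : Γ(M, U) →+ Γ((pullback f).obj M, f ⁻¹ᵁ U) :=
  (((pullbackPushforwardAdjunction f).unit.app M).app U).hom

lemma preimage_le {U V : Y.Opens} (h : U ≤ V) : f ⁻¹ᵁ U ≤ f ⁻¹ᵁ V := fun _ hx ↦ h hx

lemma toPullback_res (M : Y.Modules) {U V : Y.Opens} (h : U ≤ V) (x : Γ(M, V)) :
    toPullback f M U (res M h x) = res _ (preimage_le f h) (toPullback f M V x) :=
  app_res ((pullbackPushforwardAdjunction f).unit.app M) h x

lemma le_preimage_inf {U : X.Opens} {V W : Y.Opens} (hV : U ≤ f ⁻¹ᵁ V) (hW : U ≤ f ⁻¹ᵁ W) :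
    U ≤ f ⁻¹ᵁ (V ⊓ W) := fun _ hx ↦ ⟨hV hx, hW hx⟩

lemma le_preimage_top (U : X.Opens) : U ≤ f ⁻¹ᵁ (⊤ : Y.Opens) := fun _ _ ↦ trivial

/-- The map on regular functions. -/
def appO (U : Y.Opens) : Γ(Y, U) →+* Γ(X, f ⁻¹ᵁ U) := (f.app U).hom

lemma appO_res {U V : Y.Opens} (h : U ≤ V) (r : Γ(Y, V)) :
    appO f U (resO Y h r) = resO X (preimage_le f h) (appO f V r) :=
  congr($(f.naturality (homOfLE h).op) r)

lemma toPullback_smul (M : Y.Modules) (U : Y.Opens) (r : Γ(Y, U)) (x : Γ(M, U)) :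
    toPullback f M U (r • x) = appO f U r • toPullback f M U x :=
  ((pullbackPushforwardAdjunction f).unit.app M).app_smul r x

/-- The morphism `f^*M ⟶ P` adjoint to `M ⟶ f_*P`. -/
def adjLift {M : Y.Modules} {P : X.Modules} (φ : M ⟶ (pushforward f).obj P) :
    (pullback f).obj M ⟶ P :=
  ((pullbackPushforwardAdjunction f).homEquiv M P).symm φ

lemma adjLift_toPullback {M : Y.Modules} {P : X.Modules} (φ : M ⟶ (pushforward f).obj P)
    (U : Y.Opens) (x : Γ(M, U)) :
    (adjLift f φ).app (f ⁻¹ᵁ U) (toPullback f M U x) = φ.app U x := by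
  have h : (pullbackPushforwardAdjunction f).unit.app M ≫ (pushforward f).map (adjLift f φ) = φ := by
    have := ((pullbackPushforwardAdjunction f).homEquiv M P).apply_symm_apply φ
    rwa [Adjunction.homEquiv_unit] at this
  exact congr(($h).app U x)

lemma pullback_hom_ext {M : Y.Modules} {P : X.Modules} {φ ψ : (pullback f).obj M ⟶ P}
    (h : ∀ (U : Y.Opens) (x : Γ(M, U)),
      φ.app (f ⁻¹ᵁ U) (toPullback f M U x) = ψ.app (f ⁻¹ᵁ U) (toPullback f M U x)) : φ = ψ := by
  apply ((pullbackPushforwardAdjunction f).homEquiv M P).injective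
  rw [Adjunction.homEquiv_unit, Adjunction.homEquiv_unit]
  exact hom_ext' fun U x ↦ h U x

lemma pullback_map_toPullback {M N : Y.Modules} (φ : M ⟶ N) (U : Y.Opens) (x : Γ(M, U)) :
    ((pullback f).map φ).app (f ⁻¹ᵁ U) (toPullback f M U x) = toPullback f N U (φ.app U x) :=
  congr(($((pullbackPushforwardAdjunction f).unit.naturality φ)).app U x).symm

end Pullback

/-- The extension `j_* j^* P` of the restriction of `P` to an open `V`: its sections on `W` are
the sections of `P` on `V ∩ W`. -/
def cut (P : X.Modules) (V : X.Opens) : X.Modules := (pushforward V.ι).obj (P.restrict V.ι)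

lemma cut_eq (V W : X.Opens) : V.ι ''ᵁ V.ι ⁻¹ᵁ W = V ⊓ W := by
  simp [Scheme.Hom.image_preimage_eq_opensRange_inf]

/-- The identification of sections of `cut P V`. -/
def cutEquiv (P : X.Modules) (V W : X.Opens) : Γ(cut P V, W) ≃+ Γ(P, V ⊓ W) where
  toFun := res P (cut_eq V W).ge
  invFun := res P (cut_eq V W).le
  left_inv _ := (res_res P _ _ _).trans (res_self P _ _)
  right_inv _ := (res_res P _ _ _).trans (res_self P _ _)
  map_add' x y := map_add (res P (cut_eq V W).ge) (show Γ(P, V.ι ''ᵁ V.ι ⁻¹ᵁ W) from x) y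

lemma cutEquiv_res (P : X.Modules) (V : X.Opens) {W W' : X.Opens} (h : W ≤ W')
    (x : Γ(cut P V, W')) :
    cutEquiv P V W (res _ h x) = res P (inf_le_inf_left V h) (cutEquiv P V W' x) := by
  have (y : Γ(P, V.ι ''ᵁ V.ι ⁻¹ᵁ W')) : res P (cut_eq V W).ge
      (res P (Scheme.Hom.image_mono _ (preimage_le V.ι h)) y) =
      res P (inf_le_inf_left V h) (res P (cut_eq V W').ge y) := by
    rw [res_res, res_res]
  exact this x

lemma cut_smul (P : X.Modules) (V W : X.Opens) (r : Γ(X, W)) (x : Γ(cut P V, W)) :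
    (r • x : Γ(cut P V, W)) =
      resO X ((cut_eq V W).trans_le inf_le_right) r • (show Γ(P, V.ι ''ᵁ V.ι ⁻¹ᵁ W) from x) := by
  have : (V.ι.appIso _).inv (V.ι.app W r) = resO X ((cut_eq V W).trans_le inf_le_right) r :=
    congr($(V.ι.app_appIso_inv W) r)
  rw [← this]
  rfl

lemma cutEquiv_smul (P : X.Modules) (V W : X.Opens) (r : Γ(X, W)) (x : Γ(cut P V, W)) :
    cutEquiv P V W (r • x) = resO X (inf_le_right : V ⊓ W ≤ W) r • cutEquiv P V W x := by
  rw [cut_smul]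
  have (y : Γ(P, V.ι ''ᵁ V.ι ⁻¹ᵁ W)) : res P (cut_eq V W).ge
      (resO X ((cut_eq V W).trans_le inf_le_right) r • y) =
      resO X (inf_le_right : V ⊓ W ≤ W) r • res P (cut_eq V W).ge y := by
    rw [res_smul, resO_resO]
  exact this x


/-- `Hom_{𝒪_V}(M|_V, N|_V)`, for an open `V`: compatible families of linear maps
`M(W) → N(W)` for all opens `W ≤ V`. -/
@[ext]
structure HomOn (V : X.Opens) (M N : X.Modules) where
  app : ∀ W : X.Opens, W ≤ V → (Γ(M, W) →ₗ[Γ(X, W)] Γ(N, W))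
  res_app : ∀ (W W' : X.Opens) (hW : W ≤ W') (hV : W' ≤ V) (x : Γ(M, W')),
    res N hW (app W' hV x) = app W (hW.trans hV) (res M hW x)

namespace HomOn

variable {V : X.Opens} {M N P : X.Modules}

lemma ext' {φ ψ : HomOn V M N} (h : ∀ W hW x, φ.app W hW x = ψ.app W hW x) : φ = ψ := by
  ext W hW x
  exact h W hW x

instance : Zero (HomOn V M N) := ⟨⟨fun _ _ ↦ 0, by simp⟩⟩

instance : Add (HomOn V M N) :=
  ⟨fun φ ψ ↦ ⟨fun W h ↦ φ.app W h + ψ.app W h, by simp [φ.res_app, ψ.res_app]⟩⟩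

instance : Neg (HomOn V M N) :=
  ⟨fun φ ↦ ⟨fun W h ↦ -φ.app W h, by simp [φ.res_app]⟩⟩

@[simp] lemma zero_app (W : X.Opens) (h : W ≤ V) : (0 : HomOn V M N).app W h = 0 := rfl

@[simp] lemma add_app (φ ψ : HomOn V M N) (W : X.Opens) (h : W ≤ V) :
    (φ + ψ).app W h = φ.app W h + ψ.app W h := rfl

@[simp] lemma neg_app (φ : HomOn V M N) (W : X.Opens) (h : W ≤ V) :
    (-φ).app W h = -φ.app W h := rfl

instance : AddCommGroup (HomOn V M N) where
  add_assoc _ _ _ := by ext1; funext; simp [add_assoc]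
  zero_add _ := by ext1; funext; simp
  add_zero _ := by ext1; funext; simp
  add_comm _ _ := by ext1; funext; simp [add_comm]
  neg_add_cancel _ := by ext1; funext; simp
  nsmul := nsmulRec
  zsmul := zsmulRec

/-- Restriction to a smaller open. -/
def restrict {V' : X.Opens} (h : V' ≤ V) : HomOn V M N →+ HomOn V' M N where
  toFun φ := ⟨fun W hW ↦ φ.app W (hW.trans h), fun _ _ _ _ _ ↦ φ.res_app _ _ _ _ _⟩
  map_zero' := rfl
  map_add' _ _ := rfl

@[simp] lemma restrict_app {V' : X.Opens} (h : V' ≤ V) (φ : HomOn V M N) (W : X.Opens)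
    (hW : W ≤ V') : (restrict h φ).app W hW = φ.app W (hW.trans h) := rfl

/-- Composition. -/
def comp (ψ : HomOn V N P) (φ : HomOn V M N) : HomOn V M P where
  app W h := (ψ.app W h).comp (φ.app W h)
  res_app := by simp [φ.res_app, ψ.res_app]

/-- Multiplication by a regular function. -/
def scale (r : Γ(X, V)) (φ : HomOn V M N) : HomOn V M N where
  app W h := resO X h r • φ.app W h
  res_app W W' hW hV x := by simp [res_smul, φ.res_app]

/-- The restriction of a global morphism. -/
def ofHom (φ : M ⟶ N) (V : X.Opens) : HomOn V M N where
  app W _ := { (φ.app W).hom with map_smul' := φ.app_smul }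
  res_app _ _ h _ x := (app_res φ h x).symm

lemma ofHom_app (φ : M ⟶ N) (W : X.Opens) (h : W ≤ V) (x : Γ(M, W)) :
    (ofHom φ V).app W h x = φ.app W x := rfl

/-- The morphism `M ⟶ cut N V` corresponding to a morphism on `V`. -/
def toCut (φ : HomOn V M N) : M ⟶ cut N V :=
  ofApp (fun W ↦ (cutEquiv N V W).symm.toAddMonoidHom.comp
      ((φ.app (V ⊓ W) inf_le_left).toAddMonoidHom.comp (res M inf_le_right)))
    (fun W W' h x ↦ by
      apply (cutEquiv N V W).injective
      simp [cutEquiv_res, φ.res_app])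
    (fun W r x ↦ by
      apply (cutEquiv N V W).injective
      simp [cutEquiv_smul, res_smul])

lemma cutEquiv_toCut (φ : HomOn V M N) (W : X.Opens) (x : Γ(M, W)) :
    cutEquiv N V W (φ.toCut.app W x) = φ.app (V ⊓ W) inf_le_left (res M inf_le_right x) :=
  AddEquiv.apply_symm_apply _ _

lemma toCut_injective : Function.Injective (toCut : HomOn V M N → _) := by
  intro φ ψ h
  refine ext' fun W hW x ↦ ?_
  have := (cutEquiv_toCut φ W x).symm.trans ((congr(cutEquiv N V W (($h).app W x))).trans
    (cutEquiv_toCut ψ W x))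
  have := congr(res N (le_inf hW le_rfl) $this)
  simpa [res_app] using this

/-- The morphism on `V` corresponding to a morphism `M ⟶ cut N V`. -/
def ofCut (φ : M ⟶ cut N V) : HomOn V M N where
  app W h :=
    { toFun x := res N (le_inf h le_rfl) (cutEquiv N V W (φ.app W x))
      map_add' x y := by simp
      map_smul' r x := by
        rw [Scheme.Modules.Hom.app_smul, cutEquiv_smul, res_smul, resO_resO, resO_self]
        rfl }
  res_app W W' h h' x := by
    change res N _ (res N _ _) = res N _ _
    rw [app_res, cutEquiv_res, res_res, res_res]

lemma ofCut_app (φ : M ⟶ cut N V) (W : X.Opens) (h : W ≤ V) (x : Γ(M, W)) :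
    (ofCut φ).app W h x = res N (le_inf h le_rfl) (cutEquiv N V W (φ.app W x)) := rfl

variable {f : X ⟶ Y} {A : Y.Modules}

/-- Extension of semilinear families of maps on a module to its pullback. -/
def lift (φ : ∀ (W : Y.Opens) (U : X.Opens), U ≤ V → U ≤ f ⁻¹ᵁ W → Γ(A, W) →+ Γ(P, U))
    (hsmul : ∀ W U hV hW (r : Γ(Y, W)) x,
      φ W U hV hW (r • x) = resO X hW (appO f W r) • φ W U hV hW x)
    (hres : ∀ W W' U U' hV hW hV' hW' (h : W ≤ W') (h' : U ≤ U') x,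
      res P h' (φ W' U' hV' hW' x) = φ W U hV hW (res A h x)) :
    HomOn V ((pullback f).obj A) P :=
  ofCut (adjLift f (P := cut P V) (ofApp (N := (pushforward f).obj (cut P V))
    (fun W ↦ (cutEquiv P V (f ⁻¹ᵁ W)).symm.toAddMonoidHom.comp
      (φ W (V ⊓ f ⁻¹ᵁ W) inf_le_left inf_le_right))
    (fun W W' h x ↦ by
      apply (cutEquiv P V (f ⁻¹ᵁ W)).injective
      refine ((AddEquiv.apply_symm_apply _ _).trans ?_).trans
        (cutEquiv_res P V (preimage_le f h) _).symm
      refine Eq.trans ?_ (congrArg _ (AddEquiv.apply_symm_apply _ _).symm)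
      exact (hres _ _ _ _ _ _ _ _ h _ x).symm)
    (fun W r x ↦ by
      apply (cutEquiv P V (f ⁻¹ᵁ W)).injective
      refine ((AddEquiv.apply_symm_apply _ _).trans ?_).trans
        (cutEquiv_smul P V _ (appO f W r) _).symm
      refine Eq.trans ?_ (congrArg _ (AddEquiv.apply_symm_apply _ _).symm)
      exact hsmul _ _ _ _ _ _)))

lemma lift_app (φ : ∀ (W : Y.Opens) (U : X.Opens), U ≤ V → U ≤ f ⁻¹ᵁ W → Γ(A, W) →+ Γ(P, U))
    (hsmul) (hres) (W : Y.Opens) (U : X.Opens) (hV : U ≤ V) (hW : U ≤ f ⁻¹ᵁ W) (x : Γ(A, W)) :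
    (lift φ hsmul hres).app U hV (res _ hW (toPullback f A W x)) = φ W U hV hW x := by
  rw [lift, ofCut_app, app_res, adjLift_toPullback]
  refine (congrArg (res P _) (cutEquiv_res P V hW _)).trans ((res_res P _ _ _).trans ?_)
  refine (congrArg (res P _) (AddEquiv.apply_symm_apply (cutEquiv P V (f ⁻¹ᵁ W)) _)).trans ?_
  exact (hres W W U _ hV hW inf_le_left inf_le_right le_rfl (le_inf hV hW) x).trans (by simp)

lemma pullback_ext {φ ψ : HomOn V ((pullback f).obj A) P}
    (h : ∀ (W : Y.Opens) (U : X.Opens) (hV : U ≤ V) (hW : U ≤ f ⁻¹ᵁ W) (x : Γ(A, W)),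
      φ.app U hV (res _ hW (toPullback f A W x)) = ψ.app U hV (res _ hW (toPullback f A W x))) :
    φ = ψ := by
  apply toCut_injective
  refine pullback_hom_ext f fun W x ↦ ?_
  apply (cutEquiv P V (f ⁻¹ᵁ W)).injective
  rw [cutEquiv_toCut, cutEquiv_toCut, h]

end HomOn

/-- An `𝒪_X`-bilinear map `M × N → P`, equivalently a morphism `M ⊗ N ⟶ P`. -/
@[ext]
structure BilinMap (M N P : X.Modules) where
  app : ∀ U : X.Opens, Γ(M, U) →ₗ[Γ(X, U)] Γ(N, U) →ₗ[Γ(X, U)] Γ(P, U)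
  res_app : ∀ (U V : X.Opens) (h : U ≤ V) (m : Γ(M, V)) (n : Γ(N, V)),
    res P h (app V m n) = app U (res M h m) (res N h n)

namespace BilinMap

variable {M N P : X.Modules} (β : BilinMap M N P)

/-- Plugging in a section in the second variable. -/
def left {V : X.Opens} (n : Γ(N, V)) : HomOn V M P where
  app W h := (β.app W).flip (res N h n)
  res_app W W' h h' x := by simp [β.res_app]

/-- Plugging in a section in the first variable. -/
def right {V : X.Opens} (m : Γ(M, V)) : HomOn V N P where
  app W h := β.app W (res M h m)
  res_app W W' h h' x := by simp [β.res_app]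

@[simp] lemma left_app {V : X.Opens} (n : Γ(N, V)) (W : X.Opens) (h : W ≤ V) (m : Γ(M, W)) :
    (β.left n).app W h m = β.app W m (res N h n) := rfl

@[simp] lemma right_app {V : X.Opens} (m : Γ(M, V)) (W : X.Opens) (h : W ≤ V) (n : Γ(N, W)) :
    (β.right m).app W h n = β.app W (res M h m) n := rfl

end BilinMap

namespace BilinMap

variable (f : X ⟶ Y) {M N P : Y.Modules} (β : BilinMap M N P)

/-- Auxiliary: `f^*N → f^*P` on `f⁻¹V` for a section `m` of `M` on `V`. -/
def pullbackRight {V : Y.Opens} (m : Γ(M, V)) :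
    HomOn (f ⁻¹ᵁ V) ((pullback f).obj N) ((pullback f).obj P) :=
  HomOn.lift (fun W U hV hW ↦ (res _ (le_preimage_inf f hV hW)).comp
      ((toPullback f P (V ⊓ W)).comp ((β.app (V ⊓ W) (res M inf_le_left m)).toAddMonoidHom.comp
        (res N inf_le_right))))
    (fun W U hV hW r x ↦ by
      simp [res_smul, toPullback_smul, appO_res])
    (fun W W' U U' hV hW hV' hW' h h' x ↦ by
      have : β.app (V ⊓ W) (res M inf_le_left m) (res N inf_le_right (res N h x)) =
          res P (inf_le_inf_left V h) (β.app (V ⊓ W') (res M inf_le_left m)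
            (res N inf_le_right x)) := by
        simp [β.res_app]
      refine (res_res _ _ _ _).trans (Eq.trans ?_ (congrArg
        (fun z ↦ res _ (le_preimage_inf f hV hW) (toPullback f P (V ⊓ W) z)) this).symm)
      simp only [toPullback_res, res_res]
      rfl)

lemma pullbackRight_app {V : Y.Opens} (m : Γ(M, V)) (W : Y.Opens) (U : X.Opens)
    (hV : U ≤ f ⁻¹ᵁ V) (hW : U ≤ f ⁻¹ᵁ W) (n : Γ(N, W)) :
    (β.pullbackRight f m).app U hV (res _ hW (toPullback f N W n)) =
      res _ (le_preimage_inf f hV hW)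
        (toPullback f P (V ⊓ W) (β.app (V ⊓ W) (res M inf_le_left m) (res N inf_le_right n))) :=
  HomOn.lift_app _ _ _ _ _ _ _ _

lemma pullbackRight_add {V : Y.Opens} (m m' : Γ(M, V)) :
    β.pullbackRight f (m + m') = β.pullbackRight f m + β.pullbackRight f m' :=
  HomOn.pullback_ext fun W U hV hW x ↦ by simp [pullbackRight_app]

lemma pullbackRight_smul {V : Y.Opens} (r : Γ(Y, V)) (m : Γ(M, V)) :
    β.pullbackRight f (r • m) = (β.pullbackRight f m).scale (appO f V r) :=
  HomOn.pullback_ext fun W U hV hW x ↦ by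
    simp [pullbackRight_app, HomOn.scale, res_smul, toPullback_smul, appO_res]

lemma pullbackRight_res {V V' : Y.Opens} (h : V' ≤ V) (m : Γ(M, V)) :
    β.pullbackRight f (res M h m) = (β.pullbackRight f m).restrict (preimage_le f h) :=
  HomOn.pullback_ext fun W U hV hW x ↦ by
    have : β.app (V' ⊓ W) (res M inf_le_left (res M h m)) (res N inf_le_right x) =
          res P (inf_le_inf_right W h) (β.app (V ⊓ W) (res M inf_le_left m)
            (res N inf_le_right x)) := by
        simp [β.res_app]
    rw [HomOn.restrict_app, pullbackRight_app, pullbackRight_app, this, toPullback_res, res_res]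

/-- Auxiliary: `f^*M → f^*P` on `V` for a section `t` of `f^*N` on `V`. -/
def pullbackLeft {V : X.Opens} (t : Γ((pullback f).obj N, V)) :
    HomOn V ((pullback f).obj M) ((pullback f).obj P) :=
  HomOn.lift (fun W U hV hW ↦
      { toFun m := (β.pullbackRight f m).app U hW (res _ hV t)
        map_zero' := by
          have := β.pullbackRight_add f (0 : Γ(M, W)) 0
          rw [add_zero, left_eq_add] at this
          simp [this]
        map_add' m m' := by simp [pullbackRight_add] })
    (fun W U hV hW r x ↦ by simp [pullbackRight_smul, HomOn.scale])
    (fun W W' U U' hV hW hV' hW' h h' x ↦ by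
      simp [pullbackRight_res, HomOn.res_app])

lemma pullbackLeft_app {V : X.Opens} (t : Γ((pullback f).obj N, V)) (W : Y.Opens) (U : X.Opens)
    (hV : U ≤ V) (hW : U ≤ f ⁻¹ᵁ W) (m : Γ(M, W)) :
    (β.pullbackLeft f t).app U hV (res _ hW (toPullback f M W m)) =
      (β.pullbackRight f m).app U hW (res _ hV t) :=
  HomOn.lift_app _ _ _ _ _ _ _ _

lemma pullbackLeft_add {V : X.Opens} (t t' : Γ((pullback f).obj N, V)) :
    β.pullbackLeft f (t + t') = β.pullbackLeft f t + β.pullbackLeft f t' :=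
  HomOn.pullback_ext fun W U hV hW x ↦ by simp [pullbackLeft_app]

lemma pullbackLeft_smul {V : X.Opens} (r : Γ(X, V)) (t : Γ((pullback f).obj N, V)) :
    β.pullbackLeft f (r • t) = (β.pullbackLeft f t).scale r :=
  HomOn.pullback_ext fun W U hV hW x ↦ by simp [pullbackLeft_app, HomOn.scale, res_smul]

lemma pullbackLeft_res {V V' : X.Opens} (h : V' ≤ V) (t : Γ((pullback f).obj N, V)) :
    β.pullbackLeft f (res _ h t) = (β.pullbackLeft f t).restrict h :=
  HomOn.pullback_ext fun W U hV hW x ↦ by simp [pullbackLeft_app]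

/-- The bilinear map `f^*M × f^*N → f^*P` extending a bilinear map `M × N → P`. -/
def pullback : BilinMap ((pullback f).obj M) ((pullback f).obj N) ((pullback f).obj P) where
  app U := LinearMap.mk₂ _ (fun s t ↦ (β.pullbackLeft f t).app U le_rfl s)
    (by simp) (by simp) (by simp [pullbackLeft_add]) (by simp [pullbackLeft_smul, HomOn.scale])
  res_app U V h s t := by simp [pullbackLeft_res, HomOn.res_app]

lemma pullback_app (W : Y.Opens) (m : Γ(M, W)) (n : Γ(N, W)) {U : X.Opens} (hW : U ≤ f ⁻¹ᵁ W) :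
    (β.pullback f).app U (res _ hW (toPullback f M W m)) (res _ hW (toPullback f N W n)) =
      res _ hW (toPullback f P W (β.app W m n)) := by
  change (β.pullbackLeft f _).app U le_rfl _ = _
  rw [pullbackLeft_app, res_res, pullbackRight_app]
  have : β.app (W ⊓ W) (res M inf_le_left m) (res N inf_le_right n) =
      res P inf_le_left (β.app W m n) := (β.res_app _ _ _ _ _).symm
  rw [this, toPullback_res, res_res]

end BilinMap

/-- A sheaf of associative unital `𝒪_X`-algebras: an `𝒪_X`-module with an associative bilinear
multiplication and a two-sided unit. -/
structure AlgSheaf (X : Scheme.{u}) where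
  /-- the underlying `𝒪_X`-module -/
  mod : X.Modules
  /-- multiplication -/
  mul : BilinMap mod mod mod
  /-- the unit -/
  one : ∀ U : X.Opens, Γ(mod, U)
  res_one : ∀ (U V : X.Opens) (h : U ≤ V), res mod h (one V) = one U
  one_mul : ∀ (U : X.Opens) (a : Γ(mod, U)), mul.app U (one U) a = a
  mul_one : ∀ (U : X.Opens) (a : Γ(mod, U)), mul.app U a (one U) = a
  mul_assoc : ∀ (U : X.Opens) (a b c : Γ(mod, U)),
    mul.app U (mul.app U a b) c = mul.app U a (mul.app U b c)

namespace AlgSheaf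

/-- A homomorphism of `𝒪_X`-algebras. -/
@[ext]
structure Hom (A B : AlgSheaf X) where
  /-- the underlying morphism of `𝒪_X`-modules -/
  hom : A.mod ⟶ B.mod
  map_one : ∀ U : X.Opens, hom.app U (A.one U) = B.one U
  map_mul : ∀ (U : X.Opens) (a b : Γ(A.mod, U)),
    hom.app U (A.mul.app U a b) = B.mul.app U (hom.app U a) (hom.app U b)

instance : Category (AlgSheaf X) where
  Hom := Hom
  id A := ⟨𝟙 _, fun _ ↦ rfl, fun _ _ _ ↦ rfl⟩
  comp φ ψ := ⟨φ.hom ≫ ψ.hom, fun U ↦ by simp [φ.map_one, ψ.map_one],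
    fun U a b ↦ by simp [φ.map_mul, ψ.map_mul]⟩

@[ext]
lemma hom_ext {A B : AlgSheaf X} {φ ψ : A ⟶ B} (h : Hom.hom φ = Hom.hom ψ) : φ = ψ := Hom.ext h

@[simp] lemma id_hom (A : AlgSheaf X) : Hom.hom (𝟙 A) = 𝟙 A.mod := rfl

@[simp] lemma comp_hom {A B C : AlgSheaf X} (φ : A ⟶ B) (ψ : B ⟶ C) :
    (φ ≫ ψ).hom = φ.hom ≫ ψ.hom := rfl

variable (f : X ⟶ Y)

/-- `f^*B` as an `𝒪_X`-module, for an `𝒪_Y`-algebra `B`, with the algebra structure for which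
`B → f_* f^*B` is multiplicative and unital. -/
def pullbackObj (B : AlgSheaf Y) : AlgSheaf X where
  mod := (pullback f).obj B.mod
  mul := B.mul.pullback f
  one U := res _ (le_preimage_top f U) (toPullback f B.mod ⊤ (B.one ⊤))
  res_one U V h := res_res _ _ _ _
  one_mul := by
    intro U a
    suffices (B.mul.pullback f).right (res _ (le_preimage_top f U) (toPullback f B.mod ⊤ (B.one ⊤))) =
        HomOn.ofHom (𝟙 ((pullback f).obj B.mod)) U by
      simpa [HomOn.ofHom_app] using congr(($this).app U le_rfl a)
    refine HomOn.pullback_ext fun W U hV hW x ↦ ?_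
    have : res ((pullback f).obj B.mod) (le_preimage_top f U)
        (toPullback f B.mod ⊤ (B.one ⊤)) = res _ hW (toPullback f B.mod W (B.one W)) := by
      rw [← B.res_one W ⊤ le_top, toPullback_res, res_res]
    rw [BilinMap.right_app, res_res, this, BilinMap.pullback_app, B.one_mul, HomOn.ofHom_app]
    rfl
  mul_one := by
    intro U a
    suffices (B.mul.pullback f).left (res _ (le_preimage_top f U) (toPullback f B.mod ⊤ (B.one ⊤))) =
        HomOn.ofHom (𝟙 ((pullback f).obj B.mod)) U by
      simpa [HomOn.ofHom_app] using congr(($this).app U le_rfl a)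
    refine HomOn.pullback_ext fun W U hV hW x ↦ ?_
    have : res ((pullback f).obj B.mod) (le_preimage_top f U)
        (toPullback f B.mod ⊤ (B.one ⊤)) = res _ hW (toPullback f B.mod W (B.one W)) := by
      rw [← B.res_one W ⊤ le_top, toPullback_res, res_res]
    rw [BilinMap.left_app, res_res, this, BilinMap.pullback_app, B.mul_one, HomOn.ofHom_app]
    rfl
  mul_assoc := by
    intro U a b c
    suffices ((B.mul.pullback f).left c).comp ((B.mul.pullback f).left b) =
        (B.mul.pullback f).left ((B.mul.pullback f).app U b c) by
      simpa [HomOn.comp] using congr(($this).app U le_rfl a)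
    refine HomOn.pullback_ext fun W V hV hW x ↦ ?_
    simp only [HomOn.comp, LinearMap.comp_apply, BilinMap.left_app, BilinMap.res_app]
    generalize res _ hV b = b
    generalize res _ hV c = c
    suffices ((B.mul.pullback f).left c).comp
        ((B.mul.pullback f).right (res _ hW (toPullback f B.mod W x))) =
        ((B.mul.pullback f).right (res _ hW (toPullback f B.mod W x))).comp
          ((B.mul.pullback f).left c) by
      simpa [HomOn.comp] using congr(($this).app V le_rfl b)
    refine HomOn.pullback_ext fun W' V' hV' hW' y ↦ ?_
    simp only [HomOn.comp, LinearMap.comp_apply, BilinMap.left_app, BilinMap.right_app]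
    generalize res _ hV' c = c
    rw [res_res]
    have hW₁ := hV'.trans hW
    suffices (B.mul.pullback f).right ((B.mul.pullback f).app V'
          (res _ hW₁ (toPullback f B.mod W x)) (res _ hW' (toPullback f B.mod W' y))) =
        ((B.mul.pullback f).right (res _ hW₁ (toPullback f B.mod W x))).comp
          ((B.mul.pullback f).right (res _ hW' (toPullback f B.mod W' y))) by
      simpa [HomOn.comp] using congr(($this).app V' le_rfl c)
    refine HomOn.pullback_ext fun W₃ V₃ hV₃ hW₃ z ↦ ?_
    simp only [HomOn.comp, LinearMap.comp_apply, BilinMap.right_app, BilinMap.res_app, res_res]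
    have h₁ := hV₃.trans hW₁
    have h₂ := hV₃.trans hW'
    have e (T : Y.Opens) (h : V₃ ≤ f ⁻¹ᵁ T) (h' : W ⊓ (W' ⊓ W₃) ≤ T) (x : Γ(B.mod, T)) :
        res _ h (toPullback f B.mod T x) =
        res _ (le_preimage_inf f h₁ (le_preimage_inf f h₂ hW₃))
          (toPullback f B.mod (W ⊓ (W' ⊓ W₃)) (res _ h' x)) := by
      rw [toPullback_res, res_res]
    rw [e W _ inf_le_left x, e W' _ (inf_le_right.trans inf_le_left) y,
      e W₃ _ (inf_le_right.trans inf_le_right) z]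
    simp only [BilinMap.pullback_app, B.mul_assoc]

end AlgSheaf

lemma BilinMap.pullback_map (f : X ⟶ Y) {M N P M' N' P' : Y.Modules} (β : BilinMap M N P)
    (β' : BilinMap M' N' P') (φ : M ⟶ M') (ψ : N ⟶ N') (χ : P ⟶ P')
    (h : ∀ U m n, χ.app U (β.app U m n) = β'.app U (φ.app U m) (ψ.app U n)) (U : X.Opens)
    (a : Γ((Scheme.Modules.pullback f).obj M, U)) (b : Γ((Scheme.Modules.pullback f).obj N, U)) :
    ((Scheme.Modules.pullback f).map χ).app U ((β.pullback f).app U a b) =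
      (β'.pullback f).app U (((Scheme.Modules.pullback f).map φ).app U a)
        (((Scheme.Modules.pullback f).map ψ).app U b) := by
  suffices (HomOn.ofHom ((Scheme.Modules.pullback f).map χ) U).comp ((β.pullback f).left b) =
      ((β'.pullback f).left (((Scheme.Modules.pullback f).map ψ).app U b)).comp
        (HomOn.ofHom ((Scheme.Modules.pullback f).map φ) U) by
    simpa [HomOn.comp, HomOn.ofHom_app] using congr(($this).app U le_rfl a)
  refine HomOn.pullback_ext fun W V hV hW x ↦ ?_
  simp only [HomOn.comp, LinearMap.comp_apply, BilinMap.left_app, HomOn.ofHom_app, ← app_res]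
  generalize res _ hV b = b
  suffices (HomOn.ofHom ((Scheme.Modules.pullback f).map χ) V).comp
      ((β.pullback f).right (res _ hW (toPullback f M W x))) =
      ((β'.pullback f).right (((Scheme.Modules.pullback f).map φ).app V
        (res _ hW (toPullback f M W x)))).comp
        (HomOn.ofHom ((Scheme.Modules.pullback f).map ψ) V) by
    simpa [HomOn.comp, HomOn.ofHom_app] using congr(($this).app V le_rfl b)
  refine HomOn.pullback_ext fun W' V' hV' hW' y ↦ ?_
  simp only [HomOn.comp, LinearMap.comp_apply, BilinMap.right_app, HomOn.ofHom_app,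
    ← app_res, res_res]
  have h₁ := hV'.trans hW
  have e (K : Y.Modules) (T : Y.Opens) (h : V' ≤ f ⁻¹ᵁ T) (h' : W ⊓ W' ≤ T) (x : Γ(K, T)) :
      res _ h (toPullback f K T x) = res _ (le_preimage_inf f h₁ hW')
        (toPullback f K (W ⊓ W') (res _ h' x)) := by
    rw [toPullback_res, res_res]
  rw [e M W _ inf_le_left x, e N W' _ inf_le_right y, app_res, app_res]
  simp only [BilinMap.pullback_app, app_res, pullback_map_toPullback, h]

namespace AlgSheaf

lemma pullbackObj_one (f : X ⟶ Y) (B : AlgSheaf Y) (U : X.Opens) (W : Y.Opens)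
    (h : U ≤ f ⁻¹ᵁ W) :
    (pullbackObj f B).one U = res _ h (toPullback f B.mod W (B.one W)) := by
  rw [← B.res_one W ⊤ le_top, toPullback_res, res_res]
  rfl

/-- The pullback functor `f^*` on sheaves of algebras. -/
def pullbackAlg (f : X ⟶ Y) : AlgSheaf Y ⥤ AlgSheaf X where
  obj := pullbackObj f
  map {A B} φ :=
    { hom := (pullback f).map φ.hom
      map_one U := by
        refine (app_res ((pullback f).map φ.hom) (le_preimage_top f U) _).trans ?_
        rw [pullback_map_toPullback, φ.map_one]
        rfl
      map_mul := BilinMap.pullback_map f A.mul B.mul φ.hom φ.hom φ.hom φ.map_mul }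
  map_id A := by ext1; exact (pullback f).map_id _
  map_comp φ ψ := by ext1; exact (pullback f).map_comp _ _

/-- The pushforward functor `f_*` on sheaves of algebras. -/
def pushforwardAlg (f : X ⟶ Y) : AlgSheaf X ⥤ AlgSheaf Y where
  obj A :=
    { mod := (pushforward f).obj A.mod
      mul :=
        { app U := LinearMap.mk₂ _ (fun a b ↦ A.mul.app (f ⁻¹ᵁ U) a b)
            (fun a b c ↦ LinearMap.map_add₂ (A.mul.app (f ⁻¹ᵁ U)) a b c)
            (fun r a b ↦ LinearMap.map_smul₂ (A.mul.app (f ⁻¹ᵁ U)) (appO f U r)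
              (show Γ(A.mod, f ⁻¹ᵁ U) from a) b)
            (fun a b c ↦ map_add (A.mul.app (f ⁻¹ᵁ U) a) b c)
            (fun r a b ↦ map_smul (A.mul.app (f ⁻¹ᵁ U) a) (appO f U r)
              (show Γ(A.mod, f ⁻¹ᵁ U) from b))
          res_app U V h := A.mul.res_app _ _ (preimage_le f h) }
      one U := A.one (f ⁻¹ᵁ U)
      res_one U V h := A.res_one _ _ (preimage_le f h)
      one_mul U := A.one_mul (f ⁻¹ᵁ U)
      mul_one U := A.mul_one (f ⁻¹ᵁ U)
      mul_assoc U := A.mul_assoc (f ⁻¹ᵁ U) }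
  map φ :=
    { hom := (pushforward f).map φ.hom
      map_one U := φ.map_one (f ⁻¹ᵁ U)
      map_mul U := φ.map_mul (f ⁻¹ᵁ U) }

/-- The canonical homomorphism `B ⟶ f_* f^* B`. -/
def unit (f : X ⟶ Y) : 𝟭 (AlgSheaf Y) ⟶ pullbackAlg f ⋙ pushforwardAlg f where
  app B :=
    { hom := (pullbackPushforwardAdjunction f).unit.app B.mod
      map_one U := (pullbackObj_one f B _ U le_rfl).trans (res_self _ _ _) |>.symm
      map_mul U a b := by
        have := B.mul.pullback_app f U a b le_rfl
        rw [res_self, res_self, res_self] at this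
        exact this.symm }
  naturality A B φ := by
    ext1
    exact (pullbackPushforwardAdjunction f).unit.naturality φ.hom

section FiberProduct

variable {A B C : AlgSheaf X} (φ : A ⟶ C) (ψ : B ⟶ C)

lemma isPullback_sections (U : X.Opens) :
    IsPullback ((Scheme.Modules.toPresheaf X ⋙ (evaluation _ _).obj (op U) ⋙ forget Ab).map
        (Limits.pullback.fst φ.hom ψ.hom))
      ((Scheme.Modules.toPresheaf X ⋙ (evaluation _ _).obj (op U) ⋙ forget Ab).map
        (Limits.pullback.snd φ.hom ψ.hom))
      ((Scheme.Modules.toPresheaf X ⋙ (evaluation _ _).obj (op U) ⋙ forget Ab).map φ.hom)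
      ((Scheme.Modules.toPresheaf X ⋙ (evaluation _ _).obj (op U) ⋙ forget Ab).map ψ.hom) := by
  have : Limits.PreservesLimitsOfSize.{0, 0} (Scheme.Modules.toPresheaf X) :=
    Limits.preservesLimitsOfSize_shrink _
  have : Limits.PreservesLimitsOfSize.{0, 0} ((evaluation X.Opensᵒᵖ Ab).obj (op U) ⋙
    forget Ab) := inferInstance
  exact ((IsPullback.of_hasPullback φ.hom ψ.hom).map (Scheme.Modules.toPresheaf X)).map
    ((evaluation X.Opensᵒᵖ Ab).obj (op U) ⋙ forget Ab)

lemma fiber_ext {U : X.Opens} {x y : Γ(Limits.pullback φ.hom ψ.hom, U)}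
    (h₁ : (Limits.pullback.fst φ.hom ψ.hom).app U x = (Limits.pullback.fst φ.hom ψ.hom).app U y)
    (h₂ : (Limits.pullback.snd φ.hom ψ.hom).app U x = (Limits.pullback.snd φ.hom ψ.hom).app U y) :
    x = y :=
  Limits.Types.ext_of_isPullback (isPullback_sections φ ψ U) h₁ h₂

lemma exists_fiber {U : X.Opens} (a : Γ(A.mod, U)) (b : Γ(B.mod, U))
    (h : φ.hom.app U a = ψ.hom.app U b) :
    ∃ x : Γ(Limits.pullback φ.hom ψ.hom, U), (Limits.pullback.fst φ.hom ψ.hom).app U x = a ∧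
      (Limits.pullback.snd φ.hom ψ.hom).app U x = b :=
  Limits.Types.exists_of_isPullback (isPullback_sections φ ψ U) a b h

end FiberProduct

end AlgSheaf

namespace AlgSheaf

section FiberProduct

variable {A B C : AlgSheaf X} (φ : A ⟶ C) (ψ : B ⟶ C)

/-- The section of the fiber product given by a compatible pair. -/
def fiberMk {U : X.Opens} (a : Γ(A.mod, U)) (b : Γ(B.mod, U))
    (h : φ.hom.app U a = ψ.hom.app U b) : Γ(Limits.pullback φ.hom ψ.hom, U) :=
  (exists_fiber φ ψ a b h).choose

@[simp] lemma fst_fiberMk {U : X.Opens} (a : Γ(A.mod, U)) (b : Γ(B.mod, U)) (h) :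
    (Limits.pullback.fst φ.hom ψ.hom).app U (fiberMk φ ψ a b h) = a :=
  (exists_fiber φ ψ a b h).choose_spec.1

@[simp] lemma snd_fiberMk {U : X.Opens} (a : Γ(A.mod, U)) (b : Γ(B.mod, U)) (h) :
    (Limits.pullback.snd φ.hom ψ.hom).app U (fiberMk φ ψ a b h) = b :=
  (exists_fiber φ ψ a b h).choose_spec.2

lemma fiber_condition {U : X.Opens} (x : Γ(Limits.pullback φ.hom ψ.hom, U)) :
    φ.hom.app U ((Limits.pullback.fst φ.hom ψ.hom).app U x) =
      ψ.hom.app U ((Limits.pullback.snd φ.hom ψ.hom).app U x) :=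
  congr(($(Limits.pullback.condition (f := φ.hom) (g := ψ.hom))).app U x)

lemma one_compat (U : X.Opens) : φ.hom.app U (A.one U) = ψ.hom.app U (B.one U) := by
  rw [φ.map_one, ψ.map_one]

lemma mul_compat {U : X.Opens} (x y : Γ(Limits.pullback φ.hom ψ.hom, U)) :
    φ.hom.app U (A.mul.app U ((Limits.pullback.fst φ.hom ψ.hom).app U x)
      ((Limits.pullback.fst φ.hom ψ.hom).app U y)) =
    ψ.hom.app U (B.mul.app U ((Limits.pullback.snd φ.hom ψ.hom).app U x)
      ((Limits.pullback.snd φ.hom ψ.hom).app U y)) := by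
  simp only [φ.map_mul, ψ.map_mul, fiber_condition]

/-- The fiber product `A ×_C B` of sheaves of algebras, with componentwise multiplication. -/
def fiber : AlgSheaf X where
  mod := Limits.pullback φ.hom ψ.hom
  mul :=
    { app U := LinearMap.mk₂ _ (fun x y ↦ fiberMk φ ψ
          (A.mul.app U ((Limits.pullback.fst φ.hom ψ.hom).app U x)
            ((Limits.pullback.fst φ.hom ψ.hom).app U y))
          (B.mul.app U ((Limits.pullback.snd φ.hom ψ.hom).app U x)
            ((Limits.pullback.snd φ.hom ψ.hom).app U y))
          (mul_compat φ ψ x y))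
        (fun _ _ _ ↦ fiber_ext φ ψ (by simp) (by simp))
        (fun _ _ _ ↦ fiber_ext φ ψ (by simp) (by simp))
        (fun _ _ _ ↦ fiber_ext φ ψ (by simp) (by simp))
        (fun _ _ _ ↦ fiber_ext φ ψ (by simp) (by simp))
      res_app U V h x y := fiber_ext φ ψ (by simp [app_res, BilinMap.res_app])
        (by simp [app_res, BilinMap.res_app]) }
  one U := fiberMk φ ψ (A.one U) (B.one U) (one_compat φ ψ U)
  res_one U V h := fiber_ext φ ψ (by simp [app_res, A.res_one]) (by simp [app_res, B.res_one])
  one_mul U a := fiber_ext φ ψ (by simp [A.one_mul]) (by simp [B.one_mul])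
  mul_one U a := fiber_ext φ ψ (by simp [A.mul_one]) (by simp [B.mul_one])
  mul_assoc U a b c := fiber_ext φ ψ (by simp [A.mul_assoc]) (by simp [B.mul_assoc])

/-- The first projection. -/
def fiberFst : fiber φ ψ ⟶ A where
  hom := Limits.pullback.fst φ.hom ψ.hom
  map_one U := fst_fiberMk φ ψ _ _ (one_compat φ ψ U)
  map_mul _ x y := fst_fiberMk φ ψ _ _ (mul_compat φ ψ x y)

/-- The second projection. -/
def fiberSnd : fiber φ ψ ⟶ B where
  hom := Limits.pullback.snd φ.hom ψ.hom
  map_one U := snd_fiberMk φ ψ _ _ (one_compat φ ψ U)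
  map_mul _ x y := snd_fiberMk φ ψ _ _ (mul_compat φ ψ x y)

variable {D : AlgSheaf X} (a : D ⟶ A) (b : D ⟶ B) (h : a ≫ φ = b ≫ ψ)

lemma fst_lift_app {U : X.Opens} (x : Γ(D.mod, U)) :
    (Limits.pullback.fst φ.hom ψ.hom).app U
      ((Limits.pullback.lift a.hom b.hom congr(Hom.hom $h)).app U x) = a.hom.app U x :=
  congr(($(Limits.pullback.lift_fst a.hom b.hom congr(Hom.hom $h))).app U x)

lemma snd_lift_app {U : X.Opens} (x : Γ(D.mod, U)) :
    (Limits.pullback.snd φ.hom ψ.hom).app U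
      ((Limits.pullback.lift a.hom b.hom congr(Hom.hom $h)).app U x) = b.hom.app U x :=
  congr(($(Limits.pullback.lift_snd a.hom b.hom congr(Hom.hom $h))).app U x)

/-- The homomorphism to the fiber product given by a compatible pair of homomorphisms. -/
def fiberLift : D ⟶ fiber φ ψ where
  hom := Limits.pullback.lift a.hom b.hom congr(Hom.hom $h)
  map_one U := fiber_ext φ ψ
    ((fst_lift_app φ ψ a b h _).trans ((a.map_one U).trans (fst_fiberMk φ ψ _ _ (one_compat φ ψ U)).symm))
    ((snd_lift_app φ ψ a b h _).trans ((b.map_one U).trans (snd_fiberMk φ ψ _ _ (one_compat φ ψ U)).symm))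
  map_mul U x y := fiber_ext φ ψ
    ((fst_lift_app φ ψ a b h _).trans ((a.map_mul U x y).trans (by
      rw [← fst_lift_app φ ψ a b h, ← fst_lift_app φ ψ a b h]
      exact (fst_fiberMk φ ψ _ _ (mul_compat φ ψ _ _)).symm)))
    ((snd_lift_app φ ψ a b h _).trans ((b.map_mul U x y).trans (by
      rw [← snd_lift_app φ ψ a b h, ← snd_lift_app φ ψ a b h]
      exact (snd_fiberMk φ ψ _ _ (mul_compat φ ψ _ _)).symm)))

lemma fiberLift_fst : fiberLift φ ψ a b h ≫ fiberFst φ ψ = a :=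
  hom_ext (Limits.pullback.lift_fst _ _ _)

lemma fiberLift_snd : fiberLift φ ψ a b h ≫ fiberSnd φ ψ = b :=
  hom_ext (Limits.pullback.lift_snd _ _ _)

lemma fiberLift_fst_assoc {E : AlgSheaf X} (c : A ⟶ E) :
    fiberLift φ ψ a b h ≫ fiberFst φ ψ ≫ c = a ≫ c := by
  rw [← Category.assoc, fiberLift_fst]

lemma fiberLift_snd_assoc {E : AlgSheaf X} (c : B ⟶ E) :
    fiberLift φ ψ a b h ≫ fiberSnd φ ψ ≫ c = b ≫ c := by
  rw [← Category.assoc, fiberLift_snd]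

lemma fiber_w : fiberFst φ ψ ≫ φ = fiberSnd φ ψ ≫ ψ :=
  hom_ext Limits.pullback.condition

lemma fiber_hom_ext {α β : D ⟶ fiber φ ψ} (h₁ : α ≫ fiberFst φ ψ = β ≫ fiberFst φ ψ)
    (h₂ : α ≫ fiberSnd φ ψ = β ≫ fiberSnd φ ψ) : α = β :=
  hom_ext (Limits.pullback.hom_ext congr(Hom.hom $h₁) congr(Hom.hom $h₂))

/-- Functoriality of fiber products of sheaves of algebras. -/
def fiberMap {A' B' C' : AlgSheaf X} (φ' : A' ⟶ C') (ψ' : B' ⟶ C') (α : A ⟶ A') (β : B ⟶ B')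
    (γ : C ⟶ C') (h₁ : φ ≫ γ = α ≫ φ') (h₂ : ψ ≫ γ = β ≫ ψ') : fiber φ ψ ⟶ fiber φ' ψ' :=
  fiberLift φ' ψ' (fiberFst φ ψ ≫ α) (fiberSnd φ ψ ≫ β) (by
    rw [Category.assoc, Category.assoc, ← h₁, ← h₂, ← Category.assoc, fiber_w, Category.assoc])

end FiberProduct

section Pinch

variable {X' Y' : Scheme.{u}} {w : X' ⟶ X} {g : X' ⟶ Y'} {f : X ⟶ Y} {u : Y' ⟶ Y}

/-- The identification `u_* g_* C = f_* w_* C` for a commutative square. -/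
def pushforwardSquare (h : w ≫ f = g ≫ u) :
    pushforwardAlg g ⋙ pushforwardAlg u ⟶ pushforwardAlg w ⋙ pushforwardAlg f where
  app C :=
    { hom := (Scheme.Modules.pushforwardComp g u).hom.app C.mod ≫
        (Scheme.Modules.pushforwardCongr h.symm).hom.app C.mod ≫
        (Scheme.Modules.pushforwardComp w f).inv.app C.mod
      map_one U := C.res_one (w ⁻¹ᵁ f ⁻¹ᵁ U) (g ⁻¹ᵁ u ⁻¹ᵁ U) congr($h ⁻¹ᵁ U).le
      map_mul U a b := C.mul.res_app (w ⁻¹ᵁ f ⁻¹ᵁ U) (g ⁻¹ᵁ u ⁻¹ᵁ U) congr($h ⁻¹ᵁ U).le a b }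
  naturality A B φ := by
    ext1
    refine hom_ext' fun U x ↦ ?_
    exact (app_res φ.hom (U := w ⁻¹ᵁ f ⁻¹ᵁ U) (V := g ⁻¹ᵁ u ⁻¹ᵁ U) congr($h ⁻¹ᵁ U).le x).symm

variable (h : w ≫ f = g ≫ u)

/-- The composite `u_* B' → u_* g_* g^* B' ≅ u_* g_* w^* A = f_* w_* w^* A` for a triple
`(B', τ : g^* B' ≅ w^* A, A)`. -/
def pinchLeft (T : Limits.CategoricalPullback (pullbackAlg g) (pullbackAlg w)) :
    (pushforwardAlg u).obj T.fst ⟶ (pushforwardAlg f).obj ((pushforwardAlg w).obj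
      ((pullbackAlg w).obj T.snd)) :=
  (pushforwardAlg u).map ((unit g).app T.fst ≫ (pushforwardAlg g).map T.iso.hom) ≫
    (pushforwardSquare h).app _

/-- The map `f_* A → f_* w_* w^* A` for a triple `(B', τ, A)`. -/
def pinchRight (T : Limits.CategoricalPullback (pullbackAlg g) (pullbackAlg w)) :
    (pushforwardAlg f).obj T.snd ⟶ (pushforwardAlg f).obj ((pushforwardAlg w).obj
      ((pullbackAlg w).obj T.snd)) :=
  (pushforwardAlg f).map ((unit w).app T.snd)

/-- The pinching functor `(B', τ, A) ↦ u_* B' ×_{h_* τ} f_* A`. -/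
def pinch : Limits.CategoricalPullback (pullbackAlg g) (pullbackAlg w) ⥤ AlgSheaf Y where
  obj T := fiber (pinchLeft h T) (pinchRight T)
  map {S T} α := fiberMap _ _ _ _ ((pushforwardAlg u).map α.fst) ((pushforwardAlg f).map α.snd)
    ((pushforwardAlg f).map ((pushforwardAlg w).map ((pullbackAlg w).map α.snd)))
    (by
      have h₁ := (pushforwardSquare h).naturality ((pullbackAlg w).map α.snd)
      have h₂ := (unit g).naturality α.fst
      have h₃ := α.w
      simp only [Functor.comp_map, Functor.id_map] at h₁ h₂
      simp only [pinchLeft, Category.assoc]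
      rw [← h₁, ← Functor.map_comp_assoc, ← Functor.map_comp_assoc, reassoc_of% h₂]
      simp only [Category.assoc, ← Functor.map_comp, h₃])
    (by
      have h₂ := (unit w).naturality α.snd
      simp only [Functor.comp_map, Functor.id_map] at h₂
      simp only [pinchRight, ← Functor.map_comp, h₂])
  map_id T := by
    apply fiber_hom_ext <;> simp [fiberMap, fiberLift_fst, fiberLift_snd]
  map_comp α β := by
    apply fiber_hom_ext
    · simp only [fiberMap, fiberLift_fst, fiberLift_fst_assoc, Category.assoc]
      simp
    · simp only [fiberMap, fiberLift_snd, fiberLift_snd_assoc, Category.assoc]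
      simp

end Pinch

end AlgSheaf

section Azumaya

/-- Finite locally free modules: locally isomorphic to `𝒪^n`. -/
def IsFiniteLocallyFree (M : X.Modules) : Prop :=
  ∀ x : X, ∃ (U : X.Opens) (_ : x ∈ U) (n : ℕ),
    Nonempty (M.restrict U.ι ≅ SheafOfModules.free (R := U.toScheme.ringCatSheaf) (ULift (Fin n)))

/-- Restriction of tensors of sections. -/
def tensorRes (M N : X.Modules) {U V : X.Opens} (h : U ≤ V) :
    Γ(M, V) ⊗[Γ(X, V)] Γ(N, V) →+ Γ(M, U) ⊗[Γ(X, U)] Γ(N, U) :=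
  TensorProduct.liftAddHom
    { toFun m :=
        { toFun n := res M h m ⊗ₜ res N h n
          map_zero' := by simp
          map_add' := by simp [TensorProduct.tmul_add] }
      map_zero' := by ext; simp
      map_add' _ _ := by ext; simp [TensorProduct.add_tmul] }
    (fun r m n ↦ by simp [res_smul, TensorProduct.smul_tmul])

@[simp] lemma tensorRes_tmul (M N : X.Modules) {U V : X.Opens} (h : U ≤ V) (m : Γ(M, V))
    (n : Γ(N, V)) : tensorRes M N h (m ⊗ₜ n) = res M h m ⊗ₜ res N h n := rfl

lemma tensor_addHom_ext {R : Type u} [CommRing R] {M N P : Type u} [AddCommGroup M] [Module R M]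
    [AddCommGroup N] [Module R N] [AddCommGroup P] {φ ψ : M ⊗[R] N →+ P}
    (h : ∀ m n, φ (m ⊗ₜ n) = ψ (m ⊗ₜ n)) : φ = ψ := by
  ext t
  induction t using TensorProduct.induction_on with
  | zero => simp
  | tmul m n => exact h m n
  | add s t hs ht => rw [map_add, map_add, hs, ht]

lemma tensorRes_self (M N : X.Modules) {U : X.Opens} (h : U ≤ U)
    (t : Γ(M, U) ⊗[Γ(X, U)] Γ(N, U)) : tensorRes M N h t = t :=
  DFunLike.congr_fun (tensor_addHom_ext (φ := tensorRes M N h) (ψ := AddMonoidHom.id _)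
    (by simp)) t

lemma tensorRes_tensorRes (M N : X.Modules) {U V W : X.Opens} (h : U ≤ V) (h' : V ≤ W)
    (t : Γ(M, W) ⊗[Γ(X, W)] Γ(N, W)) :
    tensorRes M N h (tensorRes M N h' t) = tensorRes M N (h.trans h') t :=
  DFunLike.congr_fun (tensor_addHom_ext (φ := (tensorRes M N h).comp (tensorRes M N h'))
    (ψ := tensorRes M N (h.trans h')) (by simp)) t

/-- The presheaf `U ↦ M(U) ⊗_{𝒪(U)} N(U)`, whose sheafification is `M ⊗ N`. -/
def tensorPresheaf (M N : X.Modules) : X.Opensᵒᵖ ⥤ Ab.{u} where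
  obj U := AddCommGrpCat.of (Γ(M, U.unop) ⊗[Γ(X, U.unop)] Γ(N, U.unop))
  map i := AddCommGrpCat.ofHom (tensorRes M N (leOfHom i.unop))
  map_id _ := AddCommGrpCat.hom_ext <| AddMonoidHom.ext <| tensorRes_self M N _
  map_comp i j := AddCommGrpCat.hom_ext <| AddMonoidHom.ext fun t ↦
    (tensorRes_tensorRes M N (leOfHom j.unop) (leOfHom i.unop) t).symm

/-- The sheaf `U ↦ Hom_{𝒪_U}(M|_U, N|_U)`, as a presheaf of abelian groups. -/
def homPresheaf (M N : X.Modules) : X.Opensᵒᵖ ⥤ Ab.{u} where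
  obj U := AddCommGrpCat.of (HomOn U.unop M N)
  map i := AddCommGrpCat.ofHom (HomOn.restrict (leOfHom i.unop))
  map_id _ := rfl
  map_comp _ _ := rfl

namespace AlgSheaf

variable (A : AlgSheaf X)

/-- The endomorphism `x ↦ a x b` of `A|_U`. -/
def conj {U : X.Opens} (a b : Γ(A.mod, U)) : HomOn U A.mod A.mod :=
  (A.mul.left b).comp (A.mul.right a)

lemma conj_app {U : X.Opens} (a b : Γ(A.mod, U)) (W : X.Opens) (h : W ≤ U) (x : Γ(A.mod, W)) :
    (A.conj a b).app W h x = A.mul.app W (A.mul.app W (res _ h a) x) (res _ h b) := rfl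

/-- The map `A(U) ⊗ A(U)° → End_{𝒪_U}(A|_U)`, `a ⊗ b ↦ (x ↦ a x b)`. -/
def tensorToEnd (U : X.Opens) :
    Γ(A.mod, U) ⊗[Γ(X, U)] Γ(A.mod, U) →+ HomOn U A.mod A.mod :=
  TensorProduct.liftAddHom
    { toFun a :=
        { toFun b := A.conj a b
          map_zero' := HomOn.ext' (by simp [conj_app])
          map_add' _ _ := HomOn.ext' (by simp [conj_app]) }
      map_zero' := AddMonoidHom.ext fun _ ↦ HomOn.ext' (by simp [conj_app])
      map_add' _ _ := AddMonoidHom.ext fun _ ↦ HomOn.ext' (by simp [conj_app]) }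
    (fun r a b ↦ HomOn.ext' (by simp [conj_app, res_smul]))

lemma tensorToEnd_res {U V : X.Opens} (h : U ≤ V) (t : Γ(A.mod, V) ⊗[Γ(X, V)] Γ(A.mod, V)) :
    A.tensorToEnd U (tensorRes _ _ h t) = HomOn.restrict h (A.tensorToEnd V t) :=
  DFunLike.congr_fun (tensor_addHom_ext (φ := (A.tensorToEnd U).comp (tensorRes _ _ h))
    (ψ := (HomOn.restrict h).comp (A.tensorToEnd V)) fun a b ↦ by
      change A.conj (res _ h a) (res _ h b) = HomOn.restrict h (A.conj a b)
      exact HomOn.ext' (by simp [conj_app])) t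

/-- The canonical homomorphism `a ⊗ b ↦ (x ↦ a x b)` from the presheaf tensor product of `A` and
`A°` to the sheaf `End(A)`. -/
def canonicalHom : tensorPresheaf A.mod A.mod ⟶ homPresheaf A.mod A.mod where
  app U := AddCommGrpCat.ofHom (A.tensorToEnd U.unop)
  naturality _ _ i := AddCommGrpCat.hom_ext <| AddMonoidHom.ext
    (A.tensorToEnd_res (leOfHom i.unop))

/-- Azumaya algebras: finite locally free algebras with nonzero stalks such that the canonical
homomorphism of sheaves `A ⊗ A° → End(A)`, `a ⊗ b ↦ (x ↦ a x b)`, is an isomorphism. The sheaf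
`A ⊗ A°` is the sheafification of the presheaf tensor product and `End(A)` is already a sheaf, so
this homomorphism is the sheafification of `canonicalHom`. -/
structure IsAzumaya : Prop where
  finiteLocallyFree : IsFiniteLocallyFree A.mod
  nontrivial_stalk : ∀ x : X, Nontrivial (A.mod.presheaf.stalk x)
  isIso : IsIso ((presheafToSheaf (Opens.grothendieckTopology X) Ab.{u}).map A.canonicalHom)

end AlgSheaf

end Azumaya

/-- The category of Azumaya algebras on `X`. -/
abbrev Az (X : Scheme.{u}) := ObjectProperty.FullSubcategory (AlgSheaf.IsAzumaya (X := X))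

/-- The pullback functor on Azumaya algebras. -/
def pullbackAz (f : X ⟶ Y)
    (hf : ∀ B : AlgSheaf Y, B.IsAzumaya → ((AlgSheaf.pullbackAlg f).obj B).IsAzumaya) :
    Az Y ⥤ Az X :=
  ObjectProperty.lift _ (ObjectProperty.ι _ ⋙ AlgSheaf.pullbackAlg f) fun B ↦ hf _ B.property

variable {X' Y' : Scheme.{u}} {w : X' ⟶ X} {g : X' ⟶ Y'} {f : X ⟶ Y} {u : Y' ⟶ Y}

/-- The functor `Az(Y') ×_{Az(X')} Az(X) ⥤ Alg(Y') ×_{Alg(X')} Alg(X)` forgetting the Azumaya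
property. -/
def forgetAz (hg : ∀ B : AlgSheaf Y', B.IsAzumaya → ((AlgSheaf.pullbackAlg g).obj B).IsAzumaya)
    (hw : ∀ A : AlgSheaf X, A.IsAzumaya → ((AlgSheaf.pullbackAlg w).obj A).IsAzumaya) :
    Limits.CategoricalPullback (pullbackAz g hg) (pullbackAz w hw) ⥤
      Limits.CategoricalPullback (AlgSheaf.pullbackAlg g) (AlgSheaf.pullbackAlg w) where
  obj T := ⟨T.fst.obj, T.snd.obj, (ObjectProperty.ι _).mapIso T.iso⟩
  map α := ⟨α.fst.hom, α.snd.hom, congr((ObjectProperty.ι _).map $(α.w))⟩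

/-- The pinching functor `Ψ : Az(Y') ×_{Az(X')} Az(X) ⥤ Az(Y)`. -/
def pinchAz (h : w ≫ f = g ≫ u)
    (hg : ∀ B : AlgSheaf Y', B.IsAzumaya → ((AlgSheaf.pullbackAlg g).obj B).IsAzumaya)
    (hw : ∀ A : AlgSheaf X, A.IsAzumaya → ((AlgSheaf.pullbackAlg w).obj A).IsAzumaya)
    (hΨ : ∀ T : Limits.CategoricalPullback (pullbackAz g hg) (pullbackAz w hw),
      ((AlgSheaf.pinch h).obj ((forgetAz hg hw).obj T)).IsAzumaya) :
    Limits.CategoricalPullback (pullbackAz g hg) (pullbackAz w hw) ⥤ Az Y :=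
  ObjectProperty.lift _ (forgetAz hg hw ⋙ AlgSheaf.pinch h) hΨ

end Pinching

end

open Pinching

/-!
Everything is expressed by dual bases: sections `eᵢ` and linear forms `φᵢ` on an open with `x = ∑
φᵢ(x) eᵢ`. A module is finite locally free exactly if it has dual bases locally
(`isFiniteLocallyFree_iff`), and then it has one on every affine open
(`IsFiniteLocallyFree.exists_dualBasis`). Given a dual basis of an algebra, the canonical map `A ⊗
A° → End(A)` is an isomorphism exactly if certain polynomial equations in the structure constants
are solvable (`IsInv`). The solution is unique, so it may be constructed locally, and it is
compatible with pullback (`isAzumaya_iff`). Hence pullbacks of Azumaya algebras are Azumaya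
algebras.

The square being cocartesian is used only through the functions on `Y`: they are the pairs of
functions on `Y'` and `X` that agree on `X'` (`eq_of_appO_eq`, `exists_appO_eq`). Indeed, such
pairs form a quasi-coherent algebra on `Y`, because `f`, `u` and `w` are affine. Its relative
spectrum `Z ⟶ Y` receives compatible morphisms from `Y'` and `X`, hence a section `Y ⟶ Z`, which
inverts the map from functions on `Y` to pairs. Being cartesian is used only to see that `w` is a
closed immersion.

For a triple `(B', τ, A)` of finite locally free algebras and an affine open of `Y`, the pullback
to `X'` of a dual basis of `B'` lifts along `w` to a dual basis of `A`, after enlarging it by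
elements and forms that vanish on `X'` (`DualBasis.exists_lift`). Enlarging the dual basis of `B'`
by zeros gives compatible dual bases of `B'` and `A`, and such a pair is a dual basis of the
pinched algebra (`exists_dualBasis_pinch`). If `B'` and `A` are Azumaya algebras, then the
solutions of the equations on `Y'` and `X` agree on `X'` by uniqueness, so they form a solution on
`Y`, and the pinched algebra is an Azumaya algebra (`isAzumaya_pinch`).

The functor `B ↦ (u^*B, f^*B)` is left adjoint to pinching. The unit and the counit carry dual
bases to dual bases with the same coefficients, so they are isomorphisms on finite locally free
algebras (`isIso_unitPinch`, `isIso_counit`). This gives the equivalence of categories.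

Let finally `B` be a quasi-coherent algebra on `Y` with `u^*B` and `f^*B` Azumaya algebras. By the
equivalence it suffices that `B` is finite locally free. Over an affine open the unit `η` from `B`
to the pinching of its pullbacks is surjective (`surjective_unitPinch`), and the pinching has a
dual basis, so `η` is split by a projector `π` onto its kernel. Let `I` be the ideal of functions
on `Y` that vanish on `Y'`. It is also an ideal of the functions on `X`, and therefore kills the
sections of `B` that vanish on `X`, in particular the kernel of `η`. On the other hand, the kernel
lies in `I B`, since its elements vanish on `Y'`. Hence the kernel is contained in `π(I B) = I
π(B) = 0` (`isFiniteLocallyFree_of_pullback`).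
-/

noncomputable section

namespace Pinching

open AlgebraicGeometry.Scheme.Modules (pushforward pullback pullbackPushforwardAdjunction)

variable {X Y : Scheme.{u}}

/-! ### Pulling back functions and sections -/

section PullbackSections

variable (f : X ⟶ Y)

/-- The pullback of a regular function on `U` to an open contained in `f⁻¹U`. -/
def pbO {U : Y.Opens} {V : X.Opens} (h : V ≤ f ⁻¹ᵁ U) : Γ(Y, U) →+* Γ(X, V) :=
  (resO X h).comp (appO f U)

/-- The pullback of a section of `M` on `U` to a section of `f^*M` on an open contained in
`f⁻¹U`. -/
def pbM {M : Y.Modules} {U : Y.Opens} {V : X.Opens} (h : V ≤ f ⁻¹ᵁ U) :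
    Γ(M, U) →+ Γ((pullback f).obj M, V) :=
  (res _ h).comp (toPullback f M U)

variable {f} {M N : Y.Modules} {U U' : Y.Opens} {V V' : X.Opens}

@[simp] lemma resO_pbO (h : V ≤ f ⁻¹ᵁ U) (h' : V' ≤ V) (r : Γ(Y, U)) :
    resO X h' (pbO f h r) = pbO f (h'.trans h) r := resO_resO _ _ _

@[simp] lemma pbO_resO (h : V ≤ f ⁻¹ᵁ U) (h' : U ≤ U') (r : Γ(Y, U')) :
    pbO f h (resO Y h' r) = pbO f (h.trans (preimage_le f h')) r := by
  simp [pbO, appO_res]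

lemma pbO_self (r : Γ(Y, U)) : pbO f le_rfl r = appO f U r := resO_self _ _

@[simp] lemma res_pbM (h : V ≤ f ⁻¹ᵁ U) (h' : V' ≤ V) (x : Γ(M, U)) :
    res _ h' (pbM f h x) = pbM f (h'.trans h) x := res_res _ _ _ _

@[simp] lemma pbM_res (h : V ≤ f ⁻¹ᵁ U) (h' : U ≤ U') (x : Γ(M, U')) :
    pbM f h (res M h' x) = pbM f (h.trans (preimage_le f h')) x := by
  simp [pbM, toPullback_res]

lemma pbM_self (x : Γ(M, U)) : pbM f le_rfl x = toPullback f M U x := res_self _ _ _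

@[simp] lemma pbM_smul (h : V ≤ f ⁻¹ᵁ U) (r : Γ(Y, U)) (x : Γ(M, U)) :
    pbM f h (r • x) = pbO f h r • pbM f h x := by
  simp [pbM, pbO, toPullback_smul, res_smul]

lemma map_pbM (φ : M ⟶ N) (h : V ≤ f ⁻¹ᵁ U) (x : Γ(M, U)) :
    ((pullback f).map φ).app V (pbM f h x) = pbM f h (φ.app U x) :=
  (app_res _ h _).trans (congrArg _ (pullback_map_toPullback f φ U x))

lemma adjLift_pbM {P : X.Modules} (φ : M ⟶ (pushforward f).obj P) (h : V ≤ f ⁻¹ᵁ U)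
    (x : Γ(M, U)) :
    (adjLift f φ).app V (pbM f h x) = res P h (φ.app U x) :=
  (app_res _ h _).trans (congrArg _ (adjLift_toPullback f φ U x))

/-- Homomorphisms from `f^*M` are determined by their values on the pulled back sections, since
these generate `f^*M`. -/
lemma HomOn.pbM_ext {P : X.Modules} (hV : V ≤ f ⁻¹ᵁ U) {φ ψ : HomOn V ((pullback f).obj M) P}
    (h : ∀ (W : Y.Opens) (_ : W ≤ U) (V' : X.Opens) (hV' : V' ≤ V) (hW : V' ≤ f ⁻¹ᵁ W)
      (x : Γ(M, W)), φ.app V' hV' (pbM f hW x) = ψ.app V' hV' (pbM f hW x)) : φ = ψ := by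
  refine HomOn.pullback_ext fun W V' hV' hW x ↦ ?_
  have := h (U ⊓ W) inf_le_left V' hV' (le_preimage_inf f (hV'.trans hV) hW)
    (res M inf_le_right x)
  rwa [pbM_res] at this

end PullbackSections

/-! ### Linear forms and dual bases -/

/-- A linear form on `M|_V`: a compatible family of linear maps `M(W) → 𝒪(W)` for the opens
`W ≤ V`. -/
@[ext]
structure LinForm (V : X.Opens) (M : X.Modules) where
  /-- the linear maps -/
  app : ∀ W : X.Opens, W ≤ V → (Γ(M, W) →ₗ[Γ(X, W)] Γ(X, W))
  res_app : ∀ (W W' : X.Opens) (hW : W ≤ W') (hV : W' ≤ V) (x : Γ(M, W')),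
    resO X hW (app W' hV x) = app W (hW.trans hV) (res M hW x)

variable (X) in
/-- The structure sheaf as a module over itself. -/
def unitMod : X.Modules := SheafOfModules.unit X.ringCatSheaf

/-- Sections of the structure sheaf are regular functions. -/
def unitEquiv (U : X.Opens) : Γ(unitMod X, U) ≃ₗ[Γ(X, U)] Γ(X, U) where
  toFun x := x
  invFun x := x
  map_add' _ _ := rfl
  map_smul' _ _ := rfl

lemma unitEquiv_res {U V : X.Opens} (h : U ≤ V) (x : Γ(unitMod X, V)) :
    unitEquiv U (res _ h x) = resO X h (unitEquiv V x) := rfl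

lemma res_unitEquiv_symm {U V : X.Opens} (h : U ≤ V) (x : Γ(X, V)) :
    res _ h ((unitEquiv V).symm x) = (unitEquiv U).symm (resO X h x) := rfl

namespace LinForm

variable {V : X.Opens} {M N : X.Modules}

lemma ext' {φ ψ : LinForm V M} (h : ∀ W hW x, φ.app W hW x = ψ.app W hW x) : φ = ψ := by
  ext W hW x
  exact h W hW x

/-- Linear forms are homomorphisms to the structure sheaf. -/
def toHomOn (φ : LinForm V M) : HomOn V M (unitMod X) where
  app W h := (unitEquiv W).symm.toLinearMap.comp (φ.app W h)
  res_app W W' h h' x := by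
    have := φ.res_app W W' h h' x
    simp [res_unitEquiv_symm, this]

/-- Homomorphisms to the structure sheaf are linear forms. -/
def ofHomOn (φ : HomOn V M (unitMod X)) : LinForm V M where
  app W h := (unitEquiv W).toLinearMap.comp (φ.app W h)
  res_app W W' h h' x := by
    have := φ.res_app W W' h h' x
    simp [← unitEquiv_res, this]

lemma ofHomOn_app (φ : HomOn V M (unitMod X)) (W : X.Opens) (h : W ≤ V) (x : Γ(M, W)) :
    (ofHomOn φ).app W h x = unitEquiv W (φ.app W h x) := rfl

lemma toHomOn_injective : Function.Injective (toHomOn : LinForm V M → _) := fun _ _ h ↦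
  ext' fun W hW x ↦ congr(unitEquiv W (HomOn.app $h W hW x))

/-- The restriction of a linear form. -/
def restrict {V' : X.Opens} (h : V' ≤ V) (φ : LinForm V M) : LinForm V' M where
  app W hW := φ.app W (hW.trans h)
  res_app _ _ _ _ _ := φ.res_app _ _ _ _ _

@[simp] lemma restrict_app {V' : X.Opens} (h : V' ≤ V) (φ : LinForm V M) (W : X.Opens)
    (hW : W ≤ V') (x : Γ(M, W)) : (φ.restrict h).app W hW x = φ.app W (hW.trans h) x := rfl

/-- Linear combinations of linear forms. -/
def comb {κ : Type*} [Fintype κ] (c : κ → Γ(X, V)) (φ : κ → LinForm V M) : LinForm V M where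
  app W h := ∑ k, resO X h (c k) • (φ k).app W h
  res_app W W' h h' x := by
    simp [LinearMap.sum_apply, (φ _).res_app]

lemma comb_app {κ : Type*} [Fintype κ] (c : κ → Γ(X, V)) (φ : κ → LinForm V M) (W : X.Opens)
    (h : W ≤ V) (x : Γ(M, W)) :
    (comb c φ).app W h x = ∑ k, resO X h (c k) * (φ k).app W h x := by
  simp [comb, LinearMap.sum_apply]

/-- The composition of a linear form with a homomorphism. -/
def comp (φ : LinForm V N) (ψ : HomOn V M N) : LinForm V M where
  app W h := (φ.app W h).comp (ψ.app W h)
  res_app := by simp [φ.res_app, ψ.res_app]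

@[simp] lemma comp_app (φ : LinForm V N) (ψ : HomOn V M N) (W : X.Opens) (h : W ≤ V)
    (x : Γ(M, W)) : (φ.comp ψ).app W h x = φ.app W h (ψ.app W h x) := rfl

lemma pbM_ext {f : X ⟶ Y} {U : Y.Opens} {A : Y.Modules} (hV : V ≤ f ⁻¹ᵁ U)
    {φ ψ : LinForm V ((pullback f).obj A)}
    (h : ∀ (W : Y.Opens) (_ : W ≤ U) (V' : X.Opens) (hV' : V' ≤ V) (hW : V' ≤ f ⁻¹ᵁ W)
      (x : Γ(A, W)), φ.app V' hV' (pbM f hW x) = ψ.app V' hV' (pbM f hW x)) : φ = ψ :=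
  toHomOn_injective (HomOn.pbM_ext hV fun W hW V' hV' hW' x ↦
    congr((unitEquiv V').symm $(h W hW V' hV' hW' x)))

/-- The pullback of a linear form. -/
def pullback (f : X ⟶ Y) {U : Y.Opens} {A : Y.Modules} (hV : V ≤ f ⁻¹ᵁ U) (φ : LinForm U A) :
    LinForm V ((pullback f).obj A) :=
  ofHomOn (HomOn.lift (fun W V' hV' hW ↦ (unitEquiv V').symm.toLinearMap.toAddMonoidHom.comp
      ((pbO f (le_preimage_inf f (hV'.trans hV) hW)).toAddMonoidHom.comp
        ((φ.app (U ⊓ W) inf_le_left).toAddMonoidHom.comp (res A inf_le_right))))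
    (fun W V' hV' hW r x ↦ by
      have : pbO f (le_preimage_inf f (hV'.trans hV) hW) (resO Y inf_le_right r) =
        resO X hW (appO f W r) := pbO_resO _ _ _
      simp only [LinearMap.toAddMonoidHom_coe, AddMonoidHom.coe_comp, Function.comp_apply,
        LinearEquiv.coe_coe, res_smul, map_smul, smul_eq_mul, RingHom.toAddMonoidHom_eq_coe,
        AddMonoidHom.coe_coe, map_mul, this]
      exact (unitEquiv V').symm.map_smul _ _)
    (fun W W' V' V'' hV hW hV' hW' h h' x ↦ by
      have : φ.app (U ⊓ W) inf_le_left (res A inf_le_right (res A h x)) =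
        resO Y (inf_le_inf_left U h) (φ.app (U ⊓ W') inf_le_left (res A inf_le_right x)) := by
        simp [φ.res_app]
      simp only [LinearMap.toAddMonoidHom_coe, AddMonoidHom.coe_comp, Function.comp_apply,
        LinearEquiv.coe_coe, res_unitEquiv_symm]
      congr 1
      refine (resO_pbO _ _ _).trans (((congrArg (pbO f _) this).trans (pbO_resO _ _ _)).symm)))

lemma pullback_app {f : X ⟶ Y} {U : Y.Opens} {A : Y.Modules} (hV : V ≤ f ⁻¹ᵁ U)
    (φ : LinForm U A) (W : Y.Opens) (hWU : W ≤ U) (V' : X.Opens) (hV' : V' ≤ V)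
    (hW : V' ≤ f ⁻¹ᵁ W) (x : Γ(A, W)) :
    (φ.pullback f hV).app V' hV' (pbM f hW x) = pbO f hW (φ.app W hWU x) := by
  rw [pullback, ofHomOn_app]
  refine (congrArg _ (HomOn.lift_app _ _ _ _ _ _ _ _)).trans ?_
  refine ((unitEquiv V').apply_symm_apply _).trans ?_
  refine (congrArg (pbO f _) (φ.res_app (U ⊓ W) W inf_le_right hWU x).symm).trans ?_
  exact pbO_resO _ _ _

end LinForm

/-- A dual basis of `M|_V`: sections `eᵢ` and linear forms `φᵢ` with `x = ∑ φᵢ(x) eᵢ`. It exhibits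
`M|_V` as a direct summand of a finite free module. -/
structure DualBasis (V : X.Opens) (M : X.Modules) (ι : Type*) [Fintype ι] where
  /-- the sections -/
  e : ι → Γ(M, V)
  /-- the linear forms -/
  φ : ι → LinForm V M
  sum_eq : ∀ (W : X.Opens) (h : W ≤ V) (x : Γ(M, W)),
    ∑ i, (φ i).app W h x • res M h (e i) = x

namespace DualBasis

variable {V : X.Opens} {M N : X.Modules} {ι : Type*} [Fintype ι]

/-- The restriction of a dual basis to a smaller open. -/
def restrict (D : DualBasis V M ι) {V' : X.Opens} (h : V' ≤ V) : DualBasis V' M ι where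
  e i := res M h (D.e i)
  φ i := (D.φ i).restrict h
  sum_eq W hW x := by simpa using D.sum_eq W (hW.trans h) x

lemma restrict_restrict (D : DualBasis V M ι) {V' V'' : X.Opens} (h : V' ≤ V) (h' : V'' ≤ V') :
    (D.restrict h).restrict h' = D.restrict (h'.trans h) := by
  simp only [restrict, res_res]
  rfl

lemma sum_self (D : DualBasis V M ι) (x : Γ(M, V)) :
    ∑ i, (D.φ i).app V le_rfl x • D.e i = x := by
  simpa using D.sum_eq V le_rfl x

lemma eq_of_forms (D : DualBasis V M ι) {W : X.Opens} (h : W ≤ V) {x y : Γ(M, W)}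
    (hxy : ∀ i, (D.φ i).app W h x = (D.φ i).app W h y) : x = y := by
  rw [← D.sum_eq W h x, ← D.sum_eq W h y]
  simp only [hxy]

/-- The pullback of a dual basis. -/
def pullback (f : X ⟶ Y) {U : Y.Opens} {A : Y.Modules} (D : DualBasis U A ι)
    (hV : V ≤ f ⁻¹ᵁ U) : DualBasis V ((pullback f).obj A) ι where
  e i := pbM f hV (D.e i)
  φ i := (D.φ i).pullback f hV
  sum_eq W h x := by
    let s : HomOn W ((Scheme.Modules.pullback f).obj A) ((Scheme.Modules.pullback f).obj A) :=
      { app := fun W' h' ↦ ∑ i, (((D.φ i).pullback f hV).app W' (h'.trans h)).smulRight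
          (pbM f (h'.trans (h.trans hV)) (D.e i))
        res_app := fun W₁ W₂ h₁ h₂ x ↦ by
          simp [LinearMap.sum_apply, res_smul, LinForm.res_app] }
    have : s = HomOn.ofHom (𝟙 _) W := by
      refine HomOn.pbM_ext (h.trans hV) fun T hT V' hV' hW x ↦ ?_
      have h₁ : (HomOn.ofHom (𝟙 ((Scheme.Modules.pullback f).obj A)) W).app V' hV'
        (pbM f hW x) = pbM f hW x := rfl
      rw [h₁]
      conv_rhs => rw [← D.sum_eq T hT x]
      simp [s, LinearMap.sum_apply, LinForm.pullback_app hV _ T hT V' (hV'.trans h) hW]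
    have h₂ := congr(HomOn.app $this W le_rfl x)
    simpa [s, LinearMap.sum_apply, HomOn.ofHom_app] using h₂

end DualBasis

/-! ### Local arguments for sheaves of modules -/

section Local

variable {X : Scheme.{u}} {M N : X.Modules} {V : X.Opens}

lemma res_ext {x y : Γ(M, V)}
    (h : ∀ p ∈ V, ∃ (W : X.Opens) (hW : W ≤ V), p ∈ W ∧ res M hW x = res M hW y) : x = y := by
  refine M.isSheaf.section_ext (U := op V) fun p hp ↦ ?_
  obtain ⟨W, hW, hpW, e⟩ := h p hp
  exact ⟨W, hW, hpW, e⟩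

lemma resO_ext {x y : Γ(X, V)}
    (h : ∀ p ∈ V, ∃ (W : X.Opens) (hW : W ≤ V), p ∈ W ∧ resO X hW x = resO X hW y) : x = y := by
  refine X.IsSheaf.section_ext (U := op V) fun p hp ↦ ?_
  obtain ⟨W, hW, hpW, e⟩ := h p hp
  exact ⟨W, hW, hpW, e⟩

lemma exists_le_forall {K : Type*} [Finite K] (W : K → X.Opens) {p : X} (hV : p ∈ V)
    (hW : ∀ k, p ∈ W k) : ∃ V' : X.Opens, V' ≤ V ∧ p ∈ V' ∧ ∀ k, V' ≤ W k :=
  ⟨⟨V ∩ ⋂ k, W k, V.2.inter (isOpen_iInter_of_finite fun k ↦ (W k).2)⟩, fun _ h ↦ h.1,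
    ⟨hV, Set.mem_iInter.mpr hW⟩, fun k _ h ↦ Set.mem_iInter.mp h.2 k⟩

lemma exists_glueO {ι : Type*} (U : ι → X.Opens) (hU : ∀ i, U i ≤ V) (hV : V ≤ iSup U)
    (s : ∀ i, Γ(X, U i))
    (hs : ∀ i j, resO X (inf_le_left : U i ⊓ U j ≤ U i) (s i) = resO X inf_le_right (s j)) :
    ∃ r : Γ(X, V), ∀ i, resO X (hU i) r = s i := by
  obtain ⟨r, hr, -⟩ := X.sheaf.existsUnique_gluing' U V (fun i ↦ homOfLE (hU i)) hV s
    (fun i j ↦ hs i j)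
  exact ⟨r, hr⟩

/-- A family of functions which exists locally and is unique wherever it exists, exists
globally. -/
lemma exists_of_locally_unique {K : Type*} (P : ∀ W : X.Opens, W ≤ V → (K → Γ(X, W)) → Prop)
    (hres : ∀ (W W' : X.Opens) (h : W' ≤ W) (hW : W ≤ V) (r : K → Γ(X, W)), P W hW r →
      P W' (h.trans hW) fun k ↦ resO X h (r k))
    (huniq : ∀ (W : X.Opens) (hW : W ≤ V) (r s : K → Γ(X, W)), P W hW r → P W hW s → r = s)
    (hex : ∀ p ∈ V, ∃ (W : X.Opens) (hW : W ≤ V) (r : K → Γ(X, W)), p ∈ W ∧ P W hW r) :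
    ∃ r : K → Γ(X, V), ∀ p ∈ V, ∃ (W : X.Opens) (hW : W ≤ V), p ∈ W ∧
      P W hW fun k ↦ resO X hW (r k) := by
  choose W hW r hp hP using hex
  let U : V → X.Opens := fun p ↦ W p.1 p.2
  have hUV : ∀ p, U p ≤ V := fun p ↦ hW p.1 p.2
  have hc : V ≤ iSup U := fun p hpV ↦ Opens.mem_iSup.mpr ⟨⟨p, hpV⟩, hp p hpV⟩
  have key (k : K) : ∃ s : Γ(X, V), ∀ p, resO X (hUV p) s = r p.1 p.2 k := by
    refine exists_glueO U hUV hc (fun p ↦ r p.1 p.2 k) fun p q ↦ ?_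
    exact congrFun (huniq _ (inf_le_left.trans (hUV p)) _ _
      (hres _ _ inf_le_left (hUV p) _ (hP p.1 p.2))
      (hres _ _ inf_le_right (hUV q) _ (hP q.1 q.2))) k
  choose s hs using key
  refine ⟨s, fun p hpV ↦ ⟨U ⟨p, hpV⟩, hUV _, hp p hpV, ?_⟩⟩
  simpa only [hs] using hP p hpV

lemma isIso_of_locally_bijective (ψ : M ⟶ N)
    (h : ∀ p : X, ∃ V : X.Opens, p ∈ V ∧ ∀ W ≤ V, Function.Bijective (ψ.app W)) : IsIso ψ := by
  choose V hp hV using h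
  let B : {W : X.Opens // ∃ p, W ≤ V p} → X.Opens := Subtype.val
  have hB : Opens.IsBasis (Set.range B) := by
    rw [Opens.isBasis_iff_nbhd]
    intro U x hx
    exact ⟨U ⊓ V x, ⟨⟨_, x, inf_le_right⟩, rfl⟩, ⟨hx, hp x⟩, inf_le_left⟩
  let φ : (⟨M.presheaf, M.isSheaf⟩ : TopCat.Sheaf Ab X) ⟶ ⟨N.presheaf, N.isSheaf⟩ :=
    ⟨ψ.mapPresheaf⟩
  have h₁ : IsIso φ := TopCat.Sheaf.isIso_iff_isIso_basis hB fun W ↦ by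
    obtain ⟨W, p, hW⟩ := W
    exact (ConcreteCategory.isIso_iff_bijective (ψ.app W)).mpr (hV p W hW)
  have h₂ : IsIso ((Scheme.Modules.toPresheaf X).map ψ) :=
    inferInstanceAs (IsIso ((sheafToPresheaf _ _).map φ))
  exact isIso_of_reflects_iso ψ (Scheme.Modules.toPresheaf X)

end Local

namespace DualBasis

variable {X : Scheme.{u}} {M N : X.Modules} {V : X.Opens} {ι : Type*} [Fintype ι]

lemma homOn_ext (D : DualBasis V M ι) {α β : HomOn V M N}
    (h : ∀ i, α.app V le_rfl (D.e i) = β.app V le_rfl (D.e i)) : α = β := by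
  refine HomOn.ext' fun W hW x ↦ ?_
  rw [← D.sum_eq W hW x]
  simp only [map_sum, map_smul, ← α.res_app W V hW le_rfl, ← β.res_app W V hW le_rfl, h]

/-- A homomorphism that carries one dual basis to another is bijective on sections: in both
modules a section is determined by its coefficients, and the two systems of coefficients agree. -/
lemma bijective_of_map (D : DualBasis V M ι) (D' : DualBasis V N ι) (ψ : M ⟶ N)
    (he : ∀ i, ψ.app V (D.e i) = D'.e i)
    (hφ : ∀ i W h x, (D'.φ i).app W h (ψ.app W x) = (D.φ i).app W h x) {W : X.Opens}
    (hW : W ≤ V) : Function.Bijective (ψ.app W) := by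
  constructor
  · intro x y hxy
    exact D.eq_of_forms hW fun i ↦ by rw [← hφ, ← hφ, hxy]
  · intro y
    refine ⟨∑ i, (D'.φ i).app W hW y • res M hW (D.e i), ?_⟩
    conv_rhs => rw [← D'.sum_eq W hW y]
    simp [Scheme.Modules.Hom.app_smul, app_res, he]

/-- The image of a dual basis under an isomorphism. -/
def mapIso (D : DualBasis V M ι) (ψ : M ≅ N) : DualBasis V N ι where
  e i := ψ.hom.app V (D.e i)
  φ i := (D.φ i).comp (HomOn.ofHom ψ.inv V)
  sum_eq W hW x := by
    have h₁ (y : Γ(N, W)) : ψ.hom.app W (ψ.inv.app W y) = y :=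
      congr(($(ψ.inv_hom_id)).app W y)
    conv_rhs => rw [← h₁ x, ← D.sum_eq W hW (ψ.inv.app W x)]
    simp [Scheme.Modules.Hom.app_smul, app_res, HomOn.ofHom_app]

end DualBasis

/-! ### Inverting the canonical map of an algebra with a dual basis -/

section Coeff

variable {R : Type*} [CommRing R] {C : Type*} [AddCommGroup C] [Module R C] {ι : Type*}

/-- The coefficient `(φₐ ⊗ φᵦ)(t)`. -/
def coeff (φ : ι → C →ₗ[R] R) (a b : ι) : C ⊗[R] C →ₗ[R] R :=
  TensorProduct.lift ((LinearMap.mul R R).compl₁₂ (φ a) (φ b))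

@[simp] lemma coeff_tmul (φ : ι → C →ₗ[R] R) (a b : ι) (x y : C) :
    coeff φ a b (x ⊗ₜ y) = φ a x * φ b y := rfl

end Coeff

section Algebra

variable {R : Type*} [CommRing R] {C : Type*} [AddCommGroup C] [Module R C]
  {ι : Type*} [Fintype ι]

/-- For a module `C` with a bilinear multiplication `μ` and a dual basis `e`, `φ`: the elements
`tᵢⱼ = ∑ Tᵢⱼₐᵦ eₐ ⊗ eᵦ` are mapped to the rank one endomorphisms `x ↦ φⱼ(x) eᵢ` by
`a ⊗ b ↦ (x ↦ a x b)` (the first equation), and `∑ φᵢ(a eⱼ b) tᵢⱼ = a ⊗ b` (the second one). The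
third equation normalizes the coefficients, which makes them unique although the `eᵢ` need not be
linearly independent. These equations say that the canonical map `C ⊗ C → End(C)` is bijective. -/
structure IsInv (μ : C →ₗ[R] C →ₗ[R] C) (e : ι → C) (φ : ι → C →ₗ[R] R)
    (T : ι → ι → ι → ι → R) : Prop where
  act_eq : ∀ i j m, ∑ k, ∑ l, T i j k l • μ (μ (e k) (e m)) (e l) = φ j (e m) • e i
  sum_eq : ∀ k l a b, ∑ i, ∑ j, φ i (μ (μ (e k) (e j)) (e l)) * T i j a b = φ a (e k) * φ b (e l)
  normalized : ∀ i j a b, ∑ c, ∑ d, φ a (e c) * φ b (e d) * T i j c d = T i j a b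

/-- The canonical map `a ⊗ b ↦ (x ↦ a x b)`. -/
def act (μ : C →ₗ[R] C →ₗ[R] C) : C ⊗[R] C →ₗ[R] C →ₗ[R] C :=
  TensorProduct.lift (LinearMap.mk₂ R (fun a b ↦ (μ.flip b).comp (μ a))
    (by intros; ext; simp) (by intros; ext; simp) (by intros; ext; simp) (by intros; ext; simp))

@[simp] lemma act_tmul (μ : C →ₗ[R] C →ₗ[R] C) (a b x : C) : act μ (a ⊗ₜ b) x = μ (μ a x) b := rfl

variable {μ : C →ₗ[R] C →ₗ[R] C} {e : ι → C} {φ : ι → C →ₗ[R] R}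

namespace IsInv

/-- Substituting the first equation for `S` in the second one for `T` expresses `S` in terms of `T`
alone. Hence the solution of the equations is unique. -/
lemma eq_sum {S T : ι → ι → ι → ι → R} (hS : IsInv μ e φ S) (hT : IsInv μ e φ T) (i j a b : ι) :
    S i j a b = ∑ m, ∑ n, φ m (e i) * φ j (e n) * T m n a b := by
  have h₁ (m n : ι) : φ m (e i) * φ j (e n) =
      ∑ k, ∑ l, S i j k l * φ m (μ (μ (e k) (e n)) (e l)) := by
    have := congrArg (φ m) (hS.act_eq i j n)
    simp only [map_sum, map_smul, smul_eq_mul] at this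
    rw [this, mul_comm]
  simp only [h₁, Finset.sum_mul]
  rw [← hS.normalized i j a b]
  have h₂ (k l : ι) : φ a (e k) * φ b (e l) * S i j k l =
      ∑ m, ∑ n, S i j k l * φ m (μ (μ (e k) (e n)) (e l)) * T m n a b := by
    rw [← hT.sum_eq k l a b]
    simp only [Finset.sum_mul]
    exact Finset.sum_congr rfl fun m _ ↦ Finset.sum_congr rfl fun n _ ↦ by ring
  simp only [h₂]
  calc _ = ∑ k, ∑ m, ∑ l, ∑ n, S i j k l * φ m (μ (μ (e k) (e n)) (e l)) * T m n a b :=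
        Finset.sum_congr rfl fun k _ ↦ Finset.sum_comm
    _ = ∑ m, ∑ k, ∑ l, ∑ n, S i j k l * φ m (μ (μ (e k) (e n)) (e l)) * T m n a b :=
        Finset.sum_comm
    _ = ∑ m, ∑ k, ∑ n, ∑ l, S i j k l * φ m (μ (μ (e k) (e n)) (e l)) * T m n a b :=
        Finset.sum_congr rfl fun m _ ↦ Finset.sum_congr rfl fun k _ ↦ Finset.sum_comm
    _ = _ := Finset.sum_congr rfl fun m _ ↦ Finset.sum_comm

lemma unique {S T : ι → ι → ι → ι → R} (hS : IsInv μ e φ S) (hT : IsInv μ e φ T) : S = T := by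
  funext i j a b
  rw [hS.eq_sum hT, hT.eq_sum hT]

/-- The equations are preserved by semilinear multiplicative maps compatible with the dual
bases. -/
lemma map {R' C' : Type*} [CommRing R'] [AddCommGroup C'] [Module R' C']
    {μ' : C' →ₗ[R'] C' →ₗ[R'] C'} {e' : ι → C'} {φ' : ι → C' →ₗ[R'] R'}
    {T : ι → ι → ι → ι → R} (hT : IsInv μ e φ T) (ρ : R →+* R') (f : C →+ C')
    (hsmul : ∀ r x, f (r • x) = ρ r • f x) (hmul : ∀ x y, f (μ x y) = μ' (f x) (f y))
    (he : ∀ i, f (e i) = e' i) (hφ : ∀ i x, φ' i (f x) = ρ (φ i x)) :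
    IsInv μ' e' φ' fun i j a b ↦ ρ (T i j a b) where
  act_eq i j m := by
    simpa only [map_sum, hsmul, hmul, he, ← hφ] using congrArg f (hT.act_eq i j m)
  sum_eq k l a b := by
    simpa only [map_sum, map_mul, ← hφ, hmul, he] using congrArg ρ (hT.sum_eq k l a b)
  normalized i j a b := by
    simpa only [map_sum, map_mul, ← hφ, he] using congrArg ρ (hT.normalized i j a b)

end IsInv

lemma sum_coeff (h : ∀ x, ∑ i, φ i x • e i = x) (t : C ⊗[R] C) :
    ∑ a, ∑ b, coeff φ a b t • (e a ⊗ₜ[R] e b) = t := by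
  induction t using TensorProduct.induction_on with
  | zero => simp
  | add s t hs ht => simp only [map_add, add_smul, Finset.sum_add_distrib, hs, ht]
  | tmul x y =>
    conv_rhs => rw [← h x, ← h y]
    simp only [TensorProduct.sum_tmul, TensorProduct.tmul_sum, coeff_tmul]
    refine Finset.sum_comm.trans (Finset.sum_congr rfl fun a _ ↦ Finset.sum_congr rfl fun b _ ↦ ?_)
    rw [TensorProduct.smul_tmul_smul]

/-- The equations `IsInv` hold for the coefficients of tensors that are mapped to the rank one
endomorphisms and that express all tensors `eₖ ⊗ eₗ`. -/
lemma IsInv.of_tensor (h : ∀ x, ∑ i, φ i x • e i = x) (t : ι → ι → C ⊗[R] C)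
    (h₁ : ∀ i j m, act μ (t i j) (e m) = φ j (e m) • e i)
    (h₂ : ∀ k l, ∑ i, ∑ j, φ i (μ (μ (e k) (e j)) (e l)) • t i j = e k ⊗ₜ e l) :
    IsInv μ e φ fun i j a b ↦ coeff φ a b (t i j) where
  act_eq i j m := by
    rw [← h₁ i j m]
    conv_rhs => rw [← sum_coeff h (t i j)]
    simp [LinearMap.sum_apply]
  sum_eq k l a b := by
    simpa using congrArg (coeff φ a b) (h₂ k l)
  normalized i j a b := by
    have := congrArg (coeff φ a b) (sum_coeff h (t i j))
    simp only [map_sum, map_smul, coeff_tmul, smul_eq_mul] at this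
    rw [← this]
    exact Finset.sum_congr rfl fun _ _ ↦ Finset.sum_congr rfl fun _ _ ↦ mul_comm _ _

variable (e) in
/-- The tensor with given coefficients. -/
def tensorOf (T : ι → ι → R) : C ⊗[R] C := ∑ a, ∑ b, T a b • (e a ⊗ₜ[R] e b)

lemma IsInv.act_tensorOf (h : ∀ x, ∑ i, φ i x • e i = x) {T : ι → ι → ι → ι → R}
    (hT : IsInv μ e φ T) (i j : ι) (x : C) : act μ (tensorOf e (T i j)) x = φ j x • e i := by
  have h₁ (m : ι) : act μ (tensorOf e (T i j)) (e m) = φ j (e m) • e i := by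
    simpa [tensorOf, LinearMap.sum_apply] using hT.act_eq i j m
  conv_lhs => rw [← h x]
  conv_rhs => rw [← h x]
  simp [h₁, Finset.sum_smul, mul_smul]

/-- The inverse of the canonical map sends an endomorphism `α` to `∑ φᵢ(α(eⱼ)) tᵢⱼ`. -/
lemma IsInv.sum_tensorOf (h : ∀ x, ∑ i, φ i x • e i = x) {T : ι → ι → ι → ι → R}
    (hT : IsInv μ e φ T) (t : C ⊗[R] C) :
    ∑ i, ∑ j, φ i (act μ t (e j)) • tensorOf e (T i j) = t := by
  have h₁ (k l : ι) :
      ∑ i, ∑ j, φ i (act μ (e k ⊗ₜ e l) (e j)) • tensorOf e (T i j) = e k ⊗ₜ e l := by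
    conv_rhs => rw [← sum_coeff h (e k ⊗ₜ e l)]
    simp only [act_tmul, tensorOf, Finset.smul_sum, coeff_tmul, ← hT.sum_eq k l, Finset.sum_smul,
      mul_smul]
    calc _ = ∑ i, ∑ a, ∑ j, ∑ b, φ i (μ (μ (e k) (e j)) (e l)) • T i j a b • (e a ⊗ₜ[R] e b) :=
          Finset.sum_congr rfl fun _ _ ↦ Finset.sum_comm
      _ = ∑ a, ∑ i, ∑ j, ∑ b, φ i (μ (μ (e k) (e j)) (e l)) • T i j a b • (e a ⊗ₜ[R] e b) :=
          Finset.sum_comm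
      _ = ∑ a, ∑ i, ∑ b, ∑ j, φ i (μ (μ (e k) (e j)) (e l)) • T i j a b • (e a ⊗ₜ[R] e b) :=
          Finset.sum_congr rfl fun _ _ ↦ Finset.sum_congr rfl fun _ _ ↦ Finset.sum_comm
      _ = _ := Finset.sum_congr rfl fun _ _ ↦ Finset.sum_comm
  let F : C ⊗[R] C →ₗ[R] C ⊗[R] C :=
    ∑ i, ∑ j, ((φ i).comp ((act μ).flip (e j))).smulRight (tensorOf e (T i j))
  have hF (s : C ⊗[R] C) : F s = ∑ i, ∑ j, φ i (act μ s (e j)) • tensorOf e (T i j) := by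
    simp [F, LinearMap.sum_apply]
  have h₂ (k l : ι) : F (e k ⊗ₜ e l) = e k ⊗ₜ e l := (hF _).trans (h₁ k l)
  rw [← hF]
  conv_lhs => rw [← sum_coeff h t]
  conv_rhs => rw [← sum_coeff h t]
  simp only [map_sum, map_smul, h₂]

end Algebra

/-! ### The canonical homomorphism of a sheaf of algebras -/

section Canonical

variable {X Y : Scheme.{u}}

namespace AlgSheaf

/-- The equations `IsInv` for the sections of a sheaf of algebras on an open with a dual basis. -/
abbrev IsInvOn (A : AlgSheaf X) {V : X.Opens} {ι : Type*} [Fintype ι] (D : DualBasis V A.mod ι)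
    (T : ι → ι → ι → ι → Γ(X, V)) : Prop :=
  IsInv (A.mul.app V) D.e (fun i ↦ (D.φ i).app V le_rfl) T

variable {A B : AlgSheaf X} {V V' : X.Opens} {ι : Type*} [Fintype ι]

lemma IsInvOn.restrict {D : DualBasis V A.mod ι} {T : ι → ι → ι → ι → Γ(X, V)}
    (hT : A.IsInvOn D T) (h : V' ≤ V) :
    A.IsInvOn (D.restrict h) fun i j a b ↦ resO X h (T i j a b) :=
  IsInv.map hT (resO X h) (res A.mod h) (res_smul _ _) (A.mul.res_app _ _ h) (fun _ ↦ rfl)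
    (fun i x ↦ ((D.φ i).res_app _ _ _ _ x).symm)

lemma IsInvOn.of_hom {D : DualBasis V A.mod ι} {T : ι → ι → ι → ι → Γ(X, V)}
    (hT : A.IsInvOn D T) (ψ : A ⟶ B) {D' : DualBasis V B.mod ι}
    (he : ∀ i, ψ.hom.app V (D.e i) = D'.e i)
    (hφ : ∀ i W h x, (D'.φ i).app W h (ψ.hom.app W x) = (D.φ i).app W h x) :
    B.IsInvOn D' T :=
  IsInv.map hT (RingHom.id _) (ψ.hom.app V).hom (fun r x ↦ ψ.hom.app_smul r x) (ψ.map_mul V) he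
    (fun i x ↦ hφ i V le_rfl x)

lemma IsInvOn.pullback {f : X ⟶ Y} {C : AlgSheaf Y} {U : Y.Opens} {D : DualBasis U C.mod ι}
    {T : ι → ι → ι → ι → Γ(Y, U)} (hT : C.IsInvOn D T) (hV : V ≤ f ⁻¹ᵁ U) :
    ((pullbackAlg f).obj C).IsInvOn (D.pullback f hV) fun i j a b ↦ pbO f hV (T i j a b) :=
  IsInv.map hT (pbO f hV) (pbM f hV) (pbM_smul _) (fun x y ↦ (C.mul.pullback_app f U x y hV).symm)
    (fun _ ↦ rfl) (fun i x ↦ LinForm.pullback_app hV (D.φ i) U le_rfl V le_rfl hV x)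

lemma tensorToEnd_app_self (t : Γ(A.mod, V) ⊗[Γ(X, V)] Γ(A.mod, V)) (x : Γ(A.mod, V)) :
    (A.tensorToEnd V t).app V le_rfl x = act (A.mul.app V) t x := by
  induction t using TensorProduct.induction_on with
  | zero => simp
  | add s t hs ht => simp [map_add, hs, ht]
  | tmul a b =>
    change (A.conj a b).app V le_rfl x = _
    rw [conj_app, res_self, res_self, act_tmul]

/-- The canonical homomorphism is an isomorphism of sheaves if and only if it is locally injective
and locally surjective. -/
lemma isIso_canonicalHom_iff :
    IsIso ((presheafToSheaf (Opens.grothendieckTopology X) Ab.{u}).map A.canonicalHom) ↔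
      (∀ (V : X.Opens) (t : Γ(A.mod, V) ⊗[Γ(X, V)] Γ(A.mod, V)), A.tensorToEnd V t = 0 →
        ∀ p ∈ V, ∃ (W : X.Opens) (h : W ≤ V), p ∈ W ∧ tensorRes _ _ h t = 0) ∧
      (∀ (V : X.Opens) (ψ : HomOn V A.mod A.mod), ∀ p ∈ V, ∃ (W : X.Opens) (h : W ≤ V)
        (t : Γ(A.mod, W) ⊗[Γ(X, W)] Γ(A.mod, W)), p ∈ W ∧ A.tensorToEnd W t = ψ.restrict h) := by
  rw [← GrothendieckTopology.W_iff, GrothendieckTopology.W_iff_isLocallyBijective]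
  refine and_congr ⟨fun h V t ht p hp ↦ ?_, fun h ↦ ⟨fun {V} s t hst p hp ↦ ?_⟩⟩
    ⟨fun h V ψ p hp ↦ ?_, fun h ↦ ⟨fun {V} ψ p hp ↦ ?_⟩⟩
  · obtain ⟨W, i, hi, hpW⟩ := h.equalizerSieve_mem (X := op V) t
      (0 : Γ(A.mod, V) ⊗[Γ(X, V)] Γ(A.mod, V)) (ht.trans (map_zero (A.tensorToEnd V)).symm) p hp
    exact ⟨W, leOfHom i, hpW, Eq.trans hi (map_zero (tensorRes A.mod A.mod (leOfHom i)))⟩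
  · let s' : Γ(A.mod, V.unop) ⊗[Γ(X, V.unop)] Γ(A.mod, V.unop) := s
    let t' : Γ(A.mod, V.unop) ⊗[Γ(X, V.unop)] Γ(A.mod, V.unop) := t
    obtain ⟨W, hW, hpW, e⟩ := h V.unop (s' - t')
      ((map_sub (A.tensorToEnd V.unop) s' t').trans (sub_eq_zero.mpr hst)) p hp
    refine ⟨W, homOfLE hW, ?_, hpW⟩
    exact sub_eq_zero.mp ((map_sub (tensorRes A.mod A.mod hW) s' t').symm.trans e)
  · obtain ⟨W, i, ⟨t, ht⟩, hpW⟩ := h.imageSieve_mem (U := V) ψ p hp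
    exact ⟨W, leOfHom i, t, hpW, ht⟩
  · obtain ⟨W, hW, t, hpW, e⟩ := h V ψ p hp
    exact ⟨W, homOfLE hW, ⟨t, e⟩, hpW⟩

/-- If the equations `IsInv` are locally solvable, then the canonical homomorphism is an
isomorphism. -/
lemma isIso_canonicalHom_of_isInvOn
    (h : ∀ p : X, ∃ (V : X.Opens) (n : ℕ) (D : DualBasis V A.mod (Fin n))
      (T : Fin n → Fin n → Fin n → Fin n → Γ(X, V)), p ∈ V ∧ A.IsInvOn D T) :
    IsIso ((presheafToSheaf (Opens.grothendieckTopology X) Ab.{u}).map A.canonicalHom) := by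
  refine isIso_canonicalHom_iff.mpr ⟨fun V t ht p hp ↦ ?_, fun V ψ p hp ↦ ?_⟩ <;>
  obtain ⟨W, n, D, T, hpW, hT⟩ := h p
  · refine ⟨V ⊓ W, inf_le_left, ⟨hp, hpW⟩, ?_⟩
    have hT' := hT.restrict (inf_le_right : V ⊓ W ≤ W)
    refine (hT'.sum_tensorOf ((D.restrict _).sum_self) (tensorRes _ _ inf_le_left t)).symm.trans ?_
    refine Finset.sum_eq_zero fun i _ ↦ Finset.sum_eq_zero fun j _ ↦ ?_
    rw [← tensorToEnd_app_self, tensorToEnd_res, ht]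
    simp
  · let D' := D.restrict (inf_le_right : V ⊓ W ≤ W)
    obtain ⟨T', hT'⟩ : ∃ T', A.IsInvOn D' T' := ⟨_, hT.restrict (inf_le_right : V ⊓ W ≤ W)⟩
    refine ⟨V ⊓ W, inf_le_left, ∑ i, ∑ j,
      (D'.φ i).app _ le_rfl (ψ.app (V ⊓ W) inf_le_left (D'.e j)) • tensorOf D'.e (T' i j),
      ⟨hp, hpW⟩, D'.homOn_ext fun m ↦ ?_⟩
    rw [tensorToEnd_app_self]
    simp only [map_sum, map_smul, LinearMap.sum_apply, LinearMap.smul_apply,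
      hT'.act_tensorOf D'.sum_self, HomOn.restrict_app]
    rw [Finset.sum_comm]
    conv_rhs => rw [← D'.sum_self (D'.e m)]
    simp only [map_sum, map_smul]
    refine Finset.sum_congr rfl fun j _ ↦ ?_
    conv_rhs => rw [← D'.sum_self (ψ.app _ _ (D'.e j)), Finset.smul_sum]
    exact Finset.sum_congr rfl fun i _ ↦ smul_comm _ _ _

/-- If the canonical homomorphism is an isomorphism, then the equations `IsInv` are solvable on
every open with a dual basis. The solution exists locally, and it is unique. -/
lemma exists_isInvOn
    (h : IsIso ((presheafToSheaf (Opens.grothendieckTopology X) Ab.{u}).map A.canonicalHom))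
    (D : DualBasis V A.mod ι) : ∃ T : ι → ι → ι → ι → Γ(X, V), A.IsInvOn D T := by
  obtain ⟨hinj, hsurj⟩ := isIso_canonicalHom_iff.mp h
  let P (W : X.Opens) (hW : W ≤ V) (T : ι × ι × ι × ι → Γ(X, W)) : Prop :=
    A.IsInvOn (D.restrict hW) fun i j a b ↦ T (i, j, a, b)
  obtain ⟨T, hT⟩ := exists_of_locally_unique P (fun W W' h hW r hr ↦ by
      have := IsInvOn.restrict hr h
      rwa [DualBasis.restrict_restrict] at this)
    (fun W hW r s hr hs ↦ by
      funext ⟨i, j, a, b⟩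
      exact congr_fun₃ (congrFun (IsInv.unique hr hs) i) j a b) (fun p hp ↦ by
    -- tensors `tᵢⱼ` that map to the rank one endomorphisms exist near `p`
    have h₁ (i j : ι) := hsurj V
      { app := fun W hW ↦ ((D.φ j).app W hW).smulRight (res A.mod hW (D.e i))
        res_app := fun W W' hW hV x ↦ by simp [res_smul, (D.φ j).res_app] } p hp
    choose W hW t hpW ht using h₁
    obtain ⟨V₁, hV₁, hpV₁, hle'⟩ := exists_le_forall (fun k : ι × ι ↦ W k.1 k.2) hp
      fun k ↦ hpW k.1 k.2
    have hle (i j : ι) : V₁ ≤ W i j := hle' (i, j)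
    let t₁ (i j : ι) := tensorRes A.mod A.mod (hle i j) (t i j)
    have ht₁ (i j : ι) (x : Γ(A.mod, V₁)) : act (A.mul.app V₁) (t₁ i j) x =
        (D.φ j).app V₁ hV₁ x • res A.mod hV₁ (D.e i) := by
      rw [← tensorToEnd_app_self, tensorToEnd_res, ht]
      rfl
    -- the sums `∑ φᵢ(eₖ eⱼ eₗ) tᵢⱼ` are `eₖ ⊗ eₗ` on a smaller neighbourhood of `p`
    let D₁ := D.restrict hV₁
    let d (k l : ι) := ∑ i, ∑ j, (D₁.φ i).app V₁ le_rfl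
      (A.mul.app V₁ (A.mul.app V₁ (D₁.e k) (D₁.e j)) (D₁.e l)) • t₁ i j - D₁.e k ⊗ₜ D₁.e l
    have hd (k l : ι) : A.tensorToEnd V₁ (d k l) = 0 := by
      refine D₁.homOn_ext fun m ↦ ?_
      rw [tensorToEnd_app_self]
      simp only [d, map_sub, map_sum, map_smul, LinearMap.sub_apply, LinearMap.sum_apply,
        LinearMap.smul_apply, act_tmul, HomOn.zero_app, LinearMap.zero_apply, ht₁]
      rw [sub_eq_zero, Finset.sum_comm]
      conv_rhs => rw [← D₁.sum_self (D₁.e m)]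
      simp only [map_sum, map_smul, LinearMap.sum_apply, LinearMap.smul_apply]
      refine Finset.sum_congr rfl fun j _ ↦ ?_
      conv_rhs => rw [← D₁.sum_self (A.mul.app V₁ (A.mul.app V₁ (D₁.e k) (D₁.e j)) (D₁.e l)),
        Finset.smul_sum]
      exact Finset.sum_congr rfl fun i _ ↦ smul_comm _ _ _
    choose W₂ hW₂ hpW₂ hd₂ using fun k l ↦ hinj V₁ (d k l) (hd k l) p hpV₁
    obtain ⟨V₂, hV₂, hpV₂, hle₂'⟩ := exists_le_forall (fun k : ι × ι ↦ W₂ k.1 k.2) hpV₁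
      fun k ↦ hpW₂ k.1 k.2
    have hle₂ (i j : ι) : V₂ ≤ W₂ i j := hle₂' (i, j)
    let D₂ := D₁.restrict hV₂
    have key : A.IsInvOn D₂ _ := IsInv.of_tensor (φ := fun i ↦ (D₂.φ i).app V₂ le_rfl)
      (μ := A.mul.app V₂) D₂.sum_self (fun i j ↦ tensorRes A.mod A.mod hV₂ (t₁ i j))
      (fun i j m ↦ by
        rw [← tensorToEnd_app_self, tensorToEnd_res]
        have h₂ := congrArg (res A.mod hV₂) (ht₁ i j (D₁.e m))
        rw [← tensorToEnd_app_self, HomOn.res_app] at h₂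
        refine h₂.trans ?_
        rw [res_smul, (D.φ j).res_app]
        rfl)
      (fun k l ↦ by
        have h₂ := congrArg (tensorRes A.mod A.mod (hle₂ k l)) (hd₂ k l)
        rw [tensorRes_tensorRes, map_zero] at h₂
        simp only [d, map_sub, map_sum, sub_eq_zero] at h₂
        refine Eq.trans (Finset.sum_congr rfl fun i _ ↦ Finset.sum_congr rfl fun j _ ↦ ?_) h₂
        have h₃ (r : Γ(X, V₁)) (s : Γ(A.mod, V₁) ⊗[Γ(X, V₁)] Γ(A.mod, V₁)) :
            tensorRes A.mod A.mod hV₂ (r • s) = resO X hV₂ r • tensorRes A.mod A.mod hV₂ s := by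
          induction s using TensorProduct.induction_on with
          | zero => simp
          | add s t hs ht => simp only [smul_add, map_add, hs, ht]
          | tmul a b => simp [TensorProduct.smul_tmul', res_smul]
        rw [h₃, (D₁.φ i).res_app, A.mul.res_app, A.mul.res_app]
        rfl)
    exact ⟨V₂, hV₂.trans hV₁, fun k ↦ coeff (fun i ↦ (D₂.φ i).app V₂ le_rfl) k.2.2.1 k.2.2.2
      (tensorRes A.mod A.mod hV₂ (t₁ k.1 k.2.1)), hpV₂, by
        have : D₂ = D.restrict (hV₂.trans hV₁) := D.restrict_restrict _ _
        rw [this] at key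
        exact key⟩)
  have hT' (x y : Γ(A.mod, V)) (hxy : ∀ (W : X.Opens) (hW : W ≤ V),
      P W hW (fun k ↦ resO X hW (T k)) → res A.mod hW x = res A.mod hW y) : x = y :=
    res_ext fun p hp ↦ (hT p hp).imp fun W ⟨hW, hpW, h⟩ ↦ ⟨hW, hpW, hxy W hW h⟩
  have hTO (x y : Γ(X, V)) (hxy : ∀ (W : X.Opens) (hW : W ≤ V),
      P W hW (fun k ↦ resO X hW (T k)) → resO X hW x = resO X hW y) : x = y :=
    resO_ext fun p hp ↦ (hT p hp).imp fun W ⟨hW, hpW, h⟩ ↦ ⟨hW, hpW, hxy W hW h⟩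
  refine ⟨fun i j a b ↦ T (i, j, a, b), ⟨fun i j m ↦ hT' _ _ fun W hW h ↦ ?_,
    fun k l a b ↦ hTO _ _ fun W hW h ↦ ?_, fun i j a b ↦ hTO _ _ fun W hW h ↦ ?_⟩⟩
  · simpa [res_smul, A.mul.res_app, (D.φ _).res_app, DualBasis.restrict] using h.act_eq i j m
  · simpa [A.mul.res_app, (D.φ _).res_app, DualBasis.restrict] using h.sum_eq k l a b
  · simpa [(D.φ _).res_app, DualBasis.restrict] using h.normalized i j a b

end AlgSheaf

end Canonical

/-! ### Free modules -/

section Free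

variable {X : Scheme.{u}} {n : ℕ}

variable (X n) in
/-- The free module `𝒪ⁿ`. -/
def freeMod : X.Modules := SheafOfModules.free (R := X.ringCatSheaf) (ULift.{u} (Fin n))

/-- The coordinate embeddings of `𝒪ⁿ`. -/
def freeι (i : Fin n) : unitMod X ⟶ freeMod X n :=
  SheafOfModules.ιFree (R := X.ringCatSheaf) (ULift.up.{u} i)

lemma freeMod_hom_ext {M : X.Modules} {α β : freeMod X n ⟶ M}
    (h : ∀ i, freeι i ≫ α = freeι i ≫ β) : α = β :=
  Limits.Cofan.IsColimit.hom_ext (SheafOfModules.isColimitFreeCofan _) α β fun i ↦ h i.down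

/-- The homomorphism `𝒪ⁿ ⟶ M` with given components. -/
def freeDesc {M : X.Modules} (s : Fin n → (unitMod X ⟶ M)) : freeMod X n ⟶ M :=
  Limits.Cofan.IsColimit.desc (SheafOfModules.isColimitFreeCofan _) fun i ↦ s i.down

lemma freeι_freeDesc {M : X.Modules} (s : Fin n → (unitMod X ⟶ M)) (i : Fin n) :
    freeι i ≫ freeDesc s = s i :=
  Limits.Cofan.IsColimit.fac (SheafOfModules.isColimitFreeCofan _) _ (ULift.up.{u} i)

/-- A module is free as soon as it has coordinate functions and coordinate embeddings. -/
def isoFreeMod {N : X.Modules} (π : Fin n → (N ⟶ unitMod X)) (s : Fin n → (unitMod X ⟶ N))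
    (h : ∀ i j, s i ≫ π j = if i = j then 𝟙 _ else 0) (hs : ∑ i, π i ≫ s i = 𝟙 N) :
    N ≅ freeMod X n where
  hom := ∑ i, π i ≫ freeι i
  inv := freeDesc s
  hom_inv_id := by
    rw [Preadditive.sum_comp, ← hs]
    simp [freeι_freeDesc]
  inv_hom_id := freeMod_hom_ext fun i ↦ by
    rw [← Category.assoc, freeι_freeDesc, Preadditive.comp_sum]
    simp [← Category.assoc, h, ite_comp]

/-- The coordinate functions of `𝒪ⁿ`. -/
def freeπ (i : Fin n) : freeMod X n ⟶ unitMod X :=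
  freeDesc fun j ↦ if j = i then 𝟙 _ else 0

lemma sum_freeπ_freeι : ∑ i, freeπ i ≫ freeι i = 𝟙 (freeMod X n) :=
  freeMod_hom_ext fun i ↦ by
    rw [Preadditive.comp_sum]
    simp [← Category.assoc, freeπ, freeι_freeDesc, ite_comp]

/-- The homomorphism `𝒪 ⟶ M` given by a global section. -/
def unitHom {M : X.Modules} (e : Γ(M, ⊤)) : unitMod X ⟶ M :=
  ofApp (fun U ↦ ((LinearMap.toSpanSingleton Γ(X, U) Γ(M, U) (res M le_top e)).comp
      (unitEquiv U).toLinearMap).toAddMonoidHom)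
    (fun U V h x ↦ by
      simp [unitEquiv_res, res_smul])
    (fun U r x ↦ by simp)

lemma unitHom_app {M : X.Modules} (e : Γ(M, ⊤)) (U : X.Opens) (x : Γ(unitMod X, U)) :
    (unitHom e).app U x = unitEquiv U x • res M le_top e := rfl

lemma unitHom_one {M : X.Modules} (s : unitMod X ⟶ M) :
    unitHom (s.app ⊤ ((unitEquiv ⊤).symm 1)) = s := by
  refine hom_ext' fun U x ↦ ?_
  rw [unitHom_app, ← app_res, res_unitEquiv_symm, map_one, ← Scheme.Modules.Hom.app_smul,
    ← map_smul, smul_eq_mul, mul_one, LinearEquiv.symm_apply_apply]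

lemma app_sum {M N : X.Modules} {ι : Type*} [Fintype ι] (φ : ι → (M ⟶ N)) (U : X.Opens)
    (x : Γ(M, U)) : (∑ i, φ i).app U x = ∑ i, (φ i).app U x :=
  map_sum ({ toFun := fun φ : M ⟶ N ↦ φ.app U x, map_zero' := rfl, map_add' := fun _ _ ↦ rfl } :
    (M ⟶ N) →+ Γ(N, U)) _ _

end Free

/-! ### Restriction along open immersions -/

section Restrict

variable {X Z : Scheme.{u}} (j : Z ⟶ X) [IsOpenImmersion j] (M N : X.Modules)

/-- Sections of the restriction of `M` along an open immersion are sections of `M`. -/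
def restrictEquiv (W : Z.Opens) : Γ(M.restrict j, W) ≃+ Γ(M, j ''ᵁ W) := AddEquiv.refl _

lemma restrictEquiv_smul (W : Z.Opens) (r : Γ(Z, W)) (x : Γ(M.restrict j, W)) :
    restrictEquiv j M W (r • x) = (j.appIso W).inv r • restrictEquiv j M W x := rfl

lemma restrictEquiv_res {W W' : Z.Opens} (h : W ≤ W') (x : Γ(M.restrict j, W')) :
    restrictEquiv j M W (res _ h x) =
      res M (Scheme.Hom.image_mono _ h) (restrictEquiv j M W' x) := rfl

lemma image_preimage_of_le {V W : X.Opens} (hV : V ≤ j.opensRange) (hW : W ≤ V) :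
    j ''ᵁ j ⁻¹ᵁ W = W := by
  rw [Scheme.Hom.image_preimage_eq_opensRange_inf, inf_eq_right]
  exact hW.trans hV

variable {M N}

namespace HomOn

/-- A homomorphism on the source of an open immersion gives homomorphisms on the opens contained
in its range. -/
def ofRestrict {V : X.Opens} (hV : V ≤ j.opensRange) (α : M.restrict j ⟶ N.restrict j) :
    HomOn V M N where
  app W h :=
    { toFun x := res N (image_preimage_of_le j hV h).ge (restrictEquiv j N _
        (α.app (j ⁻¹ᵁ W) ((restrictEquiv j M _).symm
          (res M (image_preimage_of_le j hV h).le x))))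
      map_add' := by simp
      map_smul' r x := by
        have : (restrictEquiv j M (j ⁻¹ᵁ W)).symm (res M (image_preimage_of_le j hV h).le (r • x)) =
            j.app W r • (restrictEquiv j M (j ⁻¹ᵁ W)).symm
              (res M (image_preimage_of_le j hV h).le x) := by
          apply (restrictEquiv j M _).injective
          rw [restrictEquiv_smul, AddEquiv.apply_symm_apply, AddEquiv.apply_symm_apply, res_smul]
          congr 1
          exact congr($(j.app_appIso_inv W) r).symm
        rw [this, Scheme.Modules.Hom.app_smul, restrictEquiv_smul, res_smul]
        congr 1
        refine (congrArg (resO X _) congr($(j.app_appIso_inv W) r)).trans ?_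
        exact (resO_resO _ _ _).trans (resO_self _ _) }
  res_app W W' hW h x := by
    have : (restrictEquiv j M (j ⁻¹ᵁ W)).symm (res M (image_preimage_of_le j hV (hW.trans h)).le
        (res M hW x)) = res _ (preimage_le j hW) ((restrictEquiv j M (j ⁻¹ᵁ W')).symm
          (res M (image_preimage_of_le j hV h).le x)) := by
      apply (restrictEquiv j M _).injective
      rw [restrictEquiv_res]
      simp
    simp only [LinearMap.coe_mk, AddHom.coe_mk]
    rw [this, app_res, restrictEquiv_res, res_res, res_res]

lemma ofRestrict_app {V : X.Opens} (hV : V ≤ j.opensRange) (α : M.restrict j ⟶ N.restrict j)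
    (W : X.Opens) (h : W ≤ V) (x : Γ(M, W)) :
    (ofRestrict j hV α).app W h x = res N (image_preimage_of_le j hV h).ge (restrictEquiv j N _
        (α.app (j ⁻¹ᵁ W) ((restrictEquiv j M _).symm
          (res M (image_preimage_of_le j hV h).le x)))) := rfl

lemma image_le {V : X.Opens} (hV : j.opensRange ≤ V) (W : Z.Opens) : j ''ᵁ W ≤ V :=
  le_trans (by rintro _ ⟨x, -, rfl⟩; exact ⟨x, rfl⟩) hV

/-- A homomorphism on an open gives a homomorphism on the source of an open immersion with range
contained in this open. -/
def toRestrict {V : X.Opens} (hV : j.opensRange ≤ V) (φ : HomOn V M N) :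
    M.restrict j ⟶ N.restrict j :=
  ofApp (fun W ↦ (restrictEquiv j N W).symm.toAddMonoidHom.comp
      ((φ.app (j ''ᵁ W) (image_le j hV W)).toAddMonoidHom.comp
        (restrictEquiv j M W).toAddMonoidHom))
    (fun _ W' h x ↦ (φ.res_app _ _ (Scheme.Hom.image_mono _ h) (image_le j hV W')
      (restrictEquiv j M W' x)).symm)
    (fun W r x ↦ (φ.app (j ''ᵁ W) (image_le j hV W)).map_smul ((j.appIso W).inv r)
      (restrictEquiv j M W x))

lemma toRestrict_app {V : X.Opens} (hV : j.opensRange ≤ V) (φ : HomOn V M N) (W : Z.Opens)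
    (x : Γ(M.restrict j, W)) : restrictEquiv j N W ((φ.toRestrict j hV).app W x) =
      φ.app (j ''ᵁ W) (image_le j hV W) (restrictEquiv j M W x) := rfl

lemma ofRestrict_toRestrict {V : X.Opens} (hV : V = j.opensRange) (φ : HomOn V M N) :
    ofRestrict j hV.le (toRestrict j hV.ge φ) = φ := by
  refine ext' fun W h x ↦ ?_
  rw [ofRestrict_app, toRestrict_app, AddEquiv.apply_symm_apply, φ.res_app, res_res, res_self]

end HomOn

/-- The structure sheaf restricts to the structure sheaf. -/
def restrictUnit : (unitMod X).restrict j ≅ unitMod Z := Scheme.Modules.restrictUnitIso j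

/-- The standard basis of a free module gives a dual basis of `M|_U`. -/
lemma exists_dualBasis_of_iso {U : X.Opens} {n : ℕ} (θ : M.restrict U.ι ≅ freeMod U n) :
    Nonempty (DualBasis U M (Fin n)) := by
  have hU : U ≤ U.ι.opensRange := by simp
  have hU' : U ≤ U.ι ''ᵁ ⊤ := by simp
  let s (i : Fin n) : unitMod U ⟶ M.restrict U.ι := freeι i ≫ θ.inv
  let π (i : Fin n) : M.restrict U.ι ⟶ unitMod U := θ.hom ≫ freeπ i
  have hs : ∑ i, π i ≫ s i = 𝟙 _ := by
    have : θ.hom ≫ (∑ i, freeπ i ≫ freeι i) ≫ θ.inv = 𝟙 _ := by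
      rw [sum_freeπ_freeι, Category.id_comp, θ.hom_inv_id]
    rw [← this, Preadditive.sum_comp, Preadditive.comp_sum]
    simp [π, s]
  refine ⟨⟨fun i ↦ res M hU' (restrictEquiv U.ι M ⊤ ((s i).app ⊤ ((unitEquiv ⊤).symm 1))),
    fun i ↦ LinForm.ofHomOn (HomOn.ofRestrict U.ι hU (π i ≫ (restrictUnit U.ι).inv)), ?_⟩⟩
  intro W hW x
  have hW' := image_preimage_of_le U.ι hU hW
  let y : Γ(M.restrict U.ι, U.ι ⁻¹ᵁ W) := (restrictEquiv U.ι M _).symm (res M hW'.le x)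
  have h₁ : ∑ i, (s i).app _ ((π i).app _ y) = y := by
    have h₂ : (∑ i, π i ≫ s i).app (U.ι ⁻¹ᵁ W) y = y := by rw [hs]; rfl
    refine Eq.trans ?_ h₂
    rw [app_sum]
    rfl
  have h₃ : res M hW'.ge (restrictEquiv U.ι M _ y) = x := by simp [y]
  conv_rhs => rw [← h₃, ← h₁, map_sum, map_sum]
  refine Finset.sum_congr rfl fun i _ ↦ ?_
  conv_rhs => rw [← unitHom_one (s i), unitHom_app, restrictEquiv_smul, res_smul,
    restrictEquiv_res, res_res]
  rw [res_res]
  rfl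

/-- A dual basis over `U` that is a basis makes `M|_U` free. -/
lemma nonempty_iso_of_dualBasis {U : X.Opens} {n : ℕ} (D : DualBasis U M (Fin n))
    (h : ∀ i k, (D.φ k).app U le_rfl (D.e i) = if i = k then 1 else 0) :
    Nonempty (M.restrict U.ι ≅ freeMod U n) := by
  have hU : U.ι.opensRange ≤ U := by simp
  have hU' : U.ι ''ᵁ ⊤ ≤ U := by simp
  let s (i : Fin n) : unitMod U ⟶ M.restrict U.ι :=
    unitHom ((restrictEquiv U.ι M ⊤).symm (res M hU' (D.e i)))
  let π (i : Fin n) : M.restrict U.ι ⟶ unitMod U :=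
    (D.φ i).toHomOn.toRestrict U.ι hU ≫ (restrictUnit U.ι).hom
  have hs (i : Fin n) (W : U.toScheme.Opens) (t : Γ(unitMod U, W)) :
      restrictEquiv U.ι M W ((s i).app W t) = (U.ι.appIso W).inv (unitEquiv W t) •
        res M (HomOn.image_le U.ι hU W) (D.e i) := by
    rw [unitHom_app, restrictEquiv_smul, restrictEquiv_res, AddEquiv.apply_symm_apply, res_res]
  have hπ (i : Fin n) (W : U.toScheme.Opens) (x : Γ(M.restrict U.ι, W)) :
      unitEquiv W ((π i).app W x) = (U.ι.appIso W).hom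
        ((D.φ i).app _ (HomOn.image_le U.ι hU W) (restrictEquiv U.ι M W x)) := rfl
  refine ⟨isoFreeMod π s (fun i k ↦ hom_ext' fun W t ↦ ?_) (hom_ext' fun W x ↦ ?_)⟩
  · apply (unitEquiv W).injective
    refine (hπ k W ((s i).app W t)).trans ?_
    rw [hs, map_smul, ← (D.φ k).res_app _ _ _ le_rfl, h, smul_eq_mul, map_mul]
    have : (U.ι.appIso W).hom ((U.ι.appIso W).inv (unitEquiv W t)) = unitEquiv W t :=
      congr($((U.ι.appIso W).inv_hom_id) _)
    rw [this]
    split_ifs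
    · simp
    · simp
  · rw [app_sum]
    apply (restrictEquiv U.ι M W).injective
    refine Eq.trans ?_ (D.sum_eq _ (HomOn.image_le U.ι hU W) (restrictEquiv U.ι M W x))
    rw [map_sum]
    refine Finset.sum_congr rfl fun i _ ↦ ?_
    refine (hs i W ((π i).app W x)).trans ?_
    congr 1
    rw [hπ]
    exact congr($((U.ι.appIso W).hom_inv_id) _)

end Restrict

/-! ### Local bases -/

section LocalBasis

variable {X : Scheme.{u}} {M : X.Modules} {V : X.Opens} {n : ℕ}

lemma isUnit_resO_basicOpen (r : Γ(X, V)) : IsUnit (resO X (X.basicOpen_le r) r) :=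
  RingedSpace.isUnit_res_basicOpen X.toLocallyRingedSpace.toRingedSpace r

lemma LinForm.exists_add_mul (φ ψ : LinForm V M) (d : Γ(X, V)) : ∃ χ : LinForm V M,
    ∀ W h x, χ.app W h x = φ.app W h x + resO X h d * ψ.app W h x :=
  ⟨comb ![1, d] ![φ, ψ], fun W h x ↦ by simp [comb_app]⟩

/-- A relation between the sections of a dual basis with an invertible coefficient makes one of
them superfluous. -/
lemma DualBasis.exists_of_relation (D : DualBasis V M (Fin (n + 1))) (c : Fin (n + 1) → Γ(X, V))
    (hc : ∑ i, c i • D.e i = 0) (i₀ : Fin (n + 1)) (hu : IsUnit (c i₀)) :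
    Nonempty (DualBasis V M (Fin n)) := by
  obtain ⟨v, hv⟩ := hu.exists_left_inv
  have he : D.e i₀ = ∑ k, (-(v * c (i₀.succAbove k))) • D.e (i₀.succAbove k) := by
    have := congrArg (v • ·) hc
    simp only [Fin.sum_univ_succAbove _ i₀, smul_add, smul_zero, Finset.smul_sum, smul_smul, hv,
      one_smul] at this
    simp only [neg_smul, Finset.sum_neg_distrib]
    exact eq_neg_of_add_eq_zero_left this
  choose χ hχ using fun k ↦ LinForm.exists_add_mul (D.φ (i₀.succAbove k)) (D.φ i₀)
    (-(v * c (i₀.succAbove k)))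
  refine ⟨⟨fun k ↦ D.e (i₀.succAbove k), χ, fun W h x ↦ ?_⟩⟩
  conv_rhs => rw [← D.sum_eq W h x]
  rw [Fin.sum_univ_succAbove _ i₀, he]
  simp only [hχ, add_smul, Finset.sum_add_distrib, map_sum, res_smul, Finset.smul_sum, smul_smul]
  rw [add_comm]
  simp only [mul_comm]

/-- The matrix of a dual basis is idempotent. -/
lemma DualBasis.matrix_mul_self (D : DualBasis V M (Fin n)) :
    (Matrix.of fun i k ↦ (D.φ k).app V le_rfl (D.e i)) *
      (Matrix.of fun i k ↦ (D.φ k).app V le_rfl (D.e i)) =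
      Matrix.of fun i k ↦ (D.φ k).app V le_rfl (D.e i) := by
  ext i k
  simp only [Matrix.mul_apply, Matrix.of_apply]
  conv_rhs => rw [← D.sum_self (D.e i)]
  simp

/-- Near every point, a module with a dual basis has a basis: a dual basis of minimal length on the
neighbourhoods of the point has an invertible matrix near the point, and an invertible idempotent
matrix is the identity. -/
lemma DualBasis.exists_basis (D : DualBasis V M (Fin n)) {p : X} (hp : p ∈ V) :
    ∃ (W : X.Opens) (m : ℕ) (E : DualBasis W M (Fin m)), p ∈ W ∧
      ∀ i k, (E.φ k).app W le_rfl (E.e i) = if i = k then 1 else 0 := by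
  classical
  have hex : ∃ m : ℕ, ∃ W : X.Opens, p ∈ W ∧ Nonempty (DualBasis W M (Fin m)) :=
    ⟨n, V, hp, ⟨D⟩⟩
  obtain ⟨W, hpW, ⟨E⟩⟩ := Nat.find_spec hex
  have hmin := fun k ↦ Nat.find_min hex (m := k)
  generalize Nat.find hex = m at E hmin
  let A : Matrix (Fin m) (Fin m) Γ(X, W) := Matrix.of fun i k ↦ (E.φ k).app W le_rfl (E.e i)
  have hrel (i : Fin m) : ∑ k, (A i k - if i = k then 1 else 0) • E.e k = 0 := by
    simp only [sub_smul, Finset.sum_sub_distrib, sub_eq_zero]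
    refine (E.sum_self (E.e i)).trans ?_
    simp
  have hzero (i k : Fin m) : X.evaluation W p hpW (A i k - if i = k then 1 else 0) = 0 := by
    by_contra hne
    obtain ⟨m, rfl⟩ : ∃ m', m = m' + 1 := ⟨m - 1, by have := i.pos; omega⟩
    rw [← ne_eq, X.evaluation_ne_zero_iff_mem_basicOpen] at hne
    refine hmin m (by omega) ⟨_, hne, (E.restrict (X.basicOpen_le _)).exists_of_relation
      (fun k ↦ resO X (X.basicOpen_le _) (A i k - if i = k then 1 else 0)) ?_ k
      (isUnit_resO_basicOpen _)⟩
    have := congrArg (res M (X.basicOpen_le (A i k - if i = k then 1 else 0))) (hrel i)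
    simp only [map_sum, res_smul, map_zero] at this
    exact this
  have hA : (X.evaluation W p hpW).hom.mapMatrix A = 1 := by
    ext i k
    have := hzero i k
    rw [map_sub, sub_eq_zero] at this
    refine this.trans ?_
    rw [Matrix.one_apply]
    split_ifs <;> simp
  have hdet : p ∈ X.basicOpen A.det := by
    rw [← X.evaluation_ne_zero_iff_mem_basicOpen p hpW]
    have := RingHom.map_det (X.evaluation W p hpW).hom A
    rw [hA, Matrix.det_one] at this
    exact this.trans_ne one_ne_zero
  refine ⟨_, m, E.restrict (X.basicOpen_le A.det), hdet, ?_⟩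
  have h₁ := (E.restrict (X.basicOpen_le A.det)).matrix_mul_self
  set B : Matrix (Fin m) (Fin m) Γ(X, X.basicOpen A.det) := Matrix.of fun i k ↦
    ((E.restrict (X.basicOpen_le A.det)).φ k).app _ le_rfl
      ((E.restrict (X.basicOpen_le A.det)).e i) with hB
  have h₂ : B = (resO X (X.basicOpen_le A.det)).mapMatrix A := by
    ext i k
    exact ((E.φ k).res_app _ _ _ _ _).symm
  have h₃ : IsUnit B := by
    rw [Matrix.isUnit_iff_isUnit_det, h₂, ← RingHom.map_det]
    exact isUnit_resO_basicOpen _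
  have h₄ : B = 1 := h₃.mul_left_cancel (by rw [h₁, mul_one])
  intro i k
  rw [← Matrix.one_apply, ← h₄]
  rfl

/-- Finite locally free modules are the modules that have dual bases locally. -/
lemma isFiniteLocallyFree_iff : IsFiniteLocallyFree M ↔
    ∀ p : X, ∃ (V : X.Opens) (n : ℕ), p ∈ V ∧ Nonempty (DualBasis V M (Fin n)) := by
  constructor
  · intro h p
    obtain ⟨V, hp, n, ⟨θ⟩⟩ := h p
    exact ⟨V, n, hp, exists_dualBasis_of_iso θ⟩
  · intro h p
    obtain ⟨V, n, hp, ⟨D⟩⟩ := h p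
    obtain ⟨W, m, E, hpW, hE⟩ := D.exists_basis hp
    exact ⟨W, hpW, m, nonempty_iso_of_dualBasis E hE⟩

end LocalBasis

/-! ### Quasi-coherent modules on affine opens -/

section Affine

variable {X : Scheme.{u}} {M N : X.Modules} {U : X.Opens}

lemma image_fromSpec_top (hU : IsAffineOpen U) : hU.fromSpec ''ᵁ ⊤ = U := by
  rw [Scheme.Hom.image_top_eq_opensRange, hU.opensRange_fromSpec]

/-- The function on an open of `Spec Γ(X, U)` given by a ring element `r` is the restriction of `r`.
-/
lemma appIso_fromSpec (hU : IsAffineOpen U) (W : (Spec Γ(X, U)).Opens)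
    (h : hU.fromSpec ''ᵁ W ≤ U) (r : Γ(X, U)) :
    (hU.fromSpec.appIso W).inv ((Spec Γ(X, U)).presheaf.map W.leTop.op
      ((Scheme.ΓSpecIso Γ(X, U)).inv r)) = resO X h r := by
  have hW : W ≤ hU.fromSpec ⁻¹ᵁ U := by
    rw [hU.fromSpec_preimage_self]
    exact le_top
  have h₁ : (Spec Γ(X, U)).presheaf.map W.leTop.op ((Scheme.ΓSpecIso Γ(X, U)).inv r) =
      resO _ hW (hU.fromSpec.app U r) := by
    rw [hU.fromSpec_app_self_apply]
    exact (resO_resO (X := Spec Γ(X, U)) hW hU.fromSpec_preimage_self.le _).symm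
  have h₂ : hU.fromSpec ''ᵁ W ≤ hU.fromSpec ''ᵁ hU.fromSpec ⁻¹ᵁ U := Scheme.Hom.image_mono _ hW
  have h₃ (y : Γ(Spec Γ(X, U), hU.fromSpec ⁻¹ᵁ U)) : (hU.fromSpec.appIso W).inv (resO _ hW y) =
      resO X h₂ ((hU.fromSpec.appIso (hU.fromSpec ⁻¹ᵁ U)).inv y) :=
    congr($(Scheme.Hom.appIso_inv_naturality hU.fromSpec (homOfLE hW).op) y)
  rw [h₁, h₃]
  refine (congrArg (resO X h₂) congr($(hU.fromSpec.app_appIso_inv U) r)).trans ?_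
  exact resO_resO _ _ _

lemma smul_restrict_fromSpec (hU : IsAffineOpen U) (W : (Spec Γ(X, U)).Opens)
    (h : hU.fromSpec ''ᵁ W ≤ U) (r : Γ(X, U)) (x : Γ(M.restrict hU.fromSpec, W)) :
    restrictEquiv hU.fromSpec M W (r • x) =
      resO X h r • restrictEquiv hU.fromSpec M W x := by
  rw [← appIso_fromSpec hU W h r, ← restrictEquiv_smul]
  rfl

section Spec

variable {R : CommRingCat.{u}} {P Q : (Spec R).Modules}

lemma toOpen_fromTildeΓ (x : Γ(P, ⊤)) :
    P.fromTildeΓ.app ⊤ (tilde.toOpen ((modulesSpecToSheaf.obj P).presheaf.obj (op ⊤)) ⊤ x) = x :=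
  (congr($(Scheme.Modules.toOpen_fromTildeΓ_app P ⊤) x)).trans (res_self P le_top x)

/-- Homomorphisms from a quasi-coherent module on an affine scheme are determined by their values
on global sections. -/
lemma spec_hom_ext (hP : P.IsQuasicoherent) {α β : P ⟶ Q}
    (h : ∀ x : Γ(P, ⊤), α.app ⊤ x = β.app ⊤ x) : α = β := by
  have : IsIso P.fromTildeΓ := Scheme.Modules.isIso_fromTildeΓ_of_isQuasicoherent _
  rw [← cancel_epi P.fromTildeΓ]
  have h₁ : moduleSpecΓFunctor.map α = moduleSpecΓFunctor.map β := by
    ext x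
    exact h x
  have h₂ (α : P ⟶ Q) : P.fromTildeΓ ≫ α = tilde.map (moduleSpecΓFunctor.map α) ≫ Q.fromTildeΓ :=
    (Scheme.Modules.fromTildeΓNatTrans.naturality α).symm
  rw [h₂, h₂, h₁]

/-- Linear maps between global sections extend to homomorphisms from a quasi-coherent module. -/
lemma spec_exists_hom (hP : P.IsQuasicoherent) (L : Γ(P, ⊤) →ₗ[R] Γ(Q, ⊤)) :
    ∃ α : P ⟶ Q, ∀ x, α.app ⊤ x = L x := by
  have : IsIso P.fromTildeΓ := Scheme.Modules.isIso_fromTildeΓ_of_isQuasicoherent _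
  let P₀ : ModuleCat R := (modulesSpecToSheaf.obj P).presheaf.obj (op ⊤)
  let Q₀ : ModuleCat R := (modulesSpecToSheaf.obj Q).presheaf.obj (op ⊤)
  let L' : P₀ ⟶ Q₀ := @ModuleCat.ofHom R _ P₀ Q₀ _ _ _ _ L
  let α : P ⟶ Q := inv P.fromTildeΓ ≫ tilde.map L' ≫ Q.fromTildeΓ
  have hα : P.fromTildeΓ ≫ α = tilde.map L' ≫ Q.fromTildeΓ := IsIso.hom_inv_id_assoc _ _
  refine ⟨α, fun x ↦ ?_⟩
  have h₁ := congr(($hα).app ⊤ (tilde.toOpen P₀ ⊤ x))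
  have h₂ : (tilde.map L').app ⊤ (tilde.toOpen P₀ ⊤ x) = tilde.toOpen Q₀ ⊤ (L x) :=
    congr($(tilde.toOpen_map_app L' ⊤) x)
  have h₃ : (P.fromTildeΓ ≫ α).app ⊤ (tilde.toOpen P₀ ⊤ x) = α.app ⊤ x :=
    congrArg (α.app ⊤) (toOpen_fromTildeΓ x)
  have h₄ : (tilde.map L' ≫ Q.fromTildeΓ).app ⊤ (tilde.toOpen P₀ ⊤ x) = L x :=
    (congrArg (Q.fromTildeΓ.app ⊤) h₂).trans (toOpen_fromTildeΓ (L x))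
  exact h₃.symm.trans (h₁.trans h₄)

end Spec

/-- Global sections over the spectrum of the coordinate ring of an affine open `U` are sections
over `U`. -/
def specSections (hU : IsAffineOpen U) (M : X.Modules) :
    Γ(M.restrict hU.fromSpec, ⊤) ≃ₗ[Γ(X, U)] Γ(M, U) where
  toFun x := res M (image_fromSpec_top hU).ge (restrictEquiv hU.fromSpec M ⊤ x)
  invFun x := (restrictEquiv hU.fromSpec M ⊤).symm (res M (image_fromSpec_top hU).le x)
  left_inv x := by simp
  right_inv x := by simp
  map_add' x y := by simp
  map_smul' r x := by
    rw [smul_restrict_fromSpec hU ⊤ (image_fromSpec_top hU).le r x]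
    simp [res_smul]

lemma isQuasicoherent_restrict {Z : Scheme.{u}} (j : Z ⟶ X) [IsOpenImmersion j]
    (hM : M.IsQuasicoherent) : (M.restrict j).IsQuasicoherent :=
  Scheme.Modules.isQuasicoherent_restrictFunctor j M

/-- For a quasi-coherent module and an affine open `U`, homomorphisms on `U` are determined by
their values on sections over `U`. -/
lemma HomOn.ext_of_isAffineOpen (hU : IsAffineOpen U) (hM : M.IsQuasicoherent) {φ ψ : HomOn U M N}
    (h : ∀ x, φ.app U le_rfl x = ψ.app U le_rfl x) : φ = ψ := by
  have hr := hU.opensRange_fromSpec.symm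
  rw [← HomOn.ofRestrict_toRestrict hU.fromSpec hr φ,
    ← HomOn.ofRestrict_toRestrict hU.fromSpec hr ψ]
  congr 1
  refine spec_hom_ext (isQuasicoherent_restrict _ hM) fun x ↦ ?_
  apply (restrictEquiv hU.fromSpec N ⊤).injective
  rw [HomOn.toRestrict_app, HomOn.toRestrict_app]
  have := h (specSections hU M x)
  have := congrArg (res N (image_fromSpec_top hU).le) this
  rw [φ.res_app, ψ.res_app] at this
  have h₁ : res M (image_fromSpec_top hU).le (specSections hU M x) =
    restrictEquiv hU.fromSpec M ⊤ x := (res_res _ _ _ _).trans (res_self _ _ _)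
  rwa [h₁] at this

/-- For a quasi-coherent module and an affine open `U`, linear maps between sections over `U`
extend to homomorphisms on `U`. -/
lemma HomOn.exists_of_isAffineOpen (hU : IsAffineOpen U) (hM : M.IsQuasicoherent)
    (L : Γ(M, U) →ₗ[Γ(X, U)] Γ(N, U)) : ∃ φ : HomOn U M N, ∀ x, φ.app U le_rfl x = L x := by
  obtain ⟨α, hα⟩ := spec_exists_hom (isQuasicoherent_restrict _ hM)
    ((specSections hU N).symm.toLinearMap.comp (L.comp (specSections hU M).toLinearMap))
  let φ := HomOn.ofRestrict hU.fromSpec hU.opensRange_fromSpec.ge α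
  refine ⟨φ, fun x ↦ ?_⟩
  have h₀ : hU.fromSpec ⁻¹ᵁ U = ⊤ := hU.fromSpec_preimage_self
  have h₁ := hα ((specSections hU M).symm x)
  have h₂ := congrArg (specSections hU N) h₁
  simp only [LinearMap.comp_apply, LinearEquiv.coe_coe, LinearEquiv.apply_symm_apply] at h₂
  rw [← h₂, HomOn.ofRestrict_app]
  have h₃ : (restrictEquiv hU.fromSpec M _).symm (res M
      (image_preimage_of_le hU.fromSpec hU.opensRange_fromSpec.ge le_rfl).le x) =
      res _ h₀.le ((specSections hU M).symm x) := by
    apply (restrictEquiv hU.fromSpec M _).injective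
    rw [restrictEquiv_res]
    exact (res_res M (Scheme.Hom.image_mono _ h₀.le) (image_fromSpec_top hU).le x).symm
  rw [h₃, app_res, restrictEquiv_res, res_res]
  rfl

end Affine

/-! ### Finite locally free modules are quasi-coherent -/

section LocallyFree

variable {X : Scheme.{u}} {M N : X.Modules} {U : X.Opens}

/-- The presentation of a free module without relations. -/
def freePresentation (R : Sheaf (Opens.grothendieckTopology X) RingCat.{u}) (I : Type u) :
    (SheafOfModules.free (R := R) I).Presentation where
  generators := SheafOfModules.free.generatingSections (R := R) I
  relations.I := ULift Empty
  relations.s j := Empty.rec _ j.down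
  relations.epi :=
    have : IsIso (SheafOfModules.free.generatingSections (R := R) I).π := inferInstance
    Limits.IsZero.epi (Limits.IsZero.of_iso (Limits.isZero_zero _) (Limits.kernel.ofMono _)) _

/-- A presentation of the restriction of `M` to an open `U`, in terms of the site of opens
over `U`. -/
def overPresentation (n : ℕ) (θ : M.restrict U.ι ≅ freeMod U n) :
    (SheafOfModules.over (R := X.ringCatSheaf) M U).Presentation :=
  let e := Scheme.Modules.overEquiv U
  let F : SheafOfModules.{u} U.toScheme.ringCatSheaf ⥤ SheafOfModules.{u} (X.ringCatSheaf.over U) :=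
    e.inverse
  have : Limits.PreservesColimitsOfSize.{u, u} F :=
    e.symm.toAdjunction.leftAdjoint_preservesColimits
  let η : SheafOfModules.unit (X.ringCatSheaf.over U) ≅
      e.inverse.obj (SheafOfModules.unit U.toScheme.ringCatSheaf) :=
    e.unitIso.app _ ≪≫ e.inverse.mapIso
      ((Scheme.Modules.overFunctorEquiv U).app (SheafOfModules.unit X.ringCatSheaf) ≪≫
        Scheme.Modules.restrictUnitIso U.ι)
  SheafOfModules.Presentation.ofIsIso.{u, u, u}
    (e.inverse.mapIso (θ.symm ≪≫ ((Scheme.Modules.overFunctorEquiv U).app M).symm) ≪≫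
      (e.unitIso.app _).symm).hom
    ((freePresentation U.toScheme.ringCatSheaf (ULift.{u} (Fin n))).map F η)

lemma IsFiniteLocallyFree.isQuasicoherent (h : IsFiniteLocallyFree M) : M.IsQuasicoherent := by
  choose U hU n hn using h
  let D : SheafOfModules.QuasicoherentData (R := X.ringCatSheaf) M :=
    { I := X
      X := U
      coversTop := by
        rw [Opens.coversTop_iff]
        exact top_le_iff.mp fun x _ ↦ Opens.mem_iSup.mpr ⟨x, hU x⟩
      presentation i := overPresentation (n i) (hn i).some }
  exact D.isQuasicoherent

end LocallyFree

/-! ### Dual bases on affine opens -/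

section AffineDualBasis

variable {X : Scheme.{u}} {M N : X.Modules} {U : X.Opens}

/-- The sections of a quasi-coherent module on a basic open of an affine scheme are the localization
of its global sections. -/
lemma spec_isLocalizing {R : CommRingCat.{u}} {P : (Spec R).Modules} (hP : P.IsQuasicoherent)
    (r : R) {D : (Spec R).Opens} (hD : D = PrimeSpectrum.basicOpen r) :
    (∀ x : Γ(P, ⊤), res P (le_top : D ≤ ⊤) x = 0 → ∃ k : ℕ, r ^ k • x = 0) ∧
      ∀ y : Γ(P, D), ∃ (k : ℕ) (x : Γ(P, ⊤)), res P le_top x = r ^ k • y := by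
  have hl : IsLocalizing (modulesSpecToSheaf.obj P) := by
    rw [← isIso_fromTildeΓ_iff_isLocalizing]
    exact Scheme.Modules.isIso_fromTildeΓ_of_isQuasicoherent _
  subst hD
  have hr := hl r
  refine ⟨fun x hx ↦ ?_, fun y ↦ ?_⟩
  · obtain ⟨⟨_, k, rfl⟩, hs⟩ := (IsLocalizedModule.eq_zero_iff (.powers r)
      ((modulesSpecToSheaf.obj P).obj.map (PrimeSpectrum.basicOpen r).leTop.op).hom).mp hx
    exact ⟨k, hs⟩
  · obtain ⟨⟨x, _, k, rfl⟩, hs⟩ := hr.surj y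
    exact ⟨k, x, hs.symm⟩

lemma exists_pow_smul_eq_zero (hU : IsAffineOpen U) (hM : M.IsQuasicoherent) (r : Γ(X, U))
    (x : Γ(M, U)) (hx : res M (X.basicOpen_le r) x = 0) : ∃ k : ℕ, r ^ k • x = 0 := by
  obtain ⟨D, hD⟩ : ∃ D : (Spec Γ(X, U)).Opens, D = PrimeSpectrum.basicOpen r := ⟨_, rfl⟩
  have h₀ : hU.fromSpec ''ᵁ D = X.basicOpen r := hD ▸ hU.fromSpec_image_basicOpen r
  obtain ⟨k, hk⟩ := (spec_isLocalizing (isQuasicoherent_restrict hU.fromSpec hM) r hD).1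
    ((specSections hU M).symm x) (by
      apply (restrictEquiv _ _ _).injective
      rw [restrictEquiv_res, map_zero]
      refine (res_res M _ (image_fromSpec_top hU).le x).trans ?_
      rw [← res_res M h₀.le (X.basicOpen_le r), hx, map_zero])
  refine ⟨k, ?_⟩
  simpa using congrArg (specSections hU M) hk

lemma exists_res_eq_pow_smul (hU : IsAffineOpen U) (hM : M.IsQuasicoherent) (r : Γ(X, U))
    (y : Γ(M, X.basicOpen r)) : ∃ (k : ℕ) (x : Γ(M, U)),
      res M (X.basicOpen_le r) x = resO X (X.basicOpen_le r) r ^ k • y := by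
  obtain ⟨D, hD⟩ : ∃ D : (Spec Γ(X, U)).Opens, D = PrimeSpectrum.basicOpen r := ⟨_, rfl⟩
  have h₀ : hU.fromSpec ''ᵁ D = X.basicOpen r := hD ▸ hU.fromSpec_image_basicOpen r
  obtain ⟨k, x', h₁⟩ := (spec_isLocalizing (isQuasicoherent_restrict hU.fromSpec hM) r hD).2
    ((restrictEquiv _ _ _).symm (res M h₀.le y))
  refine ⟨k, specSections hU M x', ?_⟩
  have h₂ := congrArg (restrictEquiv _ _ _) h₁
  rw [smul_restrict_fromSpec hU _ (h₀.le.trans (X.basicOpen_le r)), restrictEquiv_res,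
    AddEquiv.apply_symm_apply] at h₂
  have h₃ := congrArg (res M h₀.ge) h₂
  rw [res_smul, resO_resO, res_res, res_res, res_self, map_pow] at h₃
  rw [← h₃]
  exact res_res _ _ _ _

/-- On an affine open, a dual basis of the module of sections of a quasi-coherent module extends to
the sheaf. -/
lemma exists_dualBasis_of_sections (hU : IsAffineOpen U) (hM : M.IsQuasicoherent) {ι : Type*}
    [Fintype ι] (e : ι → Γ(M, U)) (L : ι → Γ(M, U) →ₗ[Γ(X, U)] Γ(X, U))
    (h : ∀ x, ∑ i, L i x • e i = x) :
    ∃ D : DualBasis U M ι, D.e = e ∧ ∀ i x, (D.φ i).app U le_rfl x = L i x := by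
  choose φ hφ using fun i ↦ HomOn.exists_of_isAffineOpen hU hM
    ((unitEquiv U).symm.toLinearMap.comp (L i))
  let s : HomOn U M M :=
    { app := fun W hW ↦ ∑ i, ((LinForm.ofHomOn (φ i)).app W hW).smulRight (res M hW (e i))
      res_app := fun W W' hW h x ↦ by
        simp [LinearMap.sum_apply, res_smul, LinForm.res_app] }
  have hs : s = HomOn.ofHom (𝟙 M) U := by
    refine HomOn.ext_of_isAffineOpen hU hM fun x ↦ ?_
    refine Eq.trans ?_ (h x)
    simp [s, LinearMap.sum_apply, LinForm.ofHomOn_app, hφ]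
  refine ⟨⟨e, fun i ↦ LinForm.ofHomOn (φ i), fun W hW x ↦ ?_⟩, rfl, fun i x ↦ ?_⟩
  · have := congr(HomOn.app $hs W hW x)
    simpa [s, LinearMap.sum_apply, HomOn.ofHom_app] using this
  · simp [LinForm.ofHomOn_app, hφ]

lemma DualBasis.projective {n : ℕ} (D : DualBasis U M (Fin n)) :
    Module.Finite Γ(X, U) Γ(M, U) ∧ Module.Projective Γ(X, U) Γ(M, U) := by
  let π : (Fin n → Γ(X, U)) →ₗ[Γ(X, U)] Γ(M, U) := Fintype.linearCombination _ D.e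
  let σ : Γ(M, U) →ₗ[Γ(X, U)] (Fin n → Γ(X, U)) := LinearMap.pi fun i ↦ (D.φ i).app U le_rfl
  have h : π.comp σ = LinearMap.id := by
    ext x
    exact D.sum_self x
  exact ⟨Module.Finite.of_surjective π fun x ↦ ⟨σ x, congr($h x)⟩,
    Module.Projective.of_split σ π h⟩

/-- A finite locally free module has a dual basis on every affine open. -/
lemma IsFiniteLocallyFree.exists_dualBasis (hM : IsFiniteLocallyFree M)
    (hU : IsAffineOpen U) : ∃ n, Nonempty (DualBasis U M (Fin n)) := by
  have hq := hM.isQuasicoherent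
  let s : Set Γ(X, U) := {r | ∃ n, Nonempty (DualBasis (X.basicOpen r) M (Fin n))}
  have hs : Ideal.span s = ⊤ := by
    rw [← IsAffineOpen.iSup_basicOpen_eq_self_iff hU]
    refine le_antisymm (iSup_le fun r ↦ X.basicOpen_le _) fun p hp ↦ ?_
    obtain ⟨V, n, hpV, ⟨D⟩⟩ := isFiniteLocallyFree_iff.mp hM p
    obtain ⟨r, hr, hpr⟩ := hU.exists_basicOpen_le ⟨p, hpV⟩ hp
    exact Opens.mem_iSup.mpr ⟨⟨r, n, ⟨D.restrict hr⟩⟩, hpr⟩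
  have (r : s) : IsLocalization.Away r.1 Γ(X, X.basicOpen r.1) := hU.isLocalization_basicOpen r.1
  let (r : s) : Module Γ(X, U) Γ(M, X.basicOpen r.1) :=
    Module.compHom _ (algebraMap Γ(X, U) Γ(X, X.basicOpen r.1))
  have (r : s) : IsScalarTower Γ(X, U) Γ(X, X.basicOpen r.1) Γ(M, X.basicOpen r.1) :=
    .of_algebraMap_smul fun _ _ ↦ rfl
  let g (r : s) : Γ(M, U) →ₗ[Γ(X, U)] Γ(M, X.basicOpen r.1) :=
    { res M (X.basicOpen_le r.1) with map_smul' := fun a x ↦ res_smul M _ a x }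
  have hloc (r : s) : IsLocalizedModule (.powers r.1) (g r) := by
    constructor
    · rintro ⟨_, k, rfl⟩
      rw [Module.End.isUnit_iff]
      have h₁ : IsUnit (algebraMap Γ(X, X.basicOpen r.1)
          (Module.End Γ(X, X.basicOpen r.1) Γ(M, X.basicOpen r.1))
          (resO X (X.basicOpen_le r.1) (r.1 ^ k))) := by
        rw [map_pow]
        exact ((isUnit_resO_basicOpen r.1).pow k).map _
      have h₂ := (Module.End.isUnit_iff _).mp h₁
      exact h₂
    · intro y
      obtain ⟨k, x, hx⟩ := exists_res_eq_pow_smul hU hq r.1 y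
      refine ⟨⟨x, r.1 ^ k, k, rfl⟩, ?_⟩
      rw [← map_pow] at hx
      exact hx.symm
    · intro x y hxy
      obtain ⟨k, hk⟩ := exists_pow_smul_eq_zero hU hq r.1 (x - y) (by
        rw [map_sub, sub_eq_zero]
        exact hxy)
      refine ⟨⟨r.1 ^ k, k, rfl⟩, ?_⟩
      rw [smul_sub, sub_eq_zero] at hk
      exact hk
  have hproj (r : s) := r.2.choose_spec.some.projective
  have hfp (r : s) : Module.FinitePresentation Γ(X, X.basicOpen r.1) Γ(M, X.basicOpen r.1) := by
    have := (hproj r).1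
    have := (hproj r).2
    exact Module.finitePresentation_of_projective _ _
  have : Module.FinitePresentation Γ(X, U) Γ(M, U) :=
    Module.FinitePresentation.of_localizationSpan' (Rₚ := fun r : s ↦ Γ(X, X.basicOpen r.1)) s hs g
      hfp
  have : Module.Flat Γ(X, U) Γ(M, U) := by
    refine Module.flat_of_isLocalized_span Γ(X, U) Γ(M, U) s hs
      (fun r : s ↦ Γ(M, X.basicOpen r.1)) g fun r ↦ ?_
    have := (hproj r).2
    have := IsLocalization.flat Γ(X, X.basicOpen r.1) (.powers r.1)
    exact Module.Flat.trans Γ(X, U) Γ(X, X.basicOpen r.1) Γ(M, X.basicOpen r.1)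
  have := Module.Flat.projective_of_finitePresentation (R := Γ(X, U)) (M := Γ(M, U))
  obtain ⟨n, f, σ, -, -, hfσ⟩ := Module.Finite.exists_comp_eq_id_of_projective Γ(X, U) Γ(M, U)
  obtain ⟨D, -⟩ := exists_dualBasis_of_sections hU hq (fun i ↦ f (Pi.single i 1))
    (fun i ↦ (LinearMap.proj i).comp σ) fun x ↦ by
      conv_rhs => rw [← LinearMap.id_apply (R := Γ(X, U)) x, ← hfσ, LinearMap.comp_apply,
        pi_eq_sum_univ' (σ x), map_sum]
      simp
  exact ⟨n, ⟨D⟩⟩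

end AffineDualBasis

/-! ### Azumaya algebras in terms of dual bases -/

section Azumaya

variable {X Y : Scheme.{u}}

namespace AlgSheaf

variable {A : AlgSheaf X}

lemma eq_zero_of_one_eq_zero {V : X.Opens} (h : A.one V = 0) (x : Γ(A.mod, V)) : x = 0 := by
  rw [← A.one_mul V x, h]
  simp

lemma nontrivial_stalk_iff (p : X) : Nontrivial (A.mod.presheaf.stalk p) ↔
    ∀ V : X.Opens, p ∈ V → A.one V ≠ 0 := by
  constructor
  · intro hn V hp h1
    obtain ⟨x, hx⟩ := exists_ne (0 : A.mod.presheaf.stalk p)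
    obtain ⟨W, hpW, s, rfl⟩ := A.mod.presheaf.exists_germ_eq x
    apply hx
    have h2 : res A.mod (inf_le_left : W ⊓ V ≤ W) s = 0 := by
      apply eq_zero_of_one_eq_zero
      rw [← A.res_one _ _ (inf_le_right : W ⊓ V ≤ V), h1, map_zero]
    have h3 := A.mod.presheaf.germ_res_apply (homOfLE (inf_le_left : W ⊓ V ≤ W)) p ⟨hpW, hp⟩ s
    rw [← h3]
    exact (congrArg (A.mod.presheaf.germ (W ⊓ V) p ⟨hpW, hp⟩) h2).trans (map_zero _)
  · intro h
    by_contra hn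
    rw [not_nontrivial_iff_subsingleton] at hn
    obtain ⟨W, hpW, i, j, hij⟩ := A.mod.presheaf.germ_eq p (U := ⊤) (V := ⊤) trivial trivial
      (A.one ⊤) 0 (Subsingleton.elim _ _)
    apply h W hpW
    rw [← A.res_one W ⊤ le_top]
    exact hij.trans (map_zero _)

/-- Azumaya algebras are the algebras that locally have a dual basis for which the equations
`IsInv` are solvable, and in which `1` does not vanish anywhere. -/
lemma isAzumaya_iff : A.IsAzumaya ↔
    (∀ p : X, ∃ (V : X.Opens) (n : ℕ) (D : DualBasis V A.mod (Fin n))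
      (T : Fin n → Fin n → Fin n → Fin n → Γ(X, V)), p ∈ V ∧ A.IsInvOn D T) ∧
    ∀ (p : X) (V : X.Opens), p ∈ V → A.one V ≠ 0 := by
  constructor
  · rintro ⟨h₁, h₂, h₃⟩
    refine ⟨fun p ↦ ?_, fun p ↦ (nontrivial_stalk_iff p).mp (h₂ p)⟩
    obtain ⟨V, n, hp, ⟨D⟩⟩ := isFiniteLocallyFree_iff.mp h₁ p
    obtain ⟨T, hT⟩ := exists_isInvOn h₃ D
    exact ⟨V, n, D, T, hp, hT⟩
  · rintro ⟨h₁, h₂⟩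
    refine ⟨isFiniteLocallyFree_iff.mpr fun p ↦ ?_, fun p ↦ (nontrivial_stalk_iff p).mpr (h₂ p),
      isIso_canonicalHom_of_isInvOn h₁⟩
    obtain ⟨V, n, D, T, hp, -⟩ := h₁ p
    exact ⟨V, n, hp, ⟨D⟩⟩

/-- Pullbacks of Azumaya algebras are Azumaya algebras. -/
lemma IsAzumaya.pullback (f : X ⟶ Y) {B : AlgSheaf Y} (hB : B.IsAzumaya) :
    ((pullbackAlg f).obj B).IsAzumaya := by
  rw [isAzumaya_iff] at hB ⊢
  obtain ⟨h₁, h₂⟩ := hB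
  refine ⟨fun p ↦ ?_, fun p V hp h0 ↦ ?_⟩
  · obtain ⟨V, n, D, T, hp, hT⟩ := h₁ (f p)
    exact ⟨f ⁻¹ᵁ V, n, D.pullback f le_rfl, _, hp, hT.pullback le_rfl⟩
  · obtain ⟨W, n, D, T, hpW, -⟩ := h₁ (f p)
    obtain ⟨W', m, E, hpW', hE⟩ := D.exists_basis hpW
    -- a basis of `B` near `f p` cannot be empty, since `1 ≠ 0` there
    obtain _ | m := m
    · exact h₂ _ W' hpW' (by rw [← E.sum_self (B.one W')]; simp)
    · let V' : X.Opens := V ⊓ f ⁻¹ᵁ W'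
      have h3 := LinForm.pullback_app (f := f) (inf_le_right : V' ≤ f ⁻¹ᵁ W') (E.φ 0) W' le_rfl V'
        le_rfl inf_le_right (E.e 0)
      have h4 : pbM f (inf_le_right : V' ≤ f ⁻¹ᵁ W') (E.e 0) = 0 :=
        eq_zero_of_one_eq_zero (A := (pullbackAlg f).obj B) (V := V')
          (by rw [← AlgSheaf.res_one _ V' V inf_le_left, h0, map_zero]) _
      rw [hE, if_pos rfl, map_one, h4, map_zero] at h3
      have : Nonempty V' := ⟨⟨p, hp, hpW'⟩⟩
      exact zero_ne_one h3

end AlgSheaf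

end Azumaya

open AlgebraicGeometry.Scheme.AffineZariskiSite (directedCover relativeGluingData toOpensFunctor
  toOpens_mono)

/-! ### Relative spectra -/

section RelativeSpec

variable {X Y : Scheme.{u}}

/-- Morphisms to `Z` from the inverse images of the affine opens of `Y` glue as soon as they agree
along the inclusions of basic opens. -/
lemma exists_glue_hom {Z : Scheme.{u}} (q : X ⟶ Y)
    (c : ∀ U : Y.Opens, IsAffineOpen U → ((q ⁻¹ᵁ U : X.Opens).toScheme ⟶ Z))
    (hc : ∀ (U V : Y.Opens) (hU : IsAffineOpen U) (hV : IsAffineOpen V)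
      (r : Γ(Y, V)) (_ : Y.basicOpen r = U) (h' : U ≤ V),
      X.homOfLE (q.preimage_mono h') ≫ c V hV = c U hU) :
    ∃ z : X ⟶ Z, ∀ U hU, (q ⁻¹ᵁ U).ι ≫ z = c U hU := by
  have aux : ∀ {U V : Y.AffineZariskiSite} (i : U ⟶ V)
      (t : Limits.pullback q U.1.ι ⟶ Limits.pullback q V.1.ι)
      (_ : t ≫ Limits.pullback.fst q V.1.ι = Limits.pullback.fst q U.1.ι),
      t ≫ (pullbackRestrictIsoRestrict q V.1).hom ≫ c V.1 V.2 =
        (pullbackRestrictIsoRestrict q U.1).hom ≫ c U.1 U.2 := by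
    intro ⟨U, hU⟩ ⟨V, hV⟩ i t ht
    have h1 : t ≫ (pullbackRestrictIsoRestrict q V).hom =
        (pullbackRestrictIsoRestrict q U).hom ≫ X.homOfLE
        (q.preimage_mono (toOpens_mono i.le)) := by
      rw [← cancel_mono (Scheme.Opens.ι _)]
      simpa using ht
    rw [reassoc_of% h1]
    obtain ⟨r, hr⟩ := i.le
    exact congrArg _ (hc U V hU hV r hr (toOpens_mono i.le))
  have key : ∀ {U V : ((directedCover Y).pullback₁ q).I₀} (i : U ⟶ V),
      Scheme.Cover.trans ((directedCover Y).pullback₁ q) i ≫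
        (pullbackRestrictIsoRestrict q (Subtype.val V)).hom ≫ c _ V.2 =
        (pullbackRestrictIsoRestrict q (Subtype.val U)).hom ≫ c _ U.2 :=
    fun i ↦ aux i _ (Scheme.Cover.trans_map ((directedCover Y).pullback₁ q) i)
  refine ⟨Scheme.OpenCover.glueMorphismsOfLocallyDirected ((directedCover Y).pullback₁ q) _ key,
    fun U hU ↦ ?_⟩
  rw [← cancel_epi (pullbackRestrictIsoRestrict q U).hom, ← Category.assoc]
  trans ((directedCover Y).pullback₁ q).f ⟨U, hU⟩ ≫
    Scheme.OpenCover.glueMorphismsOfLocallyDirected ((directedCover Y).pullback₁ q) _ key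
  · congr 1
    exact pullbackRestrictIsoRestrict_hom_ι q U
  · exact Scheme.OpenCover.map_glueMorphismsOfLocallyDirected _ _ key ⟨U, hU⟩

/-- The relative spectrum of a quasi-coherent algebra `F`, which is given by its values on affine
opens. That `F` is quasi-coherent is expressed by `α` being coequifibered: the values of `F` on
basic opens are localizations. -/
lemma exists_relativeSpec {F : Y.AffineZariskiSiteᵒᵖ ⥤ CommRingCat}
    {α : (toOpensFunctor Y).op ⋙ Y.presheaf ⟶ F} (H : α.Coequifibered) :
    ∃ (Z : Scheme.{u}) (p : Z ⟶ Y) (c : ∀ U : Y.AffineZariskiSite, Spec (F.obj (op U)) ⟶ Z),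
      (∀ U, IsOpenImmersion (c U)) ∧
      (∀ (U V : Y.AffineZariskiSite) (i : U ⟶ V), Spec.map (F.map i.op) ≫ c V = c U) ∧
      (∀ U, c U ≫ p = Spec.map (α.app (op U)) ≫ U.2.fromSpec) ∧
      (∀ U, p ⁻¹' U.1 = Set.range (c U)) := by
  let D := relativeGluingData H
  have : (D.functor ⋙ Scheme.forget).IsLocallyDirected :=
    Scheme.Cover.RelativeGluingData.instIsLocallyDirectedI₀CompFunctorForgetOfIsThin ..
  refine ⟨D.glued, D.toBase, D.cover.f, fun U ↦ D.cover.map_prop U, fun U V i ↦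
    Limits.colimit.w D.functor i, fun U ↦ ?_, fun U ↦ ?_⟩
  · exact Limits.colimit.ι_desc _ _
  · simpa using! D.preimage_toBase_eq_range_ι U

end RelativeSpec

/-! ### The ring of compatible pairs of functions -/

section Localization

variable {X Y : Scheme.{u}} (q : X ⟶ Y) [IsAffineHom q] {V W : Y.Opens}

/-- For an affine morphism `q`, the functions on the inverse image of a basic open are a
localization. -/
lemma isLocalization_preimage_basicOpen (hV : IsAffineOpen V) (r : Γ(Y, V)) {W : Y.Opens}
    (hW : Y.basicOpen r = W) (h : W ≤ V) :
    (∀ x : Γ(X, q ⁻¹ᵁ V), resO X (preimage_le q h) x = 0 → ∃ k : ℕ, appO q V r ^ k * x = 0) ∧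
    ∀ y : Γ(X, q ⁻¹ᵁ W), ∃ (k : ℕ) (x : Γ(X, q ⁻¹ᵁ V)),
      resO X (preimage_le q h) x = resO X (preimage_le q h) (appO q V r) ^ k * y := by
  have hqV : IsAffineOpen (q ⁻¹ᵁ V) := hV.preimage q
  obtain ⟨D, hD⟩ : ∃ D : X.Opens, D = q ⁻¹ᵁ W := ⟨_, rfl⟩
  have hle : D ≤ q ⁻¹ᵁ V := hD.trans_le (preimage_le q h)
  suffices (∀ x : Γ(X, q ⁻¹ᵁ V), resO X hle x = 0 → ∃ k : ℕ, appO q V r ^ k * x = 0) ∧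
    ∀ y : Γ(X, D), ∃ (k : ℕ) (x : Γ(X, q ⁻¹ᵁ V)),
      resO X hle x = resO X hle (appO q V r) ^ k * y by subst hD; exact this
  obtain rfl : D = X.basicOpen (appO q V r) :=
    hD.trans ((congrArg (q ⁻¹ᵁ ·) hW.symm).trans (q.preimage_basicOpen r))
  have := hqV.isLocalization_basicOpen (appO q V r)
  refine ⟨fun x hx ↦ ?_, fun y ↦ ?_⟩
  · obtain ⟨⟨_, k, rfl⟩, hs⟩ := (IsLocalization.map_eq_zero_iff (.powers (appO q V r))
      Γ(X, X.basicOpen (appO q V r)) x).mp hx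
    exact ⟨k, hs⟩
  · obtain ⟨⟨x, _, k, rfl⟩, hs⟩ := IsLocalization.surj (.powers (appO q V r)) y
    refine ⟨k, x, ?_⟩
    rw [← map_pow, mul_comm]
    exact hs.symm

end Localization

section Fiber

variable {X' X Y' Y : Scheme.{u}} {w : X' ⟶ X} {g : X' ⟶ Y'} {f : X ⟶ Y} {u : Y' ⟶ Y}
  (e : w ≫ f = g ≫ u)

lemma preimage_comp_le (V : Y.Opens) : (w ≫ f) ⁻¹ᵁ V ≤ w ⁻¹ᵁ f ⁻¹ᵁ V := le_rfl

lemma preimage_le_of_eq (e : w ≫ f = g ≫ u) (V : Y.Opens) : (w ≫ f) ⁻¹ᵁ V ≤ g ⁻¹ᵁ u ⁻¹ᵁ V := by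
  rw [e]; exact le_rfl

lemma pbO_appO {X Y Z : Scheme.{u}} (f : X ⟶ Y) (g : Y ⟶ Z) {V : X.Opens} {W : Z.Opens}
    (h : V ≤ f ⁻¹ᵁ g ⁻¹ᵁ W) (h' : V ≤ (f ≫ g) ⁻¹ᵁ W) (x) :
    pbO f h (appO g W x) = pbO (f ≫ g) h' x := by
  have : appO (f ≫ g) W = (appO f (g ⁻¹ᵁ W)).comp (appO g W) := by
    unfold appO; rw [Scheme.Hom.comp_app]; rfl
  exact congr(resO X h ($this x)).symm

lemma pbO_congr {X Y : Scheme.{u}} {f g : X ⟶ Y} (e : f = g) {V : X.Opens} {W : Y.Opens}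
    (h : V ≤ f ⁻¹ᵁ W) (h' : V ≤ g ⁻¹ᵁ W) (x) : pbO f h x = pbO g h' x := by
  subst e; rfl

/-- The pairs of functions on `u⁻¹V` and `f⁻¹V` with the same pullback to `X'`. -/
def fiberRing (V : Y.Opens) : Subring (Γ(Y', u ⁻¹ᵁ V) × Γ(X, f ⁻¹ᵁ V)) :=
  RingHom.eqLocus ((pbO g (preimage_le_of_eq e V)).comp (RingHom.fst _ _))
    ((pbO w (preimage_comp_le V)).comp (RingHom.snd _ _))

/-- The restriction of pairs to a smaller open. -/
def fiberRingRes {V W : Y.Opens} (h : V ≤ W) : fiberRing e W →+* fiberRing e V :=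
  (((resO Y' (preimage_le u h)).prodMap (resO X (preimage_le f h))).comp
    (fiberRing e W).subtype).codRestrict (fiberRing e V) fun x ↦ by
      have hx : pbO g (preimage_le_of_eq e W) x.1.1 = pbO w (preimage_comp_le W) x.1.2 := x.2
      have := congrArg (resO X' (preimage_le (w ≫ f) h)) hx
      rw [resO_pbO, resO_pbO] at this
      change pbO g (preimage_le_of_eq e V) (resO Y' (preimage_le u h) x.1.1) =
        pbO w (preimage_comp_le V) (resO X (preimage_le f h) x.1.2)
      rw [pbO_resO, pbO_resO]
      exact this

/-- The map from functions on `V` to compatible pairs of functions on `u⁻¹V` and `f⁻¹V`. It is shown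
in `bijective_toFiberRing_of_isAffineOpen` to be bijective for a pushout. -/
def toFiberRing (V : Y.Opens) : Γ(Y, V) →+* fiberRing e V :=
  ((appO u V).prod (appO f V)).codRestrict (fiberRing e V) fun x ↦ by
    change pbO g (preimage_le_of_eq e V) (appO u V x) =
        pbO w (preimage_comp_le V) (appO f V x)
    rw [pbO_appO g u _ (e ▸ le_rfl), pbO_appO w f _ le_rfl]
    exact pbO_congr e.symm _ _ _

/-- The rings `fiberRing` as a presheaf on the affine opens of `Y`. -/
def fiberFunctor : Y.AffineZariskiSiteᵒᵖ ⥤ CommRingCat.{u} where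
  obj V := .of (fiberRing e V.unop.1)
  map i := CommRingCat.ofHom (fiberRingRes e (toOpens_mono i.unop.le))
  map_id V := by
    refine CommRingCat.hom_ext (RingHom.ext fun x ↦ Subtype.ext ?_)
    exact Prod.ext (resO_self (X := Y') _ x.1.1) (resO_self (X := X) _ x.1.2)
  map_comp i j := by
    refine CommRingCat.hom_ext (RingHom.ext fun x ↦ Subtype.ext ?_)
    exact Prod.ext (resO_resO (X := Y') _ _ x.1.1).symm (resO_resO (X := X) _ _ x.1.2).symm

/-- The maps `toFiberRing` as a morphism of presheaves on the affine opens of `Y`. -/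
def toFiberFunctor : (toOpensFunctor Y).op ⋙ Y.presheaf ⟶ fiberFunctor e where
  app V := CommRingCat.ofHom (toFiberRing e V.unop.1)
  naturality V W i := by
    refine CommRingCat.hom_ext (RingHom.ext fun x ↦ Subtype.ext ?_)
    exact Prod.ext (appO_res u (toOpens_mono i.unop.le) x)
      (appO_res f (toOpens_mono i.unop.le) x)

lemma fiberRingRes_toFiberRing {V W : Y.Opens} (h : W ≤ V) (r : Γ(Y, V)) :
    fiberRingRes e h (toFiberRing e V r) = toFiberRing e W (resO Y h r) :=
  Subtype.ext (Prod.ext (appO_res u h r).symm (appO_res f h r).symm)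

lemma pbO_appO_left (V : Y.Opens) (x : Γ(Y, V)) :
    pbO g (preimage_le_of_eq e V) (appO u V x) = appO (w ≫ f) V x := by
  rw [pbO_appO g u _ (e ▸ le_rfl), pbO_congr e.symm _ le_rfl, pbO_self]

lemma pbO_appO_right (V : Y.Opens) (x : Γ(Y, V)) :
    pbO w (preimage_comp_le V) (appO f V x) = appO (w ≫ f) V x := by
  rw [pbO_appO w f _ le_rfl, pbO_self]

lemma exists_pow_mul_eq_of_fiberRingRes_eq [IsAffineHom f] [IsAffineHom u] {V W : Y.Opens}
    (hV : IsAffineOpen V) (r : Γ(Y, V)) (hW : Y.basicOpen r = W) (h : W ≤ V)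
    (x y : fiberRing e V) (hxy : fiberRingRes e h x = fiberRingRes e h y) :
    ∃ k, toFiberRing e V r ^ k * x = toFiberRing e V r ^ k * y := by
  obtain ⟨k₁, hk₁⟩ := (isLocalization_preimage_basicOpen u hV r hW h).1 (x.1.1 - y.1.1) (by
    rw [map_sub, sub_eq_zero]; exact congr(($hxy).1.1))
  obtain ⟨k₂, hk₂⟩ := (isLocalization_preimage_basicOpen f hV r hW h).1 (x.1.2 - y.1.2) (by
    rw [map_sub, sub_eq_zero]; exact congr(($hxy).1.2))
  have aux {R : Type u} [CommRing R] {p x y : R} {k l : ℕ} (h : p ^ k * (x - y) = 0)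
      (hl : k ≤ l) : p ^ l * x = p ^ l * y := by
    rw [← sub_eq_zero, ← mul_sub, ← Nat.sub_add_cancel hl, pow_add, mul_assoc, h, mul_zero]
  exact ⟨k₁ + k₂, Subtype.ext (Prod.ext (aux hk₁ (by omega)) (aux hk₂ (by omega)))⟩

lemma exists_fiberRingRes_eq_pow_mul [IsAffineHom f] [IsAffineHom u] [IsAffineHom w]
    {V W : Y.Opens} (hV : IsAffineOpen V) (r : Γ(Y, V)) (hW : Y.basicOpen r = W) (h : W ≤ V)
    (z : fiberRing e W) : ∃ (k : ℕ) (x : fiberRing e V),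
      fiberRingRes e h x = toFiberRing e W (resO Y h r) ^ k * z := by
  have hu := isLocalization_preimage_basicOpen u hV r hW h
  have hf := isLocalization_preimage_basicOpen f hV r hW h
  have hh := isLocalization_preimage_basicOpen (w ≫ f) hV r hW h
  have hg := pbO_appO_left e V r
  have hw := pbO_appO_right (w := w) (f := f) V r
  obtain ⟨⟨b, a⟩, hba⟩ := z
  obtain ⟨k₁, b₁, hb₁⟩ := hu.2 b
  obtain ⟨k₂, a₁, ha₁⟩ := hf.2 a
  have hba' : pbO g (preimage_le_of_eq e W) b = pbO w (preimage_comp_le W) a := hba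
  obtain ⟨k₃, hk₃⟩ := hh.1 (pbO g (preimage_le_of_eq e V) (appO u V r ^ k₂ * b₁) -
      pbO w (preimage_comp_le V) (appO f V r ^ k₁ * a₁)) (by
    have h₁ := congrArg (pbO g (preimage_le_of_eq e W)) hb₁
    have h₂ := congrArg (pbO w (preimage_comp_le W)) ha₁
    have h₃ := congrArg (resO X' (preimage_le (w ≫ f) h)) hg
    have h₄ := congrArg (resO X' (preimage_le (w ≫ f) h)) hw
    rw [resO_pbO] at h₃ h₄
    simp only [map_mul, map_pow, pbO_resO] at h₁ h₂
    rw [map_sub, resO_pbO, resO_pbO, map_mul, map_mul, map_pow, map_pow, h₁, h₂, h₃, h₄, hba']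
    ring)
  rw [mul_sub, sub_eq_zero] at hk₃
  -- the powers `k₁` and `k₂` clear denominators, and `k₃` makes the resulting pair compatible
  refine ⟨k₁ + k₂ + k₃, ⟨(appO u V r ^ k₃ * (appO u V r ^ k₂ * b₁),
    appO f V r ^ k₃ * (appO f V r ^ k₁ * a₁)), ?_⟩, Subtype.ext (Prod.ext ?_ ?_)⟩
  · change pbO g (preimage_le_of_eq e V) (appO u V r ^ k₃ * (appO u V r ^ k₂ * b₁)) =
      pbO w (preimage_comp_le V) (appO f V r ^ k₃ * (appO f V r ^ k₁ * a₁))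
    rw [map_mul _ (_ ^ k₃), map_mul _ (_ ^ k₃), map_pow, map_pow, hg, hw]
    exact hk₃
  · change resO Y' (preimage_le u h) (appO u V r ^ k₃ * (appO u V r ^ k₂ * b₁)) =
      appO u W (resO Y h r) ^ _ * b
    rw [appO_res, map_mul, map_mul, hb₁, map_pow, map_pow]
    ring
  · change resO X (preimage_le f h) (appO f V r ^ k₃ * (appO f V r ^ k₁ * a₁)) =
      appO f W (resO Y h r) ^ _ * a
    rw [appO_res, map_mul, map_mul, ha₁, map_pow, map_pow]
    ring

/-- Compatible pairs of functions form a quasi-coherent algebra, since a fiber product of rings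
commutes with localization. -/
lemma coequifibered_toFiberFunctor [IsAffineHom f] [IsAffineHom u] [IsAffineHom w] :
    (toFiberFunctor e).Coequifibered := by
  refine Scheme.AffineZariskiSite.coequifibered_iff_forall_isLocalizationAway.mpr fun U r ↦ ?_
  obtain ⟨V, hV⟩ := U
  change Γ(Y, V) at r
  obtain ⟨W, hW⟩ : ∃ W, Y.basicOpen r = W := ⟨_, rfl⟩
  have h : W ≤ V := hW ▸ Y.basicOpen_le r
  suffices @IsLocalization.Away _ _ (toFiberRing e V r) (fiberRing e W) _
      (fiberRingRes e h).toAlgebra by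
    subst hW; exact this
  have hunit : IsUnit (resO Y h r) := by
    subst hW; exact isUnit_resO_basicOpen r
  let _ := (fiberRingRes e h).toAlgebra
  refine (isLocalization_iff _ _).mpr ⟨?_, fun z ↦ ?_, fun {x y} hxy ↦ ?_⟩
  · rintro ⟨_, k, rfl⟩
    change IsUnit (fiberRingRes e h (toFiberRing e V r ^ k))
    rw [map_pow, fiberRingRes_toFiberRing]
    exact (hunit.map (toFiberRing e W)).pow k
  · obtain ⟨k, x, hx⟩ := exists_fiberRingRes_eq_pow_mul e hV r hW h z
    refine ⟨(x, ⟨_, k, rfl⟩), ?_⟩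
    change _ * fiberRingRes e h (toFiberRing e V r ^ k) = fiberRingRes e h x
    rw [map_pow, fiberRingRes_toFiberRing, hx, mul_comm]
  · obtain ⟨k, hk⟩ := exists_pow_mul_eq_of_fiberRingRes_eq e hV r hW h x y hxy
    exact ⟨⟨_, k, rfl⟩, hk⟩

end Fiber

/-! ### Morphisms to a scheme affine over the base -/

section AffineHoms

variable {X Y Z T : Scheme.{u}}

lemma toSpecΓ_SpecMap_injective {D : X.Opens} {R : CommRingCat.{u}} {β β' : R ⟶ Γ(X, D)}
    (h : D.toSpecΓ ≫ Spec.map β = D.toSpecΓ ≫ Spec.map β') : β = β' := by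
  have h' := congrArg (fun k ↦ (Scheme.ΓSpecIso R).inv ≫ Scheme.Hom.appTop k ≫ D.topIso.hom) h
  have hh (γ : R ⟶ Γ(X, D)) : (Scheme.ΓSpecIso R).inv ≫
      Scheme.Hom.appTop (D.toSpecΓ ≫ Spec.map γ) ≫ D.topIso.hom = γ := by
    rw [Scheme.Hom.comp_appTop, Scheme.Opens.toSpecΓ_appTop, Category.assoc, Category.assoc,
      Iso.inv_hom_id, Category.comp_id, Scheme.ΓSpecIso_naturality, Iso.inv_hom_id_assoc]
  exact (hh β).symm.trans (h'.trans (hh β'))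

lemma ι_comp_eq (z : X ⟶ Z) {E : Z.Opens} (hE : IsAffineOpen E) {D : X.Opens} (h : D ≤ z ⁻¹ᵁ E) :
    D.ι ≫ z = D.toSpecΓ ≫ Spec.map (z.appLE E D h) ≫ hE.fromSpec := by
  rw [Scheme.Opens.toSpecΓ_SpecMap_appLE_assoc, hE.toSpecΓ_fromSpec, Scheme.Hom.resLE_comp_ι]

lemma pbO_pbO (z : X ⟶ Y) (z' : Y ⟶ Z) {E : Z.Opens} {D : Y.Opens} {C : X.Opens}
    (h : C ≤ z ⁻¹ᵁ D) (h' : D ≤ z' ⁻¹ᵁ E) (h'' : C ≤ (z ≫ z') ⁻¹ᵁ E) (x) :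
    pbO z h (pbO z' h' x) = pbO (z ≫ z') h'' x := by
  have : C ≤ z ⁻¹ᵁ z' ⁻¹ᵁ E := h''
  rw [← pbO_appO z z' this h'']
  exact pbO_resO h h' _

/-- If `p : Z ⟶ Y` is affine, then a morphism to `Z` over `Y` is determined by its effect on
functions. -/
lemma hom_ext_of_affineHom (p : Z ⟶ Y) [IsAffineHom p] (z z' : X ⟶ Z) (e : z ≫ p = z' ≫ p)
    (h : ∀ (V : Y.Opens) (_ : IsAffineOpen V) (D : X.Opens) (h : D ≤ z ⁻¹ᵁ p ⁻¹ᵁ V)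
      (h' : D ≤ z' ⁻¹ᵁ p ⁻¹ᵁ V) (x), pbO z h x = pbO z' h' x) : z = z' := by
  refine Scheme.Cover.hom_ext (X.openCoverOfIsOpenCover _
    (.comap (iSup_affineOpens_eq_top Y) (z ≫ p).base.1)) _ _ fun V ↦ ?_
  have h₁ : (z ≫ p) ⁻¹ᵁ V.1 ≤ z ⁻¹ᵁ p ⁻¹ᵁ V.1 := le_rfl
  have h₂ : (z ≫ p) ⁻¹ᵁ V.1 ≤ z' ⁻¹ᵁ p ⁻¹ᵁ V.1 := by rw [e]; exact le_rfl
  refine (ι_comp_eq z (V.2.preimage p) h₁).trans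
    (Eq.trans ?_ (ι_comp_eq z' (V.2.preimage p) h₂).symm)
  have : z.appLE _ _ h₁ = z'.appLE _ _ h₂ := CommRingCat.hom_ext (RingHom.ext (h V.1 V.2 _ h₁ h₂))
  rw [this]

/-- If `p : Z ⟶ Y` is affine, then a compatible family of homomorphisms of `𝒪_Y`-algebras from the
functions on `Z` to those on `X` comes from a morphism `X ⟶ Z` over `Y`. -/
lemma exists_hom_of_affineHom (p : Z ⟶ Y) [IsAffineHom p] (q : X ⟶ Y)
    (β : ∀ V : Y.Opens, IsAffineOpen V → (Γ(Z, p ⁻¹ᵁ V) →+* Γ(X, q ⁻¹ᵁ V)))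
    (hβ : ∀ (V W : Y.Opens) (hV : IsAffineOpen V) (hW : IsAffineOpen W) (h : W ≤ V)
      (r : Γ(Y, V)) (_ : Y.basicOpen r = W) x,
      β W hW (resO Z (preimage_le p h) x) = resO X (preimage_le q h) (β V hV x))
    (hp : ∀ V hV x, β V hV (appO p V x) = appO q V x) :
    ∃ z : X ⟶ Z, z ≫ p = q ∧ ∀ (V : Y.Opens) hV (h : q ⁻¹ᵁ V ≤ z ⁻¹ᵁ p ⁻¹ᵁ V) (x),
      pbO z h x = β V hV x := by
  obtain ⟨z, hz⟩ := exists_glue_hom q (fun V hV ↦ (q ⁻¹ᵁ V).toSpecΓ ≫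
      Spec.map (CommRingCat.ofHom (β V hV)) ≫ (hV.preimage p).fromSpec)
    fun W V hW hV r hr h ↦ by
      have h₁ : Z.presheaf.map (homOfLE (preimage_le p h)).op ≫ CommRingCat.ofHom (β W hW) =
          CommRingCat.ofHom (β V hV) ≫ X.presheaf.map (homOfLE (preimage_le q h)).op :=
        CommRingCat.hom_ext (RingHom.ext fun x ↦ hβ V W hV hW h r hr x)
      have h₂ := Scheme.Opens.toSpecΓ_SpecMap_presheaf_map (X := X) _ _ (preimage_le q h)
      have h₃ := (hV.preimage p).map_fromSpec (hW.preimage p) (homOfLE (preimage_le p h)).op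
      rw [← h₃, ← Spec.map_comp_assoc, h₁, Spec.map_comp_assoc, ← Category.assoc, ← h₂,
        Category.assoc]
  have hzp : z ≫ p = q := by
    refine Scheme.Cover.hom_ext (X.openCoverOfIsOpenCover _
      (.comap (iSup_affineOpens_eq_top Y) q.base.1)) _ _ fun V ↦ ?_
    have h₁ := ι_comp_eq q V.2 (le_refl (q ⁻¹ᵁ V.1))
    have h₂ := congrArg (· ≫ p) (hz V.1 V.2)
    have h₃ := V.2.SpecMap_appLE_fromSpec p (V.2.preimage p) le_rfl
    simp only [Category.assoc, ← h₃] at h₂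
    refine h₂.trans (Eq.trans ?_ h₁.symm)
    rw [← Spec.map_comp_assoc]
    congr 3
    refine CommRingCat.hom_ext (RingHom.ext fun x ↦ ?_)
    refine (congrArg (β V.1 V.2) (pbO_self (f := p) x)).trans ((hp V.1 V.2 x).trans ?_)
    exact (pbO_self (f := q) x).symm
  refine ⟨z, hzp, fun V hV h x ↦ ?_⟩
  have h₁ := (hz V hV).symm.trans (ι_comp_eq z (hV.preimage p) h)
  rw [← Category.assoc, ← Category.assoc, cancel_mono] at h₁
  exact congr(($(toSpecΓ_SpecMap_injective h₁)).hom x).symm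

lemma pbO_SpecMap {R S : CommRingCat.{u}} (φ : R ⟶ S) (h : ⊤ ≤ Spec.map φ ⁻¹ᵁ ⊤) (x : R) :
    pbO (Spec.map φ) h ((Scheme.ΓSpecIso R).inv x) = (Scheme.ΓSpecIso S).inv (φ x) := by
  have := congr(($(Scheme.ΓSpecIso_inv_naturality φ)).hom x)
  refine Eq.trans ?_ this.symm
  exact pbO_self _

lemma pbO_fromSpec {V : Y.Opens} (hV : IsAffineOpen V) (h : ⊤ ≤ hV.fromSpec ⁻¹ᵁ V)
    (x : Γ(Y, V)) : pbO hV.fromSpec h x = (Scheme.ΓSpecIso _).inv x := by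
  have := congr(resO _ h (($(hV.fromSpec_app_of_le V le_rfl)).hom x))
  refine this.trans ((resO_resO _ _ _).trans ((resO_self _ _).trans ?_))
  exact congrArg _ (resO_self _ _)

/-- The functions on the relative spectrum of a quasi-coherent algebra are the elements of this
algebra. -/
lemma exists_affineHom_of_coequifibered {F : Y.AffineZariskiSiteᵒᵖ ⥤ CommRingCat}
    {α : (toOpensFunctor Y).op ⋙ Y.presheaf ⟶ F} (H : α.Coequifibered) :
    ∃ (Z : Scheme.{u}) (p : Z ⟶ Y) (_ : IsAffineHom p)
      (σ : ∀ V : Y.AffineZariskiSite, F.obj (op V) ≃+* Γ(Z, p ⁻¹ᵁ V.1)),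
      (∀ (V W : Y.AffineZariskiSite) (i : W ⟶ V) x, σ W (F.map i.op x) =
        resO Z (preimage_le p (toOpens_mono i.le)) (σ V x)) ∧
      ∀ V x, σ V (α.app (op V) x) = appO p V.1 x := by
  obtain ⟨Z, p, c, hc, hcc, hcp, hr⟩ := exists_relativeSpec H
  have htop (V) : (⊤ : (Spec (F.obj (op V))).Opens) ≤ c V ⁻¹ᵁ p ⁻¹ᵁ V.1 := fun x _ ↦ by
    change c V x ∈ p ⁻¹' V.1
    rw [hr]; exact ⟨x, rfl⟩
  have haff (V : Y.AffineZariskiSite) : IsAffineOpen (p ⁻¹ᵁ V.1) := by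
    have := hc V
    have h : p ⁻¹ᵁ V.1 = (c V).opensRange := Opens.ext (hr V)
    rw [h]
    exact isAffineOpen_opensRange (c V)
  have hbij (V) : Function.Bijective (pbO (c V) (htop V)) := by
    have := hc V
    have h : p ⁻¹ᵁ V.1 ≤ (c V).opensRange := (Opens.ext (hr V)).le
    have h₁ := (c V).isIso_app _ h
    have h₂ : c V ⁻¹ᵁ p ⁻¹ᵁ V.1 = ⊤ := top_le_iff.mp (htop V)
    have h₃ : IsIso ((Spec (F.obj (op V))).presheaf.map (homOfLE (htop V)).op) := by
      have : IsIso (homOfLE (htop V)) := ⟨homOfLE h₂.le, rfl, rfl⟩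
      infer_instance
    exact ConcreteCategory.bijective_of_isIso
      ((c V).app _ ≫ (Spec (F.obj (op V))).presheaf.map (homOfLE (htop V)).op)
  let σ (V : Y.AffineZariskiSite) : F.obj (op V) ≃+* Γ(Z, p ⁻¹ᵁ V.1) :=
    (Scheme.ΓSpecIso (F.obj (op V))).symm.commRingCatIsoToRingEquiv.trans
      (RingEquiv.ofBijective _ (hbij V)).symm
  have hσ (V x y) : σ V x = y ↔ (Scheme.ΓSpecIso (F.obj (op V))).inv x = pbO (c V) (htop V) y :=
    (RingEquiv.ofBijective _ (hbij V)).symm_apply_eq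
  refine ⟨Z, p, ?_, σ, fun V W i x ↦ ?_, fun V x ↦ ?_⟩
  · exact ⟨fun U hU ↦ haff ⟨U, hU⟩⟩
  · rw [hσ, pbO_resO]
    have h₁ := congrArg (pbO (V := ⊤) (Spec.map (F.map i.op)) le_top) ((hσ V x _).mp rfl)
    have h₂ := preimage_le p (toOpens_mono i.le)
    exact (pbO_SpecMap (F.map i.op) le_top x).symm.trans (h₁.trans ((pbO_pbO
      (Spec.map (F.map i.op)) (c V) le_top (htop V) (fun x _ ↦ htop V trivial) _).trans
      (pbO_congr (hcc W V i) _ _ _)))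
  · rw [hσ]
    have h₃ : (⊤ : (Spec (F.obj (op V))).Opens) ≤
        (Spec.map (α.app (op V)) ≫ V.2.fromSpec) ⁻¹ᵁ V.1 := by
      rw [← hcp V]; exact htop V
    have h₄ : (⊤ : (Spec Γ(Y, V.1)).Opens) ≤ V.2.fromSpec ⁻¹ᵁ V.1 := V.2.fromSpec_preimage_self.ge
    have h₁ : pbO (c V) (htop V) (appO p V.1 x) = pbO (c V ≫ p) (htop V) x := pbO_appO _ _ _ _ _
    have h₂ := pbO_pbO (Spec.map (α.app (op V))) V.2.fromSpec le_top h₄ h₃ x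
    refine Eq.symm (h₁.trans ((pbO_congr (hcp V) _ h₃ x).trans (h₂.symm.trans ?_)))
    exact (congrArg _ (pbO_fromSpec V.2 h₄ x)).trans (pbO_SpecMap _ _ _)

end AffineHoms

/-! ### Functions on a pushout -/

section Functions

variable {X' X Y' Y : Scheme.{u}} {w : X' ⟶ X} {g : X' ⟶ Y'} {f : X ⟶ Y} {u : Y' ⟶ Y}

/-- The relative spectrum of the algebra of compatible pairs of functions. -/
lemma exists_fiberScheme (e : w ≫ f = g ≫ u) [IsAffineHom f] [IsAffineHom u] [IsAffineHom w] :
    ∃ (Z : Scheme.{u}) (p : Z ⟶ Y) (_ : IsAffineHom p)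
      (σ : ∀ V : Y.Opens, IsAffineOpen V → (fiberRing e V ≃+* Γ(Z, p ⁻¹ᵁ V))),
      (∀ (V W : Y.Opens) (hV : IsAffineOpen V) (hW : IsAffineOpen W) (h : W ≤ V)
        (r : Γ(Y, V)) (_ : Y.basicOpen r = W) x, σ W hW (fiberRingRes e h x) =
        resO Z (preimage_le p h) (σ V hV x)) ∧
      ∀ V hV x, σ V hV (toFiberRing e V x) = appO p V x := by
  obtain ⟨Z, p, hp, σ, hσ, hσα⟩ :=
    exists_affineHom_of_coequifibered (coequifibered_toFiberFunctor e)
  exact ⟨Z, p, hp, fun V hV ↦ σ ⟨V, hV⟩, fun V W hV hW h r hr x ↦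
    hσ ⟨V, hV⟩ ⟨W, hW⟩ (homOfLE ⟨r, hr⟩) x, fun V hV x ↦ hσα ⟨V, hV⟩ x⟩

/-- Let `p : Z ⟶ Y` be the relative spectrum of the algebra of compatible pairs of functions. The
two projections of pairs are morphisms from `Y'` and `X` to `Z` over `Y` that agree on `X'`. As `Y`
is the pushout, they give a section of `p`, and this section inverts the comparison map. -/
lemma bijective_toFiberRing_of_isAffineOpen (sq : BicartesianSq w g f u) [IsAffineHom f]
    [IsAffineHom u] {V : Y.Opens} (hV : IsAffineOpen V) :
    Function.Bijective (toFiberRing sq.w V) := by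
  have : IsAffineHom w := MorphismProperty.of_isPullback sq.toIsPullback.flip inferInstance
  obtain ⟨Z, p, _, σ, hσ, hσα⟩ := exists_fiberScheme sq.w
  have hσs (V W : Y.Opens) (hV : IsAffineOpen V) (hW : IsAffineOpen W) (h : W ≤ V)
      (r : Γ(Y, V)) (hr : Y.basicOpen r = W) x :
      (σ W hW).symm (resO Z (preimage_le p h) x) = fiberRingRes sq.w h ((σ V hV).symm x) := by
    rw [RingEquiv.symm_apply_eq, hσ V W hV hW h r hr, RingEquiv.apply_symm_apply]
  have hσα' (V hV x) : (σ V hV).symm (appO p V x) = toFiberRing sq.w V x := by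
    rw [RingEquiv.symm_apply_eq, hσα]
  obtain ⟨z₁, h₁, h₁'⟩ := exists_hom_of_affineHom p u
    (fun V hV ↦ ((RingHom.fst _ _).comp (fiberRing sq.w V).subtype).comp (σ V hV).symm.toRingHom)
    (fun V W hV hW h r hr x ↦ congr(($(hσs V W hV hW h r hr x)).1.1))
    (fun V hV x ↦ congr(($(hσα' V hV x)).1.1))
  obtain ⟨z₂, h₂, h₂'⟩ := exists_hom_of_affineHom p f
    (fun V hV ↦ ((RingHom.snd _ _).comp (fiberRing sq.w V).subtype).comp (σ V hV).symm.toRingHom)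
    (fun V W hV hW h r hr x ↦ congr(($(hσs V W hV hW h r hr x)).1.2))
    (fun V hV x ↦ congr(($(hσα' V hV x)).1.2))
  -- both sides send a pair `(b, a)` to the common pullback of `b` and `a` to `X'`
  have hz : w ≫ z₂ = g ≫ z₁ := by
    refine hom_ext_of_affineHom p _ _ (by rw [Category.assoc, Category.assoc, h₁, h₂, sq.w])
      fun V hV D h h' x ↦ ?_
    have h₁₀ : u ⁻¹ᵁ V ≤ z₁ ⁻¹ᵁ p ⁻¹ᵁ V := by rw [← h₁]; exact le_rfl
    have h₂₀ : f ⁻¹ᵁ V ≤ z₂ ⁻¹ᵁ p ⁻¹ᵁ V := by rw [← h₂]; exact le_rfl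
    have hD : D ≤ (w ≫ f) ⁻¹ᵁ V := by rw [← h₂]; exact h
    rw [← pbO_pbO w z₂ (hD.trans (preimage_comp_le V)) h₂₀ h,
      ← pbO_pbO g z₁ (hD.trans (preimage_le_of_eq sq.w V)) h₁₀ h', h₁' V hV, h₂' V hV]
    have := congrArg (resO X' hD) ((σ V hV).symm x).2
    exact (resO_pbO _ _ _).symm.trans (this.symm.trans (resO_pbO _ _ _))
  obtain ⟨s, hs₂, hs₁⟩ : ∃ s : Y ⟶ Z, f ≫ s = z₂ ∧ u ≫ s = z₁ :=
    ⟨sq.toIsPushout.desc z₂ z₁ hz, sq.toIsPushout.inl_desc _ _ _, sq.toIsPushout.inr_desc _ _ _⟩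
  have hsp : s ≫ p = 𝟙 Y := by
    refine sq.toIsPushout.hom_ext ?_ ?_
    · rw [← Category.assoc, hs₂, h₂, Category.comp_id]
    · rw [← Category.assoc, hs₁, h₁, Category.comp_id]
  have hVs : V ≤ s ⁻¹ᵁ p ⁻¹ᵁ V := by
    change V ≤ (s ≫ p) ⁻¹ᵁ V
    rw [hsp]; exact le_rfl
  have hleft (x : Γ(Y, V)) : pbO s hVs (σ V hV (toFiberRing sq.w V x)) = x := by
    rw [hσα, pbO_appO s p hVs hVs, pbO_congr hsp hVs le_rfl]
    exact resO_self _ _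
  have hright (x : fiberRing sq.w V) : toFiberRing sq.w V (pbO s hVs (σ V hV x)) = x := by
    refine Subtype.ext (Prod.ext ?_ ?_)
    · have h : u ⁻¹ᵁ V ≤ (u ≫ s) ⁻¹ᵁ p ⁻¹ᵁ V := preimage_le u hVs
      have h' : u ⁻¹ᵁ V ≤ z₁ ⁻¹ᵁ p ⁻¹ᵁ V := hs₁ ▸ h
      change appO u V (pbO s hVs (σ V hV x)) = x.1.1
      rw [← pbO_self (f := u), pbO_pbO u s le_rfl hVs h, pbO_congr hs₁ h h', h₁' V hV]
      exact congr(($((σ V hV).symm_apply_apply x)).1.1)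
    · have h : f ⁻¹ᵁ V ≤ (f ≫ s) ⁻¹ᵁ p ⁻¹ᵁ V := preimage_le f hVs
      have h' : f ⁻¹ᵁ V ≤ z₂ ⁻¹ᵁ p ⁻¹ᵁ V := hs₂ ▸ h
      change appO f V (pbO s hVs (σ V hV x)) = x.1.2
      rw [← pbO_self (f := f), pbO_pbO f s le_rfl hVs h, pbO_congr hs₂ h h', h₂' V hV]
      exact congr(($((σ V hV).symm_apply_apply x)).1.2)
  exact ⟨fun x y hxy ↦ by rw [← hleft x, hxy, hleft], fun x ↦ ⟨_, hright x⟩⟩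

/-- Functions on `Y` are determined by their pullbacks to `Y'` and `X`. -/
lemma eq_of_appO_eq (sq : BicartesianSq w g f u) [IsAffineHom f] [IsAffineHom u] {V : Y.Opens}
    {x y : Γ(Y, V)} (hu : appO u V x = appO u V y) (hf : appO f V x = appO f V y) : x = y := by
  refine resO_ext fun p hp ↦ ?_
  obtain ⟨W, hW, hpW, hWV⟩ := exists_isAffineOpen_mem_and_subset hp
  refine ⟨W, hWV, hpW, (bijective_toFiberRing_of_isAffineOpen sq hW).1
    (Subtype.ext (Prod.ext ?_ ?_))⟩
  · change appO u W _ = appO u W _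
    rw [appO_res u hWV, appO_res u hWV, hu]
  · change appO f W _ = appO f W _
    rw [appO_res f hWV, appO_res f hWV, hf]

/-- Functions on `Y'` and `X` that agree on `X'` come from a function on `Y`. -/
lemma exists_appO_eq (sq : BicartesianSq w g f u) [IsAffineHom f] [IsAffineHom u] {V : Y.Opens}
    (b : Γ(Y', u ⁻¹ᵁ V)) (a : Γ(X, f ⁻¹ᵁ V))
    (h : pbO g (preimage_le_of_eq sq.w V) b = pbO w (preimage_comp_le V) a) :
    ∃ r : Γ(Y, V), appO u V r = b ∧ appO f V r = a := by
  choose W hW hpW hWV using fun p : V ↦ exists_isAffineOpen_mem_and_subset p.2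
  choose r hr using fun p ↦ (bijective_toFiberRing_of_isAffineOpen sq (hW p)).2
    (fiberRingRes sq.w (hWV p) ⟨(b, a), h⟩)
  have hr₁ (p) : appO u (W p) (r p) = resO Y' (preimage_le u (hWV p)) b := congr(($(hr p)).1.1)
  have hr₂ (p) : appO f (W p) (r p) = resO X (preimage_le f (hWV p)) a := congr(($(hr p)).1.2)
  have hc : V ≤ iSup W := fun p hp ↦ Opens.mem_iSup.mpr ⟨⟨p, hp⟩, hpW _⟩
  obtain ⟨s, hs⟩ := exists_glueO W hWV hc r fun p q ↦ eq_of_appO_eq sq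
    (by rw [appO_res u, appO_res u, hr₁, hr₁, resO_resO, resO_resO])
    (by rw [appO_res f, appO_res f, hr₂, hr₂, resO_resO, resO_resO])
  refine ⟨s, resO_ext fun p hp ↦ ⟨u ⁻¹ᵁ W ⟨u p, hp⟩, preimage_le u (hWV _), hpW _, ?_⟩,
    resO_ext fun p hp ↦ ⟨f ⁻¹ᵁ W ⟨f p, hp⟩, preimage_le f (hWV _), hpW _, ?_⟩⟩
  · rw [← appO_res u (hWV _), hs, hr₁]
  · rw [← appO_res f (hWV _), hs, hr₂]

end Functions

/-! ### Lifting dual bases along closed immersions -/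

section Lift

variable {X' X : Scheme.{u}} {w : X' ⟶ X} {M : X.Modules} {V : X.Opens} {V' : X'.Opens}
  {κ ι : Type*} [Fintype κ] [Fintype ι]

lemma DualBasis.exists_lift_section (h : V' ≤ w ⁻¹ᵁ V) (hs : Function.Surjective (pbO w h))
    (D : DualBasis V M κ) (y : Γ((Scheme.Modules.pullback w).obj M, V')) :
    ∃ x : Γ(M, V), pbM w h x = y := by
  choose c hc using fun k ↦ hs (((D.φ k).pullback w h).app V' le_rfl y)
  refine ⟨∑ k, c k • D.e k, ?_⟩
  rw [map_sum, ← (D.pullback w h).sum_self y]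
  exact Finset.sum_congr rfl fun k _ ↦ by rw [pbM_smul, hc]; rfl

/-- Linear forms on `w^*M` lift if functions do: a combination of the forms `φₖ` with the lifts
of the values at `eₖ` as coefficients is a lift. -/
lemma DualBasis.exists_lift_form (h : V' ≤ w ⁻¹ᵁ V) (hs : Function.Surjective (pbO w h))
    (D : DualBasis V M κ) (φ : LinForm V' ((Scheme.Modules.pullback w).obj M)) :
    ∃ ψ : LinForm V M, ψ.pullback w h = φ := by
  choose c hc using fun k ↦ hs (φ.app V' le_rfl (pbM w h (D.e k)))
  refine ⟨.comb c D.φ, LinForm.pbM_ext h fun W hW W' hW' hWW x ↦ ?_⟩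
  rw [LinForm.pullback_app h _ W hW W' hW' hWW, LinForm.comb_app, map_sum]
  conv_rhs => rw [← D.sum_eq W hW x, map_sum, map_sum]
  refine Finset.sum_congr rfl fun k _ ↦ ?_
  have := congrArg (resO X' hW') (hc k)
  rw [resO_pbO, φ.res_app, res_pbM] at this
  rw [map_mul, pbO_resO, this, pbM_smul, pbM_res, map_smul, smul_eq_mul, mul_comm]

/-- The endomorphism `x ↦ ∑ ψᵢ(x) aᵢ`. -/
def rankSum (a : ι → Γ(M, V)) (ψ : ι → LinForm V M) : HomOn V M M where
  app W hW := ∑ i, ((ψ i).app W hW).smulRight (res M hW (a i))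
  res_app W W' hW h x := by simp [LinearMap.sum_apply, res_smul, LinForm.res_app]

lemma rankSum_app (a : ι → Γ(M, V)) (ψ : ι → LinForm V M) (W hW) (x : Γ(M, W)) :
    (rankSum a ψ).app W hW x = ∑ i, (ψ i).app W hW x • res M hW (a i) := by
  simp [rankSum, LinearMap.sum_apply]

/-- A dual basis of `w^*M` lifts to one of `M`, at the cost of adding elements and forms that
vanish on `w^*M`. If `e = ∑ ψᵢ(-) aᵢ` is the endomorphism given by arbitrary lifts and `d = 1 - e`,
the identity `1 = e (2 - e) + d²` exhibits `M` in the required form. -/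
lemma DualBasis.exists_lift (h : V' ≤ w ⁻¹ᵁ V) (hs : Function.Surjective (pbO w h))
    (D : DualBasis V M κ) (E : DualBasis V' ((Scheme.Modules.pullback w).obj M) ι) :
    ∃ F : DualBasis V M (ι ⊕ κ), (∀ i, pbM w h (F.e (.inl i)) = E.e i) ∧
      (∀ k, pbM w h (F.e (.inr k)) = 0) ∧ (∀ i, (F.φ (.inl i)).pullback w h = E.φ i) ∧
      ∀ k W hW x, ((F.φ (.inr k)).pullback w h).app W hW x = 0 := by
  choose a ha using fun i ↦ D.exists_lift_section h hs (E.e i)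
  choose ψ hψ using fun i ↦ D.exists_lift_form h hs (E.φ i)
  let e := rankSum a ψ
  let d : HomOn V M M := HomOn.ofHom (𝟙 M) V + -e
  have hd (W hW) (x : Γ(M, W)) : d.app W hW x = x - e.app W hW x := (sub_eq_add_neg _ _).symm
  have hde (W hW) (x : Γ(M, W)) : d.app W hW x + e.app W hW x = x := by rw [hd, sub_add_cancel]
  have he' (W hW) (W' : X'.Opens) (hW' : W' ≤ V') (hWW : W' ≤ w ⁻¹ᵁ W) (x : Γ(M, W)) :
      pbM w hWW (e.app W hW x) = pbM w hWW x := by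
    rw [rankSum_app, map_sum, ← E.sum_eq W' hW' (pbM w hWW x)]
    refine Finset.sum_congr rfl fun i _ ↦ ?_
    rw [pbM_smul, ← LinForm.pullback_app h _ W hW W' hW' hWW, hψ, pbM_res, ← ha, res_pbM]
  have hd' (W hW) (W' : X'.Opens) (hW' : W' ≤ V') (hWW : W' ≤ w ⁻¹ᵁ W) (x : Γ(M, W)) :
      pbM w hWW (d.app W hW x) = 0 := by
    rw [hd, map_sub, he' W hW W' hW' hWW, sub_self]
  have hzero (k) : ((D.φ k).comp d).pullback w h = LinForm.comb 0 E.φ := by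
    refine LinForm.pbM_ext h fun W hW W' hW' hWW x ↦ ?_
    rw [LinForm.pullback_app h _ W hW W' hW' hWW, LinForm.comp_app,
      ← LinForm.pullback_app h _ W hW W' hW' hWW, hd' W hW W' hW' hWW, map_zero, LinForm.comb_app]
    simp
  refine ⟨⟨Sum.elim a fun k ↦ d.app V le_rfl (D.e k),
    Sum.elim (fun i ↦ (ψ i).comp (HomOn.ofHom (𝟙 M) V + d)) fun k ↦ (D.φ k).comp d,
    fun W hW x ↦ ?_⟩, ha, fun k ↦ hd' V le_rfl V' le_rfl h _, fun i ↦ ?_, fun k W hW x ↦ ?_⟩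
  · rw [Fintype.sum_sum_type]
    have h₁ : ∑ i, (ψ i).app W hW (x + d.app W hW x) • res M hW (a i) =
        e.app W hW (x + d.app W hW x) := (rankSum_app a ψ W hW _).symm
    have h₂ : ∑ k, (D.φ k).app W hW (d.app W hW x) • res M hW (d.app V le_rfl (D.e k)) =
        d.app W hW (d.app W hW x) := by
      conv_rhs => rw [← D.sum_eq W hW (d.app W hW x), map_sum]
      exact Finset.sum_congr rfl fun k _ ↦ by rw [map_smul, d.res_app]
    refine (congrArg₂ (· + ·) h₁ h₂).trans ?_
    rw [map_add, add_assoc, ← add_comm (d.app W hW (d.app W hW x)), hde, add_comm, hde]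
  · refine LinForm.pbM_ext h fun W hW W' hW' hWW x ↦ ?_
    refine (LinForm.pullback_app h _ W hW W' hW' hWW x).trans ?_
    refine (LinForm.pullback_app h (ψ i) W hW W' hW' hWW (x + d.app W hW x)).symm.trans ?_
    rw [map_add, hd' W hW W' hW' hWW, add_zero, hψ]
  · refine congr(LinForm.app $(hzero k) W hW x).trans ?_
    simp [LinForm.comb_app]

end Lift

namespace AlgSheaf

/-! ### Sections of a pinched algebra -/

section Sections

variable {X' X Y' Y : Scheme.{u}} {w : X' ⟶ X} {g : X' ⟶ Y'} {f : X ⟶ Y} {u : Y' ⟶ Y}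
  (e : w ≫ f = g ≫ u) (T : Limits.CategoricalPullback (pullbackAlg g) (pullbackAlg w))

/-- The isomorphism `τ : g^*B' ⟶ w^*A` of a triple `(B', τ, A)`, on underlying modules. -/
def gluing : (Scheme.Modules.pullback g).obj T.fst.mod ⟶
    (Scheme.Modules.pullback w).obj T.snd.mod := T.iso.hom.hom

/-- The component on `Y'` of a section of the pinched algebra. -/
def pr₁ {U : Y.Opens} : Γ(((pinch e).obj T).mod, U) →+ Γ(T.fst.mod, u ⁻¹ᵁ U) :=
  ((fiberFst (pinchLeft e T) (pinchRight T)).hom.app U).hom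

/-- The component on `X` of a section of the pinched algebra. -/
def pr₂ {U : Y.Opens} : Γ(((pinch e).obj T).mod, U) →+ Γ(T.snd.mod, f ⁻¹ᵁ U) :=
  ((fiberSnd (pinchLeft e T) (pinchRight T)).hom.app U).hom

variable {e T} {U V : Y.Opens}

lemma pr₁_smul (r : Γ(Y, U)) (x : Γ(((pinch e).obj T).mod, U)) :
    pr₁ e T (r • x) = appO u U r • pr₁ e T x :=
  (fiberFst (pinchLeft e T) (pinchRight T)).hom.app_smul r x

lemma pr₂_smul (r : Γ(Y, U)) (x : Γ(((pinch e).obj T).mod, U)) :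
    pr₂ e T (r • x) = appO f U r • pr₂ e T x :=
  (fiberSnd (pinchLeft e T) (pinchRight T)).hom.app_smul r x

lemma pr₁_res (h : U ≤ V) (x : Γ(((pinch e).obj T).mod, V)) :
    pr₁ e T (res _ h x) = res _ (preimage_le u h) (pr₁ e T x) :=
  app_res (fiberFst (pinchLeft e T) (pinchRight T)).hom h x

lemma pr₂_res (h : U ≤ V) (x : Γ(((pinch e).obj T).mod, V)) :
    pr₂ e T (res _ h x) = res _ (preimage_le f h) (pr₂ e T x) :=
  app_res (fiberSnd (pinchLeft e T) (pinchRight T)).hom h x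

lemma pr₁_one : pr₁ e T (((pinch e).obj T).one U) = T.fst.one (u ⁻¹ᵁ U) :=
  (fiberFst (pinchLeft e T) (pinchRight T)).map_one U

lemma pr₂_one : pr₂ e T (((pinch e).obj T).one U) = T.snd.one (f ⁻¹ᵁ U) :=
  (fiberSnd (pinchLeft e T) (pinchRight T)).map_one U

lemma pr₁_mul (x y : Γ(((pinch e).obj T).mod, U)) : pr₁ e T (((pinch e).obj T).mul.app U x y) =
    T.fst.mul.app (u ⁻¹ᵁ U) (pr₁ e T x) (pr₁ e T y) :=
  (fiberFst (pinchLeft e T) (pinchRight T)).map_mul U x y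

lemma pr₂_mul (x y : Γ(((pinch e).obj T).mod, U)) : pr₂ e T (((pinch e).obj T).mul.app U x y) =
    T.snd.mul.app (f ⁻¹ᵁ U) (pr₂ e T x) (pr₂ e T y) :=
  (fiberSnd (pinchLeft e T) (pinchRight T)).map_mul U x y

lemma pinch_ext {x y : Γ(((pinch e).obj T).mod, U)} (h₁ : pr₁ e T x = pr₁ e T y)
    (h₂ : pr₂ e T x = pr₂ e T y) : x = y :=
  fiber_ext (pinchLeft e T) (pinchRight T) h₁ h₂

lemma pinchLeft_app (b : Γ(T.fst.mod, u ⁻¹ᵁ U)) : (pinchLeft e T).hom.app U b =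
    (gluing T).app ((w ≫ f) ⁻¹ᵁ U) (pbM g (preimage_le_of_eq e U) b) :=
  (app_res (gluing T) (preimage_le_of_eq e U) (toPullback g T.fst.mod (u ⁻¹ᵁ U) b)).symm

lemma pinchRight_app (a : Γ(T.snd.mod, f ⁻¹ᵁ U)) :
    (pinchRight T).hom.app U a = pbM w (preimage_comp_le U) a :=
  (pbM_self (f := w) a).symm

/-- The two components of a section agree on `X'`. -/
lemma pr_condition (x : Γ(((pinch e).obj T).mod, U)) {W : X'.Opens} (h₁ : W ≤ g ⁻¹ᵁ u ⁻¹ᵁ U)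
    (h₂ : W ≤ w ⁻¹ᵁ f ⁻¹ᵁ U) :
    (gluing T).app W (pbM g h₁ (pr₁ e T x)) = pbM w h₂ (pr₂ e T x) := by
  have h₀ : (pinchLeft e T).hom.app U (pr₁ e T x) = (pinchRight T).hom.app U (pr₂ e T x) :=
    fiber_condition (pinchLeft e T) (pinchRight T) x
  have h := (pinchLeft_app (e := e) (pr₁ e T x)).symm.trans
    (h₀.trans (pinchRight_app (pr₂ e T x)))
  have h₃ : W ≤ (w ≫ f) ⁻¹ᵁ U := h₂
  have := congrArg (res _ h₃) h
  rwa [← app_res, res_pbM, res_pbM] at this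

/-- Compatible sections of `B'` and `A` define a section of the pinched algebra. -/
lemma exists_pinch (b : Γ(T.fst.mod, u ⁻¹ᵁ U)) (a : Γ(T.snd.mod, f ⁻¹ᵁ U))
    (h : (gluing T).app ((w ≫ f) ⁻¹ᵁ U) (pbM g (preimage_le_of_eq e U) b) =
      pbM w (preimage_comp_le U) a) :
    ∃ x : Γ(((pinch e).obj T).mod, U), pr₁ e T x = b ∧ pr₂ e T x = a :=
  have h₀ : (pinchLeft e T).hom.app U b = (pinchRight T).hom.app U a :=
    (pinchLeft_app (e := e) b).trans (h.trans (pinchRight_app a).symm)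
  exists_fiber (pinchLeft e T) (pinchRight T) b a h₀

end Sections

/-! ### Dual bases of a pinched algebra -/

section PinchDualBasis

variable {X' X Y' Y : Scheme.{u}} {w : X' ⟶ X} {g : X' ⟶ Y'} {f : X ⟶ Y} {u : Y' ⟶ Y}
  (sq : BicartesianSq w g f u) [IsAffineHom f] [IsAffineHom u]
  (T : Limits.CategoricalPullback (pullbackAlg g) (pullbackAlg w))

/-- Compatible linear forms on `B'` and `A` give a linear form on the pinched algebra, with values
in the functions on `Y`, which are pairs of functions on `Y'` and `X` that agree on `X'`. -/
lemma exists_linForm_pinch {V : Y.Opens} (φ : LinForm (u ⁻¹ᵁ V) T.fst.mod)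
    (ψ : LinForm (f ⁻¹ᵁ V) T.snd.mod)
    (h : ∀ W hW y, (φ.pullback g (preimage_le_of_eq sq.w V)).app W hW y =
      (ψ.pullback w (preimage_comp_le V)).app W hW ((gluing T).app W y)) :
    ∃ χ : LinForm V ((pinch sq.w).obj T).mod, ∀ W hW x,
      appO u W (χ.app W hW x) = φ.app (u ⁻¹ᵁ W) (preimage_le u hW) (pr₁ sq.w T x) ∧
      appO f W (χ.app W hW x) = ψ.app (f ⁻¹ᵁ W) (preimage_le f hW) (pr₂ sq.w T x) := by
  have key (W : Y.Opens) (hW : W ≤ V) (x : Γ(((pinch sq.w).obj T).mod, W)) :=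
    exists_appO_eq sq (φ.app (u ⁻¹ᵁ W) (preimage_le u hW) (pr₁ sq.w T x))
      (ψ.app (f ⁻¹ᵁ W) (preimage_le f hW) (pr₂ sq.w T x)) (by
        have h₁ := h ((w ≫ f) ⁻¹ᵁ W) (preimage_le (w ≫ f) hW)
          (pbM g (preimage_le_of_eq sq.w W) (pr₁ sq.w T x))
        rw [LinForm.pullback_app _ _ _ (preimage_le u hW)] at h₁
        rw [h₁, pr_condition x _ (preimage_comp_le W),
          LinForm.pullback_app _ _ _ (preimage_le f hW)])
  choose χ h₁ h₂ using key
  exact ⟨⟨fun W hW ↦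
    { toFun := χ W hW
      map_add' := fun x y ↦ eq_of_appO_eq sq (by simp [h₁]) (by simp [h₂])
      map_smul' := fun r x ↦ eq_of_appO_eq sq (by simp [h₁, pr₁_smul]) (by simp [h₂, pr₂_smul]) },
    fun W W' hW hV x ↦ eq_of_appO_eq sq
      (by
        have := φ.res_app _ _ (preimage_le u hW) (preimage_le u hV) (pr₁ sq.w T x)
        simp only [LinearMap.coe_mk, AddHom.coe_mk]
        rw [appO_res, h₁, h₁, this, pr₁_res])
      (by
        have := ψ.res_app _ _ (preimage_le f hW) (preimage_le f hV) (pr₂ sq.w T x)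
        simp only [LinearMap.coe_mk, AddHom.coe_mk]
        rw [appO_res, h₂, h₂, this, pr₂_res])⟩, fun W hW x ↦ ⟨h₁ W hW x, h₂ W hW x⟩⟩

/-- Compatible dual bases on `Y'` and `X` give a dual basis of the pinched algebra. -/
lemma exists_dualBasis_pinch {V : Y.Opens} {ι : Type*} [Fintype ι]
    (D : DualBasis (u ⁻¹ᵁ V) T.fst.mod ι) (E : DualBasis (f ⁻¹ᵁ V) T.snd.mod ι)
    (he : ∀ i, (gluing T).app _ (pbM g (preimage_le_of_eq sq.w V) (D.e i)) =
      pbM w (preimage_comp_le V) (E.e i))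
    (hφ : ∀ i W hW y, ((D.φ i).pullback g (preimage_le_of_eq sq.w V)).app W hW y =
      ((E.φ i).pullback w (preimage_comp_le V)).app W hW ((gluing T).app W y)) :
    ∃ F : DualBasis V ((pinch sq.w).obj T).mod ι,
      (∀ i, pr₁ sq.w T (F.e i) = D.e i) ∧ (∀ i, pr₂ sq.w T (F.e i) = E.e i) ∧
      ∀ i W hW x, appO u W ((F.φ i).app W hW x) =
          (D.φ i).app (u ⁻¹ᵁ W) (preimage_le u hW) (pr₁ sq.w T x) ∧
        appO f W ((F.φ i).app W hW x) =
          (E.φ i).app (f ⁻¹ᵁ W) (preimage_le f hW) (pr₂ sq.w T x) := by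
  choose x hx₁ hx₂ using fun i ↦ exists_pinch (D.e i) (E.e i) (he i)
  choose χ hχ using fun i ↦ exists_linForm_pinch sq T (D.φ i) (E.φ i) (hφ i)
  refine ⟨⟨x, χ, fun W hW y ↦ pinch_ext ?_ ?_⟩, hx₁, hx₂, hχ⟩
  · rw [map_sum]
    refine Eq.trans ?_ (D.sum_eq _ (preimage_le u hW) _)
    exact Finset.sum_congr rfl fun i _ ↦ by rw [pr₁_smul, (hχ i W hW y).1, pr₁_res, hx₁]
  · rw [map_sum]
    refine Eq.trans ?_ (E.sum_eq _ (preimage_le f hW) _)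
    exact Finset.sum_congr rfl fun i _ ↦ by rw [pr₂_smul, (hχ i W hW y).2, pr₂_res, hx₂]

end PinchDualBasis

end AlgSheaf

/-! ### Pinchings of Azumaya algebras are Azumaya algebras -/

section General

variable {X : Scheme.{u}} {M : X.Modules} {V : X.Opens} {ι κ : Type*} [Fintype ι] [Fintype κ]

lemma LinForm.comb_zero_app (φ : ι → LinForm V M) (W : X.Opens) (h : W ≤ V) (x : Γ(M, W)) :
    (LinForm.comb 0 φ).app W h x = 0 := by
  simp [LinForm.comb_app]

/-- Enlarging a dual basis by zeros. -/
def DualBasis.addZero (D : DualBasis V M ι) (κ : Type*) [Fintype κ] : DualBasis V M (ι ⊕ κ) where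
  e := Sum.elim D.e 0
  φ := Sum.elim D.φ fun _ ↦ .comb 0 D.φ
  sum_eq W h x := by
    rw [Fintype.sum_sum_type]
    simpa using D.sum_eq W h x

/-- Reindexing a dual basis. -/
def DualBasis.reindex (D : DualBasis V M ι) (σ : κ ≃ ι) : DualBasis V M κ where
  e := D.e ∘ σ
  φ := D.φ ∘ σ
  sum_eq W h x := by
    exact (σ.sum_comp fun i ↦ (D.φ i).app W h x • res M h (D.e i)).trans (D.sum_eq W h x)

end General

section JointlyInjective

variable {R R₁ R₂ C C₁ C₂ ι : Type*} [CommRing R] [CommRing R₁] [CommRing R₂] [AddCommGroup C]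
  [AddCommGroup C₁] [AddCommGroup C₂] [Module R C] [Module R₁ C₁] [Module R₂ C₂] [Fintype ι]
  {μ : C →ₗ[R] C →ₗ[R] C} {μ₁ : C₁ →ₗ[R₁] C₁ →ₗ[R₁] C₁} {μ₂ : C₂ →ₗ[R₂] C₂ →ₗ[R₂] C₂}
  {e : ι → C} {e₁ : ι → C₁} {e₂ : ι → C₂} {φ : ι → C →ₗ[R] R} {φ₁ : ι → C₁ →ₗ[R₁] R₁}
  {φ₂ : ι → C₂ →ₗ[R₂] R₂} {T : ι → ι → ι → ι → R}

/-- The equations `IsInv` can be checked after applying a jointly injective pair of maps. -/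
lemma IsInv.of_jointly_injective (ρ₁ : R →+* R₁) (ρ₂ : R →+* R₂) (f₁ : C →+ C₁) (f₂ : C →+ C₂)
    (hρ : ∀ r s, ρ₁ r = ρ₁ s → ρ₂ r = ρ₂ s → r = s)
    (hf : ∀ x y, f₁ x = f₁ y → f₂ x = f₂ y → x = y)
    (hsmul₁ : ∀ r x, f₁ (r • x) = ρ₁ r • f₁ x) (hsmul₂ : ∀ r x, f₂ (r • x) = ρ₂ r • f₂ x)
    (hmul₁ : ∀ x y, f₁ (μ x y) = μ₁ (f₁ x) (f₁ y)) (hmul₂ : ∀ x y, f₂ (μ x y) = μ₂ (f₂ x) (f₂ y))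
    (he₁ : ∀ i, f₁ (e i) = e₁ i) (he₂ : ∀ i, f₂ (e i) = e₂ i)
    (hφ₁ : ∀ i x, ρ₁ (φ i x) = φ₁ i (f₁ x)) (hφ₂ : ∀ i x, ρ₂ (φ i x) = φ₂ i (f₂ x))
    (h₁ : IsInv μ₁ e₁ φ₁ fun i j a b ↦ ρ₁ (T i j a b))
    (h₂ : IsInv μ₂ e₂ φ₂ fun i j a b ↦ ρ₂ (T i j a b)) : IsInv μ e φ T where
  act_eq i j m := hf _ _
    (by simpa only [map_sum, hsmul₁, hmul₁, he₁, hφ₁] using h₁.act_eq i j m)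
    (by simpa only [map_sum, hsmul₂, hmul₂, he₂, hφ₂] using h₂.act_eq i j m)
  sum_eq k l a b := hρ _ _
    (by simpa only [map_sum, map_mul, hφ₁, hmul₁, he₁] using h₁.sum_eq k l a b)
    (by simpa only [map_sum, map_mul, hφ₂, hmul₂, he₂] using h₂.sum_eq k l a b)
  normalized i j a b := hρ _ _
    (by simpa only [map_sum, map_mul, hφ₁, he₁] using h₁.normalized i j a b)
    (by simpa only [map_sum, map_mul, hφ₂, he₂] using h₂.normalized i j a b)

end JointlyInjective

namespace AlgSheaf

section PinchAzumaya

variable {X' X Y' Y : Scheme.{u}} {w : X' ⟶ X} {g : X' ⟶ Y'} {f : X ⟶ Y} {u : Y' ⟶ Y}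
  (e : w ≫ f = g ≫ u) (T : Limits.CategoricalPullback (pullbackAlg g) (pullbackAlg w))

instance : IsIso (gluing T) := by
  refine ⟨T.iso.inv.hom, ?_, ?_⟩
  · exact congr(Hom.hom $(T.iso.hom_inv_id))
  · exact congr(Hom.hom $(T.iso.inv_hom_id))

/-- Dual bases of `B'` and `A` that correspond to each other on `X'`. -/
structure Compatible {V : Y.Opens} {ι : Type*} [Fintype ι] (D : DualBasis (u ⁻¹ᵁ V) T.fst.mod ι)
    (E : DualBasis (f ⁻¹ᵁ V) T.snd.mod ι) : Prop where
  e_eq : ∀ i, (gluing T).app _ (pbM g (preimage_le_of_eq e V) (D.e i)) =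
    pbM w (preimage_comp_le V) (E.e i)
  φ_eq : ∀ i W hW y, ((D.φ i).pullback g (preimage_le_of_eq e V)).app W hW y =
    ((E.φ i).pullback w (preimage_comp_le V)).app W hW ((gluing T).app W y)

/-- Over an affine open there are compatible dual bases: a dual basis of `B'` is pulled back to
`X'`, transported along `τ` and lifted to `A`. -/
lemma exists_compatible [IsAffineHom f] [IsAffineHom u] [IsClosedImmersion w]
    (hB : IsFiniteLocallyFree T.fst.mod) (hA : IsFiniteLocallyFree T.snd.mod) {V : Y.Opens}
    (hV : IsAffineOpen V) : ∃ (n : ℕ) (D : DualBasis (u ⁻¹ᵁ V) T.fst.mod (Fin n))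
      (E : DualBasis (f ⁻¹ᵁ V) T.snd.mod (Fin n)), Compatible e T D E := by
  obtain ⟨n, ⟨D₀⟩⟩ := hB.exists_dualBasis (hV.preimage u)
  obtain ⟨m, ⟨E₀⟩⟩ := hA.exists_dualBasis (hV.preimage f)
  have hs : Function.Surjective (pbO w (preimage_comp_le (w := w) (f := f) V)) := fun x ↦ by
    obtain ⟨y, rfl⟩ := w.app_surjective (f ⁻¹ᵁ V) (hV.preimage f) x
    exact ⟨y, resO_self _ _⟩
  let D' := (D₀.pullback g (preimage_le_of_eq e V)).mapIso (asIso (gluing T))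
  have hτ (W : X'.Opens) (y) : (inv (gluing T)).app W ((gluing T).app W y) = y :=
    congr(($(IsIso.hom_inv_id (gluing T))).app W y)
  obtain ⟨E, h₁, h₂, h₃, h₄⟩ := E₀.exists_lift (preimage_comp_le V) hs D'
  -- the additional elements and forms of the lift vanish on `X'`, and correspond to zeros on `Y'`
  refine ⟨n + m, (D₀.addZero (Fin m)).reindex finSumFinEquiv.symm,
    E.reindex finSumFinEquiv.symm, ⟨fun i ↦ ?_, fun i W hW y ↦ ?_⟩⟩
  · obtain ⟨i, rfl⟩ := finSumFinEquiv.surjective i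
    simp only [DualBasis.reindex, Function.comp_apply, Equiv.symm_apply_apply]
    rcases i with i | k
    · exact (h₁ i).symm
    · refine Eq.trans ?_ (h₂ k).symm
      exact (congrArg _ (map_zero _)).trans (map_zero _)
  · obtain ⟨i, rfl⟩ := finSumFinEquiv.surjective i
    simp only [DualBasis.reindex, Function.comp_apply, Equiv.symm_apply_apply]
    rcases i with i | k
    · rw [h₃]
      exact congrArg _ (hτ W y).symm
    · rw [h₄]
      have : (LinForm.comb 0 D₀.φ).pullback g (preimage_le_of_eq e V) =
          LinForm.comb 0 (D₀.pullback g (preimage_le_of_eq e V)).φ :=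
        LinForm.pbM_ext (preimage_le_of_eq e V) fun W hW V' hV' hW' x ↦ by
          rw [LinForm.pullback_app _ _ W hW, LinForm.comb_zero_app, map_zero]
          exact (LinForm.comb_zero_app _ _ _ _).symm
      exact congr(LinForm.app $this W hW y).trans (LinForm.comb_zero_app _ _ _ _)

variable {T} in
/-- The solutions of the equations `IsInv` on `Y'` and on `X` agree on `X'` by uniqueness, so they
give a solution on `Y`. -/
lemma Compatible.exists_isInvOn (sq : BicartesianSq w g f u) [IsAffineHom f] [IsAffineHom u]
    {V : Y.Opens} {ι : Type*} [Fintype ι] {D : DualBasis (u ⁻¹ᵁ V) T.fst.mod ι}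
    {E : DualBasis (f ⁻¹ᵁ V) T.snd.mod ι} (h : Compatible sq.w T D E)
    (hB : T.fst.IsAzumaya) (hA : T.snd.IsAzumaya) :
    ∃ (F : DualBasis V ((pinch sq.w).obj T).mod ι) (S : ι → ι → ι → ι → Γ(Y, V)),
      ((pinch sq.w).obj T).IsInvOn F S := by
  obtain ⟨F, he₁, he₂, hF⟩ := exists_dualBasis_pinch sq T D E h.e_eq h.φ_eq
  obtain ⟨S₁, hS₁⟩ := AlgSheaf.exists_isInvOn hB.isIso D
  obtain ⟨S₂, hS₂⟩ := AlgSheaf.exists_isInvOn hA.isIso E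
  have h₁ := (IsInvOn.pullback hS₁ (preimage_le_of_eq sq.w V)).of_hom T.iso.hom
    (D' := E.pullback w (preimage_comp_le V)) h.e_eq fun i W hW x ↦ (h.φ_eq i W hW x).symm
  have h₂ := IsInvOn.pullback hS₂ (preimage_comp_le (w := w) V)
  have h₃ := IsInv.unique h₁ h₂
  choose S h₄ h₅ using fun i j a b ↦ exists_appO_eq sq (S₁ i j a b) (S₂ i j a b)
    (congr_fun₃ (congrFun h₃ i) j a b)
  refine ⟨F, S, IsInv.of_jointly_injective (appO u V) (appO f V) (pr₁ sq.w T) (pr₂ sq.w T)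
    (fun r s ↦ eq_of_appO_eq sq) (fun x y ↦ pinch_ext) pr₁_smul pr₂_smul pr₁_mul pr₂_mul he₁ he₂
    (fun i x ↦ (hF i V le_rfl x).1) (fun i x ↦ (hF i V le_rfl x).2) ?_ ?_⟩
  · simpa only [h₄] using hS₁
  · simpa only [h₅] using hS₂

lemma isAzumaya_pinch (sq : BicartesianSq w g f u) [IsAffineHom f] [IsClosedImmersion u]
    (hB : T.fst.IsAzumaya) (hA : T.snd.IsAzumaya) : ((pinch sq.w).obj T).IsAzumaya := by
  have : IsClosedImmersion w := MorphismProperty.of_isPullback sq.toIsPullback.flip inferInstance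
  refine isAzumaya_iff.mpr ⟨fun p ↦ ?_, fun p V hp h0 ↦ ?_⟩
  · obtain ⟨V, hV, hp, -⟩ := exists_isAffineOpen_mem_and_subset (x := p) (U := ⊤) trivial
    obtain ⟨n, D, E, h⟩ := exists_compatible sq.w T hB.finiteLocallyFree hA.finiteLocallyFree hV
    obtain ⟨F, S, hS⟩ := h.exists_isInvOn sq hB hA
    exact ⟨V, n, F, S, hp, hS⟩
  -- if `1` vanishes on `V`, then `V` has empty inverse images, and all functions on `V` are zero
  · have h₁ : u ⁻¹ᵁ V = ⊥ := Opens.ext (Set.eq_empty_iff_forall_notMem.mpr fun q hq ↦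
      (isAzumaya_iff.mp hB).2 q _ hq (by rw [← pr₁_one (e := sq.w), h0, map_zero]))
    have h₂ : f ⁻¹ᵁ V = ⊥ := Opens.ext (Set.eq_empty_iff_forall_notMem.mpr fun q hq ↦
      (isAzumaya_iff.mp hA).2 q _ hq (by rw [← pr₂_one (e := sq.w), h0, map_zero]))
    have h₁' : Subsingleton Γ(Y', u ⁻¹ᵁ V) := by rw [h₁]; infer_instance
    have h₂' : Subsingleton Γ(X, f ⁻¹ᵁ V) := by rw [h₂]; infer_instance
    have : Nonempty V := ⟨⟨p, hp⟩⟩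
    exact zero_ne_one (α := Γ(Y, V))
      (eq_of_appO_eq sq (Subsingleton.elim _ _) (Subsingleton.elim _ _))

end PinchAzumaya

end AlgSheaf

/-! ### Iterated pullbacks -/

section IteratedPullback

variable {X' Y' Y : Scheme.{u}} {g : X' ⟶ Y'} {u : Y' ⟶ Y} {M : Y.Modules} {P : X'.Modules}

lemma pullback_pullback_hom_ext {φ ψ : (pullback g).obj ((pullback u).obj M) ⟶ P}
    (h : ∀ (U : Y.Opens) (V : Y'.Opens) (W : X'.Opens) (hV : V ≤ u ⁻¹ᵁ U) (hW : W ≤ g ⁻¹ᵁ V)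
      (x : Γ(M, U)), φ.app W (pbM g hW (pbM u hV x)) = ψ.app W (pbM g hW (pbM u hV x))) :
    φ = ψ := by
  refine ((pullbackPushforwardAdjunction g).homEquiv ((pullback u).obj M) P).injective
    (pullback_hom_ext u fun U x ↦ ?_)
  have h₁ : pbM g le_rfl (pbM u le_rfl x) = toPullback g _ _ (toPullback u M U x) :=
    (pbM_self _).trans (congrArg _ (pbM_self x))
  exact (congrArg (φ.app _) h₁).symm.trans ((h U (u ⁻¹ᵁ U) (g ⁻¹ᵁ u ⁻¹ᵁ U) le_rfl le_rfl
    x).trans (congrArg (ψ.app _) h₁))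

lemma HomOn.pbM_pbM_ext {V₀ : Y.Opens} {W₀ : X'.Opens} (h₀ : W₀ ≤ g ⁻¹ᵁ u ⁻¹ᵁ V₀)
    {φ ψ : HomOn W₀ ((pullback g).obj ((pullback u).obj M)) P}
    (h : ∀ (U : Y.Opens) (_ : U ≤ V₀) (V : Y'.Opens) (W : X'.Opens) (hW₀ : W ≤ W₀)
      (hV : V ≤ u ⁻¹ᵁ U) (hW : W ≤ g ⁻¹ᵁ V) (x : Γ(M, U)),
      φ.app W hW₀ (pbM g hW (pbM u hV x)) = ψ.app W hW₀ (pbM g hW (pbM u hV x))) : φ = ψ := by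
  refine toCut_injective (pullback_pullback_hom_ext fun U V W hV hW x ↦
    (cutEquiv P W₀ W).injective ?_)
  have h₁ : W₀ ⊓ W ≤ g ⁻¹ᵁ (u ⁻¹ᵁ V₀ ⊓ V) :=
    le_preimage_inf g (inf_le_left.trans h₀) (inf_le_right.trans hW)
  have h₂ : res _ inf_le_right (pbM g hW (pbM u hV x)) =
      pbM g h₁ (pbM u (le_preimage_inf u inf_le_left (inf_le_right.trans hV))
        (res M inf_le_right x)) := by
    rw [pbM_res, res_pbM, ← res_pbM (f := u) hV inf_le_right x, pbM_res]
  rw [cutEquiv_toCut, cutEquiv_toCut, h₂]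
  exact h _ inf_le_left _ _ _ _ _ _

lemma LinForm.pbM_pbM_ext {V₀ : Y.Opens} {W₀ : X'.Opens} (h₀ : W₀ ≤ g ⁻¹ᵁ u ⁻¹ᵁ V₀)
    {φ ψ : LinForm W₀ ((Scheme.Modules.pullback g).obj ((Scheme.Modules.pullback u).obj M))}
    (h : ∀ (U : Y.Opens) (_ : U ≤ V₀) (V : Y'.Opens) (W : X'.Opens) (hW₀ : W ≤ W₀)
      (hV : V ≤ u ⁻¹ᵁ U) (hW : W ≤ g ⁻¹ᵁ V) (x : Γ(M, U)),
      φ.app W hW₀ (pbM g hW (pbM u hV x)) = ψ.app W hW₀ (pbM g hW (pbM u hV x))) : φ = ψ :=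
  toHomOn_injective (HomOn.pbM_pbM_ext h₀ fun U hU V W hW₀ hV hW x ↦
    congr((unitEquiv W).symm $(h U hU V W hW₀ hV hW x)))

end IteratedPullback

namespace AlgSheaf

/-! ### The adjunction between pullback and pushforward of algebras -/

section Lift

variable {X Y : Scheme.{u}} {f : X ⟶ Y} {A : AlgSheaf Y} {P : AlgSheaf X}

lemma one_pbM {U : Y.Opens} {V : X.Opens} (h : V ≤ f ⁻¹ᵁ U) :
    pbM f h (A.one U) = ((pullbackAlg f).obj A).one V :=
  (pullbackObj_one f A V U h).symm

/-- A homomorphism of modules on `f^*M` is multiplicative as soon as it is so on pulled back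
sections. -/
lemma map_mul_of_pbM {M : Y.Modules} {N : X.Modules} (β : BilinMap M M M) (γ : BilinMap N N N)
    (ψ : (pullback f).obj M ⟶ N)
    (h : ∀ (U : Y.Opens) (V : X.Opens) (hV : V ≤ f ⁻¹ᵁ U) (x y : Γ(M, U)),
      ψ.app V (pbM f hV (β.app U x y)) = γ.app V (ψ.app V (pbM f hV x)) (ψ.app V (pbM f hV y)))
    (U : X.Opens) (a b : Γ((pullback f).obj M, U)) :
    ψ.app U ((β.pullback f).app U a b) = γ.app U (ψ.app U a) (ψ.app U b) := by
  have h₁ : (HomOn.ofHom ψ U).comp ((β.pullback f).left b) =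
      (γ.left (ψ.app U b)).comp (HomOn.ofHom ψ U) := by
    refine HomOn.pbM_ext (le_preimage_top f U) fun W _ V hV hW x ↦ ?_
    simp only [HomOn.comp, LinearMap.comp_apply, BilinMap.left_app, HomOn.ofHom_app, ← app_res]
    generalize res _ hV b = b
    suffices (HomOn.ofHom ψ V).comp ((β.pullback f).right (pbM f hW x)) =
        (γ.right (ψ.app V (pbM f hW x))).comp (HomOn.ofHom ψ V) by
      simpa [HomOn.comp, HomOn.ofHom_app] using congr(HomOn.app $this V le_rfl b)
    refine HomOn.pbM_ext hW fun W' hW' V' hV' hW'' y ↦ ?_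
    simp only [HomOn.comp, LinearMap.comp_apply, BilinMap.right_app, HomOn.ofHom_app, ← app_res]
    have : res ((pullback f).obj M) hV' (pbM f hW x) = pbM f hW'' (res M hW' x) := by
      rw [pbM_res]; exact res_pbM _ _ _
    rw [this]
    exact (congrArg (ψ.app V') (β.pullback_app f W' _ y hW'')).trans (h _ _ hW'' _ _)
  simpa [HomOn.comp, HomOn.ofHom_app] using congr(HomOn.app $h₁ U le_rfl a)

/-- The module homomorphism underlying `liftAlg`. -/
def liftAlgHom (f : X ⟶ Y) (φ : A ⟶ (pushforwardAlg f).obj P) :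
    (pullback f).obj A.mod ⟶ P.mod :=
  adjLift f (show A.mod ⟶ (pushforward f).obj P.mod from φ.hom)

lemma liftAlgHom_pbM (φ : A ⟶ (pushforwardAlg f).obj P) {U : Y.Opens} {V : X.Opens}
    (h : V ≤ f ⁻¹ᵁ U) (x : Γ(A.mod, U)) :
    (liftAlgHom f φ).app V (pbM f h x) = res P.mod h (φ.hom.app U x) :=
  adjLift_pbM (show A.mod ⟶ (pushforward f).obj P.mod from φ.hom) h x

/-- The homomorphism `f^*A ⟶ P` adjoint to `A ⟶ f_*P`. -/
def liftAlg (f : X ⟶ Y) (φ : A ⟶ (pushforwardAlg f).obj P) : (pullbackAlg f).obj A ⟶ P where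
  hom := liftAlgHom f φ
  map_one U := by
    refine (congrArg _ (one_pbM (le_preimage_top f U)).symm).trans ?_
    refine (liftAlgHom_pbM φ _ _).trans ?_
    rw [φ.map_one]
    exact P.res_one _ _ _
  map_mul := map_mul_of_pbM _ _ _ fun U V h x y ↦ by
    rw [liftAlgHom_pbM, liftAlgHom_pbM, liftAlgHom_pbM, φ.map_mul]
    exact P.mul.res_app _ _ _ _ _

lemma liftAlg_pbM (φ : A ⟶ (pushforwardAlg f).obj P) {U : Y.Opens} {V : X.Opens}
    (h : V ≤ f ⁻¹ᵁ U) (x : Γ(A.mod, U)) :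
    (liftAlg f φ).hom.app V (pbM f h x) = res P.mod h (φ.hom.app U x) :=
  liftAlgHom_pbM φ h x

lemma unit_app (U : Y.Opens) (x : Γ(A.mod, U)) :
    ((unit f).app A).hom.app U x = pbM f le_rfl x := (pbM_self x).symm

lemma pullbackAlg_hom_ext {φ ψ : (pullbackAlg f).obj A ⟶ P}
    (h : ∀ (U : Y.Opens) (V : X.Opens) (hV : V ≤ f ⁻¹ᵁ U) (x : Γ(A.mod, U)),
      φ.hom.app V (pbM f hV x) = ψ.hom.app V (pbM f hV x)) : φ = ψ :=
  hom_ext (pullback_hom_ext f fun U x ↦ by rw [← pbM_self]; exact h _ _ _ _)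

lemma isIso_of_isIso_hom {A B : AlgSheaf X} (φ : A ⟶ B) [IsIso φ.hom] : IsIso φ := by
  have h (U : X.Opens) (x) : φ.hom.app U ((inv φ.hom).app U x) = x :=
    congr(($(IsIso.inv_hom_id φ.hom)).app U x)
  have h' (U : X.Opens) (x) : (inv φ.hom).app U (φ.hom.app U x) = x :=
    congr(($(IsIso.hom_inv_id φ.hom)).app U x)
  refine ⟨⟨inv φ.hom, fun U ↦ ?_, fun U a b ↦ ?_⟩, hom_ext (IsIso.hom_inv_id φ.hom),
    hom_ext (IsIso.inv_hom_id φ.hom)⟩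
  · rw [← φ.map_one, h']
  · conv_lhs => rw [← h U a, ← h U b, ← φ.map_mul, h']

end Lift

section Components

variable {X Y Z : Scheme.{u}} {f : X ⟶ Y} {g : Z ⟶ X}

lemma comp_app_eq {A B C : AlgSheaf X} {φ : A ⟶ B} {ψ : B ⟶ C} {U : X.Opens} {x : Γ(A.mod, U)}
    {y : Γ(B.mod, U)} {z : Γ(C.mod, U)} (h₁ : φ.hom.app U x = y) (h₂ : ψ.hom.app U y = z) :
    (φ ≫ ψ).hom.app U x = z :=
  (congrArg (ψ.hom.app U) h₁).trans h₂

lemma pullbackAlg_map_pbM {A B : AlgSheaf Y} (φ : A ⟶ B) {U : Y.Opens} {V : X.Opens}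
    (h : V ≤ f ⁻¹ᵁ U) (x : Γ(A.mod, U)) :
    ((pullbackAlg f).map φ).hom.app V (pbM f h x) = pbM f h (φ.hom.app U x) :=
  map_pbM φ.hom h x

lemma pullbackAlg_map_map_pbM {A B : AlgSheaf Y} (φ : A ⟶ B) {U : Y.Opens} {V : X.Opens}
    {W : Z.Opens} (h : V ≤ f ⁻¹ᵁ U) (h' : W ≤ g ⁻¹ᵁ V) (x : Γ(A.mod, U)) :
    ((pullbackAlg g).map ((pullbackAlg f).map φ)).hom.app W (pbM g h' (pbM f h x)) =
      pbM g h' (pbM f h (φ.hom.app U x)) :=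
  (pullbackAlg_map_pbM _ h' _).trans (congrArg (pbM g h') (pullbackAlg_map_pbM φ h x))

end Components

/-! ### The adjunction between pullback and pinching -/

section Square

variable {X' X Y' Y : Scheme.{u}} {w : X' ⟶ X} {g : X' ⟶ Y'} {f : X ⟶ Y} {u : Y' ⟶ Y}
  (e : w ≫ f = g ≫ u)

/-- The canonical homomorphism `B ⟶ u_*g_*w^*f^*B` for a commutative square. -/
def canUnit (B : AlgSheaf Y) : B ⟶ (pushforwardAlg u).obj ((pushforwardAlg g).obj
    ((pullbackAlg w).obj ((pullbackAlg f).obj B))) :=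
  (unit f).app B ≫ (pushforwardAlg f).map ((unit w).app ((pullbackAlg f).obj B)) ≫
    (pushforwardSquare e.symm).app _

lemma canUnit_app (B : AlgSheaf Y) {U : Y.Opens} (x : Γ(B.mod, U)) :
    (canUnit e B).hom.app U x = res ((pullback w).obj ((pullback f).obj B.mod))
      (preimage_le_of_eq e.symm U) (pbM w le_rfl (pbM f le_rfl x)) := by
  rw [pbM_self, pbM_self]
  rfl

/-- The canonical homomorphism `g^*u^*B ⟶ w^*f^*B` for a commutative square. -/
def canHom (B : AlgSheaf Y) : (pullbackAlg g).obj ((pullbackAlg u).obj B) ⟶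
    (pullbackAlg w).obj ((pullbackAlg f).obj B) :=
  liftAlg g (liftAlg u (canUnit e B))

lemma canHom_pbM (B : AlgSheaf Y) {U : Y.Opens} {V : Y'.Opens} {V' : X.Opens} {W : X'.Opens}
    (hV : V ≤ u ⁻¹ᵁ U) (hW : W ≤ g ⁻¹ᵁ V) (hV' : V' ≤ f ⁻¹ᵁ U) (hW' : W ≤ w ⁻¹ᵁ V')
    (x : Γ(B.mod, U)) :
    (canHom e B).hom.app W (pbM g hW (pbM u hV x)) = pbM w hW' (pbM f hV' x) := by
  refine (liftAlg_pbM _ hW _).trans ?_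
  refine (congrArg (res _ hW) ((liftAlg_pbM (canUnit e B) hV x).trans
    (congrArg _ (canUnit_app e B x)))).trans ?_
  refine (res_res _ _ _ _).trans ((res_res _ _ _ _).trans ((res_pbM _ _ _).trans ?_))
  exact (pbM_res (f := w) hW' hV' (pbM f le_rfl x)).symm.trans
    (congrArg (pbM w hW') (res_pbM (f := f) le_rfl hV' x))

lemma hom_ext_of_pbM_pbM {B : AlgSheaf Y} {P : AlgSheaf X'}
    {φ ψ : (pullbackAlg g).obj ((pullbackAlg u).obj B) ⟶ P}
    (h : ∀ (U : Y.Opens) (V : Y'.Opens) (W : X'.Opens) (hV : V ≤ u ⁻¹ᵁ U) (hW : W ≤ g ⁻¹ᵁ V)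
      (x : Γ(B.mod, U)), φ.hom.app W (pbM g hW (pbM u hV x)) =
        ψ.hom.app W (pbM g hW (pbM u hV x))) : φ = ψ :=
  hom_ext (pullback_pullback_hom_ext h)

/-- The canonical isomorphism `g^*u^*B ≅ w^*f^*B` for a commutative square. -/
def canIso (B : AlgSheaf Y) : (pullbackAlg g).obj ((pullbackAlg u).obj B) ≅
    (pullbackAlg w).obj ((pullbackAlg f).obj B) where
  hom := canHom e B
  inv := canHom e.symm B
  hom_inv_id := hom_ext_of_pbM_pbM fun U V W hV hW x ↦ by
    have h : W ≤ w ⁻¹ᵁ f ⁻¹ᵁ U := fun p hp ↦ preimage_le_of_eq e.symm U (hV (hW hp))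
    exact (congrArg _ (canHom_pbM e B hV hW le_rfl h x)).trans
      (canHom_pbM e.symm B le_rfl h hV hW x)
  inv_hom_id := hom_ext_of_pbM_pbM fun U V W hV hW x ↦ by
    have h : W ≤ g ⁻¹ᵁ u ⁻¹ᵁ U := fun p hp ↦ preimage_le_of_eq e U (hV (hW hp))
    exact (congrArg _ (canHom_pbM e.symm B hV hW le_rfl h x)).trans
      (canHom_pbM e B le_rfl h hV hW x)

lemma canHom_naturality {A B : AlgSheaf Y} (φ : A ⟶ B) :
    (pullbackAlg g).map ((pullbackAlg u).map φ) ≫ canHom e B =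
      canHom e A ≫ (pullbackAlg w).map ((pullbackAlg f).map φ) :=
  hom_ext_of_pbM_pbM fun U V W hV hW x ↦ by
    have h : W ≤ w ⁻¹ᵁ f ⁻¹ᵁ U := fun p hp ↦ preimage_le_of_eq e.symm U (hV (hW hp))
    exact (comp_app_eq (pullbackAlg_map_map_pbM φ hV hW x) (canHom_pbM e B hV hW le_rfl h _)).trans
      (comp_app_eq (canHom_pbM e A hV hW le_rfl h x) (pullbackAlg_map_map_pbM φ le_rfl h x)).symm

/-- The functor `B ↦ (u^*B, f^*B)`, which is left adjoint to pinching. -/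
def unpinch : AlgSheaf Y ⥤ Limits.CategoricalPullback (pullbackAlg g) (pullbackAlg w) where
  obj B := ⟨(pullbackAlg u).obj B, (pullbackAlg f).obj B, canIso e B⟩
  map φ := ⟨(pullbackAlg u).map φ, (pullbackAlg f).map φ, canHom_naturality e φ⟩
  map_id B := Limits.CategoricalPullback.hom_ext ((pullbackAlg u).map_id B)
    ((pullbackAlg f).map_id B)
  map_comp φ ψ := Limits.CategoricalPullback.hom_ext ((pullbackAlg u).map_comp φ ψ)
    ((pullbackAlg f).map_comp φ ψ)

variable (T : Limits.CategoricalPullback (pullbackAlg g) (pullbackAlg w))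

/-- The first component of the counit. -/
def counitFst : (pullbackAlg u).obj ((pinch e).obj T) ⟶ T.fst :=
  liftAlg u (fiberFst (pinchLeft e T) (pinchRight T))

/-- The second component of the counit. -/
def counitSnd : (pullbackAlg f).obj ((pinch e).obj T) ⟶ T.snd :=
  liftAlg f (fiberSnd (pinchLeft e T) (pinchRight T))

lemma counitFst_pbM {U : Y.Opens} {V : Y'.Opens} (hV : V ≤ u ⁻¹ᵁ U)
    (x : Γ(((pinch e).obj T).mod, U)) :
    (counitFst e T).hom.app V (pbM u hV x) = res _ hV (pr₁ e T x) :=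
  liftAlg_pbM _ _ _

lemma counitSnd_pbM {U : Y.Opens} {V : X.Opens} (hV : V ≤ f ⁻¹ᵁ U)
    (x : Γ(((pinch e).obj T).mod, U)) :
    (counitSnd e T).hom.app V (pbM f hV x) = res _ hV (pr₂ e T x) :=
  liftAlg_pbM _ _ _

lemma counit_condition : (pullbackAlg g).map (counitFst e T) ≫ T.iso.hom =
    canHom e ((pinch e).obj T) ≫ (pullbackAlg w).map (counitSnd e T) :=
  hom_ext_of_pbM_pbM fun U V W hV hW x ↦ by
    have h : W ≤ w ⁻¹ᵁ f ⁻¹ᵁ U := fun p hp ↦ preimage_le_of_eq e.symm U (hV (hW hp))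
    have h₁ : ((pullbackAlg g).map (counitFst e T)).hom.app W (pbM g hW (pbM u hV x)) =
        pbM g (hW.trans (preimage_le g hV)) (pr₁ e T x) :=
      (pullbackAlg_map_pbM (counitFst e T) hW _).trans
        ((congrArg (pbM g hW) (counitFst_pbM e T hV x)).trans (pbM_res _ _ _))
    have h₂ : ((pullbackAlg w).map (counitSnd e T)).hom.app W (pbM w h (pbM f le_rfl x)) =
        pbM w h (pr₂ e T x) :=
      (pullbackAlg_map_pbM (counitSnd e T) h _).trans
        (congrArg (pbM w h) ((counitSnd_pbM e T le_rfl x).trans (res_self _ _ _)))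
    exact (comp_app_eq h₁ (pr_condition x _ h)).trans
      (comp_app_eq (canHom_pbM e _ hV hW le_rfl h x) h₂).symm

/-- The counit of the adjunction between `unpinch` and `pinch`. -/
def counit : (unpinch e).obj ((pinch e).obj T) ⟶ T :=
  ⟨counitFst e T, counitSnd e T, counit_condition e T⟩

lemma unit_condition (B : AlgSheaf Y) : (unit u).app B ≫ pinchLeft e ((unpinch e).obj B) =
    (unit f).app B ≫ pinchRight ((unpinch (g := g) (w := w) e).obj B) :=
  hom_ext (hom_ext' fun U x ↦ by
    have h : (canHom e B).hom.app ((w ≫ f) ⁻¹ᵁ U)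
        (pbM g (preimage_le_of_eq e U) (pbM u le_rfl x)) =
        pbM w (preimage_comp_le U) (pbM f le_rfl x) := canHom_pbM e B _ _ le_rfl _ x
    have h₁ : ((unit u).app B ≫ pinchLeft e ((unpinch e).obj B)).hom.app U x =
      (canHom e B).hom.app ((w ≫ f) ⁻¹ᵁ U)
        (pbM g (preimage_le_of_eq e U) (pbM u le_rfl x)) :=
      comp_app_eq (unit_app U x) (pinchLeft_app (e := e) (T := (unpinch e).obj B) _)
    have h₂ : ((unit f).app B ≫ pinchRight ((unpinch e).obj B)).hom.app U x =
        pbM w (preimage_comp_le U) (pbM f le_rfl x) :=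
      comp_app_eq (unit_app U x) (pinchRight_app (T := (unpinch e).obj B) _)
    exact h₁.trans (h.trans h₂.symm))

/-- The unit of the adjunction between `unpinch` and `pinch`. -/
def unitPinch (B : AlgSheaf Y) : B ⟶ (pinch e).obj ((unpinch (g := g) (w := w) e).obj B) :=
  fiberLift (pinchLeft e ((unpinch e).obj B)) (pinchRight ((unpinch e).obj B)) ((unit u).app B)
    ((unit f).app B) (unit_condition e B)

lemma pr₁_unitPinch (B : AlgSheaf Y) {U : Y.Opens} (x : Γ(B.mod, U)) :
    pr₁ e ((unpinch e).obj B) ((unitPinch e B).hom.app U x) = pbM u le_rfl x :=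
  (congr((Hom.hom $(fiberLift_fst (pinchLeft e ((unpinch e).obj B))
    (pinchRight ((unpinch e).obj B)) ((unit u).app B) ((unit f).app B)
    (unit_condition e B))).app U x)).trans (unit_app U x)

lemma pr₂_unitPinch (B : AlgSheaf Y) {U : Y.Opens} (x : Γ(B.mod, U)) :
    pr₂ e ((unpinch e).obj B) ((unitPinch e B).hom.app U x) = pbM f le_rfl x :=
  (congr((Hom.hom $(fiberLift_snd (pinchLeft e ((unpinch e).obj B))
    (pinchRight ((unpinch e).obj B)) ((unit u).app B) ((unit f).app B)
    (unit_condition e B))).app U x)).trans (unit_app U x)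

variable {T} in
lemma pr₁_map {S : Limits.CategoricalPullback (pullbackAlg g) (pullbackAlg w)} (α : S ⟶ T)
    {U : Y.Opens} (x : Γ(((pinch e).obj S).mod, U)) :
    pr₁ e T (((pinch e).map α).hom.app U x) = α.fst.hom.app (u ⁻¹ᵁ U) (pr₁ e S x) := by
  have h : (pinch e).map α ≫ fiberFst (pinchLeft e T) (pinchRight T) =
      fiberFst (pinchLeft e S) (pinchRight S) ≫ (pushforwardAlg u).map α.fst :=
    by simp only [pinch, fiberMap, fiberLift_fst]
  exact congr((Hom.hom $h).app U x)

variable {T} in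
lemma pr₂_map {S : Limits.CategoricalPullback (pullbackAlg g) (pullbackAlg w)} (α : S ⟶ T)
    {U : Y.Opens} (x : Γ(((pinch e).obj S).mod, U)) :
    pr₂ e T (((pinch e).map α).hom.app U x) = α.snd.hom.app (f ⁻¹ᵁ U) (pr₂ e S x) := by
  have h : (pinch e).map α ≫ fiberSnd (pinchLeft e T) (pinchRight T) =
      fiberSnd (pinchLeft e S) (pinchRight S) ≫ (pushforwardAlg f).map α.snd :=
    by simp only [pinch, fiberMap, fiberLift_snd]
  exact congr((Hom.hom $h).app U x)

lemma pinch_hom_ext {B : AlgSheaf Y} {φ ψ : B ⟶ (pinch e).obj T}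
    (h₁ : ∀ U x, pr₁ e T (φ.hom.app U x) = pr₁ e T (ψ.hom.app U x))
    (h₂ : ∀ U x, pr₂ e T (φ.hom.app U x) = pr₂ e T (ψ.hom.app U x)) : φ = ψ :=
  hom_ext (hom_ext' fun U x ↦ pinch_ext (h₁ U x) (h₂ U x))

lemma unitPinch_naturality {A B : AlgSheaf Y} (φ : A ⟶ B) :
    φ ≫ unitPinch e B = unitPinch e A ≫ (pinch e).map ((unpinch (g := g) (w := w) e).map φ) :=
  pinch_hom_ext e _
    (fun U x ↦ (pr₁_unitPinch e B (φ.hom.app U x)).trans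
      (((pr₁_map e ((unpinch e).map φ) _).trans
        ((congrArg (((pullbackAlg u).map φ).hom.app _) (pr₁_unitPinch e A x)).trans
          (pullbackAlg_map_pbM φ le_rfl x))).symm))
    (fun U x ↦ (pr₂_unitPinch e B (φ.hom.app U x)).trans
      (((pr₂_map e ((unpinch e).map φ) _).trans
        ((congrArg (((pullbackAlg f).map φ).hom.app _) (pr₂_unitPinch e A x)).trans
          (pullbackAlg_map_pbM φ le_rfl x))).symm))

variable {T} in
lemma counit_naturality {S : Limits.CategoricalPullback (pullbackAlg g) (pullbackAlg w)}
    (α : S ⟶ T) : (unpinch e).map ((pinch e).map α) ≫ counit e T = counit e S ≫ α :=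
  Limits.CategoricalPullback.hom_ext
    (pullbackAlg_hom_ext fun _ _ h x ↦
      (comp_app_eq (pullbackAlg_map_pbM _ h x) ((counitFst_pbM e T h _).trans
        (congrArg _ (pr₁_map e α x)))).trans
      (comp_app_eq (counitFst_pbM e S h x) (app_res α.fst.hom h (pr₁ e S x))).symm)
    (pullbackAlg_hom_ext fun _ _ h x ↦
      (comp_app_eq (pullbackAlg_map_pbM _ h x) ((counitSnd_pbM e T h _).trans
        (congrArg _ (pr₂_map e α x)))).trans
      (comp_app_eq (counitSnd_pbM e S h x) (app_res α.snd.hom h (pr₂ e S x))).symm)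

/-- One of the triangle identities. -/
lemma unitPinch_counit : unitPinch e ((pinch e).obj T) ≫ (pinch e).map (counit e T) = 𝟙 _ :=
  pinch_hom_ext e _
    (fun _ x ↦ (pr₁_map e (counit e T) _).trans
      ((congrArg ((counitFst e T).hom.app _) (pr₁_unitPinch e _ x)).trans
        ((counitFst_pbM e T le_rfl x).trans (res_self _ _ _))))
    (fun _ x ↦ (pr₂_map e (counit e T) _).trans
      ((congrArg ((counitSnd e T).hom.app _) (pr₂_unitPinch e _ x)).trans
        ((counitSnd_pbM e T le_rfl x).trans (res_self _ _ _))))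

end Square

end AlgSheaf

namespace AlgSheaf

/-! ### The unit and the counit are isomorphisms -/

section Isos

variable {X' X Y' Y : Scheme.{u}} {w : X' ⟶ X} {g : X' ⟶ Y'} {f : X ⟶ Y} {u : Y' ⟶ Y}
  (sq : BicartesianSq w g f u)

section Counit

variable {T : Limits.CategoricalPullback (pullbackAlg g) (pullbackAlg w)}
  {V : Y.Opens} {ι : Type*} [Fintype ι] {F : DualBasis V ((pinch sq.w).obj T).mod ι}

/-- The counit carries the pullback of a dual basis of the pinched algebra to the dual basis of `B'`
that it was built from. -/
lemma bijective_counitFst {D : DualBasis (u ⁻¹ᵁ V) T.fst.mod ι}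
    (he : ∀ i, pr₁ sq.w T (F.e i) = D.e i)
    (hφ : ∀ i W hW x, appO u W ((F.φ i).app W hW x) =
      (D.φ i).app (u ⁻¹ᵁ W) (preimage_le u hW) (pr₁ sq.w T x)) {W : Y'.Opens}
    (hW : W ≤ u ⁻¹ᵁ V) : Function.Bijective ((counitFst sq.w T).hom.app W) := by
  refine DualBasis.bijective_of_map (F.pullback u le_rfl) D (counitFst sq.w T).hom
    (fun i ↦ ?_) (fun i W hW x ↦ ?_) hW
  · exact (counitFst_pbM sq.w T le_rfl (F.e i)).trans ((res_self _ _ _).trans (he i))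
  · have : (D.φ i).comp (HomOn.ofHom (counitFst sq.w T).hom _) = (F.φ i).pullback u le_rfl := by
      refine LinForm.pbM_ext le_rfl fun U hU V' hV' hW' x ↦ ?_
      rw [LinForm.pullback_app _ _ U hU]
      refine (congrArg ((D.φ i).app V' hV') (counitFst_pbM sq.w T hW' x)).trans ?_
      refine ((D.φ i).res_app V' _ hW' (preimage_le u hU) _).symm.trans ?_
      exact congrArg (resO Y' hW') (hφ i U hU x).symm
    exact congr(LinForm.app $this W hW x)

lemma bijective_counitSnd {E : DualBasis (f ⁻¹ᵁ V) T.snd.mod ι}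
    (he : ∀ i, pr₂ sq.w T (F.e i) = E.e i)
    (hφ : ∀ i W hW x, appO f W ((F.φ i).app W hW x) =
      (E.φ i).app (f ⁻¹ᵁ W) (preimage_le f hW) (pr₂ sq.w T x)) {W : X.Opens}
    (hW : W ≤ f ⁻¹ᵁ V) : Function.Bijective ((counitSnd sq.w T).hom.app W) := by
  refine DualBasis.bijective_of_map (F.pullback f le_rfl) E (counitSnd sq.w T).hom
    (fun i ↦ ?_) (fun i W hW x ↦ ?_) hW
  · exact (counitSnd_pbM sq.w T le_rfl (F.e i)).trans ((res_self _ _ _).trans (he i))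
  · have : (E.φ i).comp (HomOn.ofHom (counitSnd sq.w T).hom _) = (F.φ i).pullback f le_rfl := by
      refine LinForm.pbM_ext le_rfl fun U hU V' hV' hW' x ↦ ?_
      rw [LinForm.pullback_app _ _ U hU]
      refine (congrArg ((E.φ i).app V' hV') (counitSnd_pbM sq.w T hW' x)).trans ?_
      refine ((E.φ i).res_app V' _ hW' (preimage_le f hU) _).symm.trans ?_
      exact congrArg (resO X hW') (hφ i U hU x).symm
    exact congr(LinForm.app $this W hW x)

end Counit

/-- For finite locally free algebras, `u^*` and `f^*` of the pinched algebra are `B'` and `A`. -/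
lemma isIso_counit [IsAffineHom f] [IsClosedImmersion u]
    (T : Limits.CategoricalPullback (pullbackAlg g) (pullbackAlg w))
    (hB : IsFiniteLocallyFree T.fst.mod) (hA : IsFiniteLocallyFree T.snd.mod) :
    IsIso (counit sq.w T) := by
  have : IsClosedImmersion w := MorphismProperty.of_isPullback sq.toIsPullback.flip inferInstance
  have key (p : Y) : ∃ V : Y.Opens, p ∈ V ∧
      (∀ W ≤ u ⁻¹ᵁ V, Function.Bijective ((counitFst sq.w T).hom.app W)) ∧
      ∀ W ≤ f ⁻¹ᵁ V, Function.Bijective ((counitSnd sq.w T).hom.app W) := by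
    obtain ⟨V, hV, hp, -⟩ := exists_isAffineOpen_mem_and_subset (x := p) (U := ⊤) trivial
    obtain ⟨n, D, E, h⟩ := exists_compatible sq.w T hB hA hV
    obtain ⟨F, he₁, he₂, hF⟩ := exists_dualBasis_pinch sq T D E h.e_eq h.φ_eq
    exact ⟨V, hp, fun W hW ↦ bijective_counitFst sq he₁ (fun i W hW x ↦ (hF i W hW x).1) hW,
      fun W hW ↦ bijective_counitSnd sq he₂ (fun i W hW x ↦ (hF i W hW x).2) hW⟩
  have h₁ : IsIso (counitFst sq.w T).hom := isIso_of_locally_bijective _ fun p ↦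
    (key (u p)).imp' (fun V ↦ u ⁻¹ᵁ V) fun V hV ↦ ⟨hV.1, hV.2.1⟩
  have h₂ : IsIso (counitSnd sq.w T).hom := isIso_of_locally_bijective _ fun p ↦
    (key (f p)).imp' (fun V ↦ f ⁻¹ᵁ V) fun V hV ↦ ⟨hV.1, hV.2.2⟩
  exact (Limits.CategoricalPullback.isIso_iff _ _ _).mpr
    ⟨isIso_of_isIso_hom (counitFst sq.w T), isIso_of_isIso_hom (counitSnd sq.w T)⟩

/-- The two pullbacks of a dual basis of `B` are compatible with `g^*u^*B ≅ w^*f^*B`. -/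
lemma compatible_unpinch (e : w ≫ f = g ≫ u) (B : AlgSheaf Y) {V : Y.Opens} {ι : Type*}
    [Fintype ι] (D : DualBasis V B.mod ι) :
    Compatible e ((unpinch e).obj B) (D.pullback u le_rfl) (D.pullback f le_rfl) where
  e_eq i := canHom_pbM e B _ _ le_rfl _ _
  φ_eq i W hW y := by
    have : ((D.φ i).pullback u le_rfl).pullback g (preimage_le_of_eq e V) =
        (((D.φ i).pullback f le_rfl).pullback w (preimage_comp_le V)).comp
          (HomOn.ofHom (canHom e B).hom _) := by
      refine LinForm.pbM_pbM_ext (preimage_le_of_eq e V) fun U hU V' W hW₀ hV hW x ↦ ?_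
      have h : W ≤ w ⁻¹ᵁ f ⁻¹ᵁ U := fun p hp ↦ preimage_le_of_eq e.symm U (hV (hW hp))
      rw [LinForm.pullback_app _ _ V' (hV.trans (preimage_le u hU)),
        LinForm.pullback_app _ _ U hU]
      refine Eq.trans ?_ (congrArg
        ((((D.φ i).pullback f le_rfl).pullback w (preimage_comp_le V)).app W hW₀)
        (canHom_pbM e B hV hW le_rfl h x)).symm
      rw [LinForm.pullback_app _ _ (f ⁻¹ᵁ U) (preimage_le f hU), LinForm.pullback_app _ _ U hU,
        pbO_pbO g u _ _ (e ▸ h), pbO_pbO w f _ _ h]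
      exact pbO_congr e.symm _ _ _
    exact congr(LinForm.app $this W hW y)

/-- A finite locally free algebra `B` is the pinching of its pullbacks: the unit carries a dual
basis of `B` to the dual basis of the pinching built from the two pullbacks. -/
lemma isIso_unitPinch [IsAffineHom f] [IsAffineHom u] (B : AlgSheaf Y)
    (hB : IsFiniteLocallyFree B.mod) : IsIso (unitPinch sq.w B) := by
  have : IsIso (unitPinch sq.w B).hom := by
    refine isIso_of_locally_bijective _ fun p ↦ ?_
    obtain ⟨V, n, hp, ⟨D⟩⟩ := isFiniteLocallyFree_iff.mp hB p
    have h := compatible_unpinch sq.w B D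
    obtain ⟨F, he₁, he₂, hF⟩ := exists_dualBasis_pinch sq _ _ _ h.e_eq h.φ_eq
    refine ⟨V, hp, fun W hW ↦ DualBasis.bijective_of_map D F _ (fun i ↦ ?_) (fun i W hW x ↦ ?_) hW⟩
    · exact pinch_ext ((pr₁_unitPinch sq.w B _).trans (he₁ i).symm)
        ((pr₂_unitPinch sq.w B _).trans (he₂ i).symm)
    · refine eq_of_appO_eq sq ((hF i W hW _).1.trans ?_) ((hF i W hW _).2.trans ?_)
      · refine (congrArg (LinForm.app _ _ _) (pr₁_unitPinch sq.w B x)).trans ?_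
        exact (LinForm.pullback_app le_rfl (D.φ i) W hW _ _ le_rfl _).trans (pbO_self _)
      · refine (congrArg (LinForm.app _ _ _) (pr₂_unitPinch sq.w B x)).trans ?_
        exact (LinForm.pullback_app le_rfl (D.φ i) W hW _ _ le_rfl _).trans (pbO_self _)
  exact isIso_of_isIso_hom _

end Isos

end AlgSheaf

/-! ### The equivalence of categories -/

namespace AlgSheaf

section FullyFaithful

variable {X' X Y' Y : Scheme.{u}} {w : X' ⟶ X} {g : X' ⟶ Y'} {f : X ⟶ Y} {u : Y' ⟶ Y}
  (e : w ≫ f = g ≫ u) {S T : Limits.CategoricalPullback (pullbackAlg g) (pullbackAlg w)}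
  [IsIso (counit e S)]

/-- Pinching is faithful where the counit is an isomorphism. -/
lemma pinch_map_injective {α β : S ⟶ T} (h : (pinch e).map α = (pinch e).map β) : α = β := by
  rw [← cancel_epi (counit e S), ← counit_naturality, h, counit_naturality]

/-- Pinching is full where the counit is an isomorphism. -/
lemma exists_pinch_map (α : (pinch e).obj S ⟶ (pinch e).obj T) :
    ∃ β : S ⟶ T, (pinch e).map β = α := by
  refine ⟨inv (counit e S) ≫ (unpinch e).map α ≫ counit e T, ?_⟩
  have h : unitPinch e ((pinch e).obj S) = (pinch e).map (inv (counit e S)) := by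
    rw [Functor.map_inv]
    exact (IsIso.inv_eq_of_inv_hom_id (unitPinch_counit e S)).symm
  rw [Functor.map_comp, Functor.map_comp, ← h, ← Category.assoc, ← unitPinch_naturality,
    Category.assoc, unitPinch_counit, Category.comp_id]

end FullyFaithful

end AlgSheaf

section Equivalence

variable {X' X Y' Y : Scheme.{u}} {w : X' ⟶ X} {g : X' ⟶ Y'} {f : X ⟶ Y} {u : Y' ⟶ Y}

open AlgSheaf

/-- A triple of Azumaya algebras from a triple of algebras. -/
def toAz {hg : ∀ B : AlgSheaf Y', B.IsAzumaya → ((pullbackAlg g).obj B).IsAzumaya}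
    {hw : ∀ A : AlgSheaf X, A.IsAzumaya → ((pullbackAlg w).obj A).IsAzumaya}
    (T : Limits.CategoricalPullback (pullbackAlg g) (pullbackAlg w)) (hB : T.fst.IsAzumaya)
    (hA : T.snd.IsAzumaya) :
    Limits.CategoricalPullback (pullbackAz g hg) (pullbackAz w hw) :=
  ⟨⟨T.fst, hB⟩, ⟨T.snd, hA⟩, (ObjectProperty.fullyFaithfulι _).preimageIso T.iso⟩

variable (sq : BicartesianSq w g f u) [IsAffineHom f] [IsClosedImmersion u]
  (hg : ∀ B : AlgSheaf Y', B.IsAzumaya → ((pullbackAlg g).obj B).IsAzumaya)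
  (hw : ∀ A : AlgSheaf X, A.IsAzumaya → ((pullbackAlg w).obj A).IsAzumaya)

lemma exists_forgetAz_map {S T : Limits.CategoricalPullback (pullbackAz g hg) (pullbackAz w hw)}
    (β : (forgetAz hg hw).obj S ⟶ (forgetAz hg hw).obj T) :
    ∃ α : S ⟶ T, (forgetAz hg hw).map α = β :=
  ⟨⟨ObjectProperty.homMk β.fst, ObjectProperty.homMk β.snd,
    ObjectProperty.hom_ext _ β.w⟩, rfl⟩

lemma isEquivalence_pinchAz
    (hΨ : ∀ T : Limits.CategoricalPullback (pullbackAz g hg) (pullbackAz w hw),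
      ((pinch sq.w).obj ((forgetAz hg hw).obj T)).IsAzumaya) :
    (pinchAz sq.w hg hw hΨ).IsEquivalence := by
  have hε (T : Limits.CategoricalPullback (pullbackAz g hg) (pullbackAz w hw)) :
      IsIso (counit sq.w ((forgetAz hg hw).obj T)) :=
    isIso_counit sq _ T.fst.property.finiteLocallyFree T.snd.property.finiteLocallyFree
  have hfaithful : (pinchAz sq.w hg hw hΨ).Faithful := ⟨fun {S T} α β h ↦ by
    have h₂ : (forgetAz hg hw).map α = (forgetAz hg hw).map β :=
      pinch_map_injective sq.w congr(($h).hom)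
    exact Limits.CategoricalPullback.hom_ext (ObjectProperty.hom_ext _ congr(($h₂).fst))
      (ObjectProperty.hom_ext _ congr(($h₂).snd))⟩
  have hfull : (pinchAz sq.w hg hw hΨ).Full := ⟨fun {S T} α ↦ by
    obtain ⟨γ, hγ⟩ := exists_pinch_map sq.w (S := (forgetAz hg hw).obj S)
      (T := (forgetAz hg hw).obj T) α.hom
    obtain ⟨β, rfl⟩ := exists_forgetAz_map hg hw γ
    exact ⟨β, ObjectProperty.hom_ext _ hγ⟩⟩
  have hsurj : (pinchAz sq.w hg hw hΨ).EssSurj := ⟨fun B ↦ by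
    have := isIso_unitPinch sq B.obj B.property.finiteLocallyFree
    exact ⟨toAz ((unpinch sq.w).obj B.obj) (B.property.pullback u) (B.property.pullback f),
      ⟨(ObjectProperty.fullyFaithfulι _).preimageIso (asIso (unitPinch sq.w B.obj)).symm⟩⟩⟩
  exact { }

end Equivalence

/-! ### Pullbacks of quasi-coherent modules on affine opens -/

section AffinePullback

variable {X Y : Scheme.{u}}

/-- Every module over the coordinate ring of an affine open embeds into the sections of a sheaf of
modules. -/
lemma exists_injective_sections {V : X.Opens} (hV : IsAffineOpen V) (N : Type u) [AddCommGroup N]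
    [Module Γ(X, V) N] :
    ∃ (K : X.Modules) (j : N →ₗ[Γ(X, V)] Γ(K, V)), Function.Injective j := by
  let Q : (Spec Γ(X, V)).Modules := tilde (ModuleCat.of Γ(X, V) N)
  let o (D : (Spec Γ(X, V)).Opens) : N →ₗ[Γ(X, V)] Γ(Q, D) :=
    (tilde.toOpen (ModuleCat.of Γ(X, V) N) D).hom
  have ho : Function.Injective (o (hV.fromSpec ⁻¹ᵁ V)) := by
    rw [hV.fromSpec_preimage_self]
    exact (ConcreteCategory.bijective_of_isIso (tilde.toOpen (ModuleCat.of Γ(X, V) N) ⊤)).1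
  have hsmul (r : Γ(X, V)) (x : Γ(Q, hV.fromSpec ⁻¹ᵁ V)) :
      r • x = appO hV.fromSpec V r • x := by
    have : appO hV.fromSpec V r = (Spec Γ(X, V)).presheaf.map (hV.fromSpec ⁻¹ᵁ V).leTop.op
        ((Scheme.ΓSpecIso Γ(X, V)).inv r) := hV.fromSpec_app_self_apply r
    rw [this]
    rfl
  refine ⟨(pushforward hV.fromSpec).obj Q,
    { toFun := o (hV.fromSpec ⁻¹ᵁ V)
      map_add' := map_add _
      map_smul' := fun r x ↦ ((o _).map_smul r x).trans (hsmul r _) }, ho⟩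

/-- The homomorphism `f^*M → K` on `f⁻¹U` adjoint to a homomorphism `M → f_*K` on `U`. -/
def HomOn.adj {f : X ⟶ Y} {M : Y.Modules} {K : X.Modules} {U : Y.Opens}
    (φ : HomOn U M ((pushforward f).obj K)) : HomOn (f ⁻¹ᵁ U) ((pullback f).obj M) K :=
  HomOn.lift (fun W V' hV' hW ↦
      (res K (le_preimage_inf f hV' hW)).comp
        ((φ.app (U ⊓ W) inf_le_left).toAddMonoidHom.comp (res M inf_le_right)))
    (fun W V' hV' hW r x ↦ by
      have h₁ : φ.app (U ⊓ W) inf_le_left (res M inf_le_right (r • x)) =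
          appO f (U ⊓ W) (resO Y inf_le_right r) •
            (show Γ(K, f ⁻¹ᵁ (U ⊓ W)) from φ.app (U ⊓ W) inf_le_left (res M inf_le_right x)) := by
        rw [res_smul]; exact (φ.app (U ⊓ W) inf_le_left).map_smul _ _
      refine (congrArg (res K (le_preimage_inf f hV' hW)) h₁).trans ((res_smul K _ _ _).trans ?_)
      rw [appO_res, resO_resO]
      rfl)
    (fun W W' V' V'' hV hW hV' hW' h h' x ↦ by
      have h₁ : φ.app (U ⊓ W) inf_le_left (res M inf_le_right (res M h x)) =
          res K (preimage_le f (inf_le_inf_left U h))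
            (φ.app (U ⊓ W') inf_le_left (res M inf_le_right x)) := by
        refine Eq.trans ?_ (φ.res_app _ _ (inf_le_inf_left U h) inf_le_left _).symm
        rw [res_res, res_res]
      refine (res_res K _ _ _).trans (Eq.symm ?_)
      exact (congrArg (res K (le_preimage_inf f hV hW)) h₁).trans (res_res K _ _ _))

lemma HomOn.adj_app {f : X ⟶ Y} {M : Y.Modules} {K : X.Modules} {U : Y.Opens}
    (φ : HomOn U M ((pushforward f).obj K)) {W : Y.Opens} (hWU : W ≤ U) {V' : X.Opens}
    (hV' : V' ≤ f ⁻¹ᵁ U) (hW : V' ≤ f ⁻¹ᵁ W) (x : Γ(M, W)) :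
    φ.adj.app V' hV' (pbM f hW x) = res K hW (φ.app W hWU x) := by
  refine (HomOn.lift_app _ _ _ _ _ _ _ _).trans ?_
  have h₁ : φ.app (U ⊓ W) inf_le_left (res M inf_le_right x) =
      res K (preimage_le f inf_le_right) (φ.app W hWU x) :=
    (φ.res_app _ _ inf_le_right hWU _).symm
  exact (congrArg (res K (le_preimage_inf f hV' hW)) h₁).trans (res_res K _ _ _)

variable {f : X ⟶ Y} {M : Y.Modules} {U : Y.Opens}

/-- If a section of a quasi-coherent module `M` over an affine open `U` vanishes in `f^*M`, then it
vanishes in `𝒪(f⁻¹U) ⊗ M(U)`, so it is killed by all balanced maps on this tensor product. Indeed,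
this tensor product embeds into the sections of some module `K`, and the map `m ↦ 1 ⊗ m` is adjoint
to a homomorphism `f^*M ⟶ K`. -/
lemma balanced_one_eq_zero (hU : IsAffineOpen U) (hV : IsAffineOpen (f ⁻¹ᵁ U))
    (hM : M.IsQuasicoherent) {N : Type*} [AddCommGroup N] (β : Γ(X, f ⁻¹ᵁ U) →+ Γ(M, U) →+ N)
    (hβ : ∀ (a : Γ(Y, U)) (b : Γ(X, f ⁻¹ᵁ U)) (m : Γ(M, U)), β (appO f U a * b) m = β b (a • m))
    {x : Γ(M, U)} (hx : pbM f le_rfl x = 0) : β 1 x = 0 := by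
  let : Algebra Γ(Y, U) Γ(X, f ⁻¹ᵁ U) := (appO f U).toAlgebra
  obtain ⟨K, j, hj⟩ := exists_injective_sections hV (Γ(X, f ⁻¹ᵁ U) ⊗[Γ(Y, U)] Γ(M, U))
  let L : Γ(M, U) →ₗ[Γ(Y, U)] Γ((pushforward f).obj K, U) :=
    { toFun m := j (1 ⊗ₜ m)
      map_add' m m' := by rw [TensorProduct.tmul_add]; exact map_add j _ _
      map_smul' a m := by
        have : (1 : Γ(X, f ⁻¹ᵁ U)) ⊗ₜ[Γ(Y, U)] (a • m) = appO f U a • (1 ⊗ₜ[Γ(Y, U)] m) := by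
          rw [← TensorProduct.smul_tmul, TensorProduct.smul_tmul', Algebra.smul_def]
          rfl
        rw [this]
        exact j.map_smul _ _ }
  obtain ⟨φ, hφ⟩ := HomOn.exists_of_isAffineOpen hU hM L
  have h₁ : (1 : Γ(X, f ⁻¹ᵁ U)) ⊗ₜ[Γ(Y, U)] x = 0 := by
    apply hj
    rw [map_zero]
    have h₂ := φ.adj_app le_rfl le_rfl le_rfl x
    rw [hx, map_zero] at h₂
    exact (hφ x).symm.trans ((res_self K _ _).symm.trans h₂.symm)
  let γ : Γ(X, f ⁻¹ᵁ U) ⊗[Γ(Y, U)] Γ(M, U) →+ N := TensorProduct.liftAddHom β hβ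
  exact (congrArg γ h₁).trans (map_zero γ)

/-- The sections of `f^*M` on `f⁻¹U` are spanned by the sections of `M` on `U`: the quotient by
their span embeds into the sections of a module `K`, and the resulting homomorphism `f^*M ⟶ K` is
zero because its adjoint is. -/
lemma span_pbM (hU : IsAffineOpen U) (hV : IsAffineOpen (f ⁻¹ᵁ U)) (hM : M.IsQuasicoherent)
    (hfM : ((pullback f).obj M).IsQuasicoherent) :
    Submodule.span Γ(X, f ⁻¹ᵁ U) (Set.range (pbM (M := M) (U := U) f le_rfl)) = ⊤ := by
  let S := Submodule.span Γ(X, f ⁻¹ᵁ U) (Set.range (pbM (M := M) (U := U) f le_rfl))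
  obtain ⟨K, j, hj⟩ := exists_injective_sections hV (Γ((pullback f).obj M, f ⁻¹ᵁ U) ⧸ S)
  obtain ⟨φ, hφ⟩ := HomOn.exists_of_isAffineOpen (N := K) hV hfM (j.comp S.mkQ)
  let ψ : HomOn U M ((pushforward f).obj K) :=
    { app W hW :=
        { toFun x := φ.app (f ⁻¹ᵁ W) (preimage_le f hW) (pbM f le_rfl x)
          map_add' x y := by rw [map_add]; exact map_add _ _ _
          map_smul' r x := by
            rw [pbM_smul, pbO_self]
            exact (φ.app (f ⁻¹ᵁ W) (preimage_le f hW)).map_smul _ _ }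
      res_app W W' hW hV x := by
        refine (φ.res_app _ _ (preimage_le f hW) (preimage_le f hV) _).trans ?_
        refine congrArg (φ.app (f ⁻¹ᵁ W) (preimage_le f (hW.trans hV))) ?_
        rw [res_pbM, pbM_res] }
  have hψ : ψ = 0 := HomOn.ext_of_isAffineOpen hU hM fun x ↦ by
    refine (hφ _).trans ?_
    rw [LinearMap.comp_apply, S.mkQ_apply, (Submodule.Quotient.mk_eq_zero S).mpr
      (Submodule.subset_span ⟨x, rfl⟩)]
    exact map_zero j
  have h₀ : φ = 0 := HomOn.pbM_ext le_rfl fun W hW V' hV' hW' x ↦ by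
    have h₁ := congrArg (res K hW') congr(HomOn.app $hψ W hW x)
    have h₂ := (φ.res_app _ _ hW' (preimage_le f hW) (pbM f le_rfl x)).symm.trans h₁
    rw [res_pbM] at h₂
    exact h₂.trans (map_zero _)
  refine (Submodule.eq_top_iff').mpr fun y ↦ (Submodule.Quotient.mk_eq_zero S).mp (hj ?_)
  rw [map_zero]
  refine (hφ y).symm.trans ?_
  rw [h₀]
  rfl

end AffinePullback

namespace AlgSheaf

/-! ### Descent of the Azumaya property -/

lemma IsAzumaya.of_iso {X : Scheme.{u}} {A B : AlgSheaf X} (ψ : A ≅ B) (hA : A.IsAzumaya) :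
    B.IsAzumaya := by
  rw [isAzumaya_iff] at hA ⊢
  have hψ : Hom.hom ψ.hom ≫ Hom.hom ψ.inv = 𝟙 _ := congr(Hom.hom $(ψ.hom_inv_id))
  have hψ' : Hom.hom ψ.inv ≫ Hom.hom ψ.hom = 𝟙 _ := congr(Hom.hom $(ψ.inv_hom_id))
  refine ⟨fun p ↦ ?_, fun p V hp h ↦ hA.2 p V hp ?_⟩
  · obtain ⟨V, n, D, T, hp, hT⟩ := hA.1 p
    refine ⟨V, n, D.mapIso ⟨Hom.hom ψ.hom, Hom.hom ψ.inv, hψ, hψ'⟩, T, hp,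
      hT.of_hom ψ.hom (fun _ ↦ rfl) fun i W h x ↦ ?_⟩
    exact congrArg ((D.φ i).app W h) congr(($hψ).app W x)
  · rw [← Hom.map_one ψ.inv, h, map_zero]

section Descent

variable {X' X Y' Y : Scheme.{u}} {w : X' ⟶ X} {g : X' ⟶ Y'} {f : X ⟶ Y} {u : Y' ⟶ Y}
  [IsAffineHom f] {B : AlgSheaf Y} {U : Y.Opens}

/-- If `j` vanishes on `X'`, then the multiples of `j` come from sections of `B` that vanish on
`Y'`. -/
lemma exists_pbM_eq_smul (sq : BicartesianSq w g f u) [IsAffineHom u]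
    (hU : IsAffineOpen U) (hB : B.mod.IsQuasicoherent)
    (hf : ((pullback f).obj B.mod).IsQuasicoherent) (y : Γ((pullback f).obj B.mod, f ⁻¹ᵁ U))
    (j : Γ(X, f ⁻¹ᵁ U)) (hj : pbO w (preimage_comp_le (w := w) U) j = 0) :
    ∃ m : Γ(B.mod, U), pbM u le_rfl m = 0 ∧ pbM f le_rfl m = j • y := by
  have hy : y ∈ Submodule.span Γ(X, f ⁻¹ᵁ U) (Set.range (pbM (M := B.mod) (U := U) f le_rfl)) := by
    rw [span_pbM hU (hU.preimage f) hB hf]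
    trivial
  induction hy using Submodule.span_induction generalizing j with
  | mem y h =>
    obtain ⟨m, rfl⟩ := h
    obtain ⟨i, hi₁, hi₂⟩ := exists_appO_eq sq (0 : Γ(Y', u ⁻¹ᵁ U)) j (by rw [map_zero, hj])
    refine ⟨i • m, ?_, ?_⟩
    · rw [pbM_smul, pbO_self, hi₁, zero_smul]
    · rw [pbM_smul, pbO_self, hi₂]
  | zero => exact ⟨0, map_zero _, by rw [map_zero, smul_zero]⟩
  | add y₁ y₂ _ _ h₁ h₂ =>
    obtain ⟨m₁, h₁, h₁'⟩ := h₁ j hj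
    obtain ⟨m₂, h₂, h₂'⟩ := h₂ j hj
    exact ⟨m₁ + m₂, by rw [map_add, h₁, h₂, add_zero], by rw [map_add, h₁', h₂', smul_add]⟩
  | smul b y _ h =>
    obtain ⟨m, h, h'⟩ := h (j * b) (by rw [map_mul, hj, zero_mul])
    exact ⟨m, h, by rw [h', mul_smul]⟩

lemma surjective_pbM_of_isClosedImmersion [IsClosedImmersion u] (hU : IsAffineOpen U)
    (hB : B.mod.IsQuasicoherent) (hu : ((pullback u).obj B.mod).IsQuasicoherent) :
    Function.Surjective (pbM (M := B.mod) (U := U) u le_rfl) := fun y ↦ by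
  have hy : y ∈ Submodule.span Γ(Y', u ⁻¹ᵁ U) (Set.range (pbM (M := B.mod) (U := U) u le_rfl)) := by
    rw [span_pbM hU (hU.preimage u) hB hu]
    trivial
  induction hy using Submodule.span_induction with
  | mem y h => exact h
  | zero => exact ⟨0, map_zero _⟩
  | add y₁ y₂ _ _ h₁ h₂ =>
    obtain ⟨m₁, rfl⟩ := h₁
    obtain ⟨m₂, rfl⟩ := h₂
    exact ⟨m₁ + m₂, map_add _ _ _⟩
  | smul b y _ h =>
    obtain ⟨m, rfl⟩ := h
    obtain ⟨a, rfl⟩ := u.app_surjective U hU b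
    exact ⟨a • m, by rw [pbM_smul, pbO_self]; rfl⟩

/-- A section of the pinched algebra is the image of a section of `B` up to a section with vanishing
component on `Y'`, and the latter lifts by `exists_pbM_eq_smul`. -/
lemma surjective_unitPinch (sq : BicartesianSq w g f u) [IsClosedImmersion u]
    (hU : IsAffineOpen U)
    (hB : B.mod.IsQuasicoherent) (hu : ((pullback u).obj B.mod).IsQuasicoherent)
    (hf : IsFiniteLocallyFree ((pullback f).obj B.mod)) :
    Function.Surjective ((unitPinch sq.w B).hom.app U) := fun p ↦ by
  obtain ⟨m, hm⟩ := surjective_pbM_of_isClosedImmersion hU hB hu (pr₁ sq.w _ p)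
  let p' := p - (unitPinch sq.w B).hom.app U m
  have h₁ : pr₁ sq.w _ p' = 0 := by
    rw [map_sub, pr₁_unitPinch, ← hm]
    exact sub_self _
  have h₂ : pbM w (preimage_comp_le U) (pr₂ sq.w _ p') = 0 := by
    rw [← pr_condition p' (preimage_le_of_eq sq.w U) (preimage_comp_le U), h₁, map_zero, map_zero]
  obtain ⟨n, ⟨E⟩⟩ := hf.exists_dualBasis (hU.preimage f)
  have h₃ (k : Fin n) := exists_pbM_eq_smul sq hU hB hf.isQuasicoherent (E.e k)
    ((E.φ k).app _ le_rfl (pr₂ sq.w _ p')) (by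
      refine (LinForm.pullback_app (preimage_comp_le U) (E.φ k) _ le_rfl _ le_rfl
        (preimage_comp_le U) _).symm.trans ?_
      exact (congrArg (((E.φ k).pullback w (preimage_comp_le U)).app _ le_rfl) h₂).trans
        (map_zero _))
  choose x hx₁ hx₂ using h₃
  refine ⟨m + ∑ k, x k, ?_⟩
  have h₄ : (unitPinch sq.w B).hom.app U (∑ k, x k) = p' := by
    refine pinch_ext ?_ ?_
    · rw [pr₁_unitPinch, map_sum, h₁]
      exact Finset.sum_eq_zero fun k _ ↦ hx₁ k
    · rw [pr₂_unitPinch, map_sum, ← E.sum_self (pr₂ sq.w _ p')]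
      exact Finset.sum_congr rfl fun k _ ↦ hx₂ k
  rw [map_add, h₄, add_sub_cancel]

/-- Sections of `B` that vanish on `X` are killed by the functions that vanish on `Y'`, since these
functions form an ideal of `𝒪(f⁻¹U)` as well. -/
lemma smul_eq_zero_of_pbM_eq_zero (sq : BicartesianSq w g f u) [IsAffineHom u]
    (hU : IsAffineOpen U)
    (hB : B.mod.IsQuasicoherent) {x : Γ(B.mod, U)} (hx : pbM f le_rfl x = 0) {i : Γ(Y, U)}
    (hi : appO u U i = 0) : i • x = 0 := by
  have key (b : Γ(X, f ⁻¹ᵁ U)) : ∃ r : Γ(Y, U), appO u U r = 0 ∧ appO f U r = b * appO f U i :=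
    exists_appO_eq sq 0 _ (by
      rw [map_mul, pbO_appO_right, ← pbO_appO_left sq.w, hi, map_zero, mul_zero])
  choose r hr₁ hr₂ using key
  have h := balanced_one_eq_zero hU (hU.preimage f) hB (N := Γ(B.mod, U))
    (AddMonoidHom.mk' (fun b ↦ AddMonoidHom.mk' (fun m ↦ r b • m) fun _ _ ↦ smul_add _ _ _)
      fun b b' ↦ AddMonoidHom.ext fun m ↦ by
        have : r (b + b') = r b + r b' :=
          eq_of_appO_eq sq (by simp [hr₁]) (by simp [hr₂, add_mul])
        simp [this, add_smul])
    (fun a b m ↦ by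
      have : r (appO f U a * b) = r b * a :=
        eq_of_appO_eq sq (by simp [hr₁]) (by simp only [hr₂, map_mul]; ring)
      simp [this, mul_smul]) hx
  have : r 1 = i := eq_of_appO_eq sq (by rw [hr₁, hi]) (by rw [hr₂, _root_.one_mul])
  rw [← this]
  exact h

/-- Sections that vanish on `Y'` are combinations with coefficients that vanish on `Y'`. -/
lemma mem_smul_top_of_pbM_eq_zero [IsClosedImmersion u] (hU : IsAffineOpen U)
    (hB : B.mod.IsQuasicoherent) {x : Γ(B.mod, U)} (hx : pbM u le_rfl x = 0) :
    x ∈ RingHom.ker (appO u U) • (⊤ : Submodule Γ(Y, U) Γ(B.mod, U)) := by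
  let S := RingHom.ker (appO u U) • (⊤ : Submodule Γ(Y, U) Γ(B.mod, U))
  have hS (r s : Γ(Y, U)) (h : appO u U r = appO u U s) (m : Γ(B.mod, U)) :
      S.mkQ (r • m) = S.mkQ (s • m) := by
    rw [← sub_eq_zero, ← map_sub, ← sub_smul]
    exact (Submodule.Quotient.mk_eq_zero S).mpr
      (Submodule.smul_mem_smul (by rw [RingHom.mem_ker, map_sub, h, sub_self]) trivial)
  have hsurj : Function.Surjective (appO u U) := u.app_surjective U hU
  choose r hr using hsurj
  have h := balanced_one_eq_zero hU (hU.preimage u) hB (N := Γ(B.mod, U) ⧸ S)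
    (AddMonoidHom.mk' (fun b ↦ AddMonoidHom.mk' (fun m ↦ S.mkQ (r b • m)) fun _ _ ↦ by
        rw [smul_add, map_add])
      fun b b' ↦ AddMonoidHom.ext fun m ↦ by
        have := hS (r (b + b')) (r b + r b') (by simp [hr]) m
        rw [add_smul, map_add] at this
        exact this)
    (fun a b m ↦ by
      have := hS (r (appO u U a * b)) (r b * a) (by simp [hr, mul_comm]) m
      rw [mul_smul] at this
      exact this) hx
  refine (Submodule.Quotient.mk_eq_zero S).mp ?_
  rw [← one_smul Γ(Y, U) x]
  exact (hS 1 (r 1) (by rw [hr, map_one]) x).trans h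

/-- A dual basis of the pinched algebra lifts to `B`, and it is a dual basis of `B` if the map `π`
to the kernel of the unit vanishes. The values of `π` lie in `I B`, where `I` are the functions
vanishing on `Y'`, and `I` kills the kernel. As `π` is idempotent, it is zero. -/
lemma isFiniteLocallyFree_of_pullback (sq : BicartesianSq w g f u) [IsClosedImmersion u]
    (hB : B.mod.IsQuasicoherent)
    (hu : ((pullbackAlg u).obj B).IsAzumaya) (hf : ((pullbackAlg f).obj B).IsAzumaya) :
    IsFiniteLocallyFree B.mod := by
  refine isFiniteLocallyFree_iff.mpr fun p ↦ ?_
  obtain ⟨U, hU, hp, -⟩ := exists_isAffineOpen_mem_and_subset (x := p) (U := ⊤) trivial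
  have hP : ((pinch sq.w).obj ((unpinch sq.w).obj B)).IsAzumaya := isAzumaya_pinch _ sq hu hf
  obtain ⟨n, ⟨F⟩⟩ := hP.finiteLocallyFree.exists_dualBasis hU
  let η : Γ(B.mod, U) →ₗ[Γ(Y, U)] Γ(((pinch sq.w).obj ((unpinch sq.w).obj B)).mod, U) :=
    (HomOn.ofHom (unitPinch sq.w B).hom U).app U le_rfl
  have hη : Function.Surjective η := surjective_unitPinch sq hU hB
    hu.finiteLocallyFree.isQuasicoherent hf.finiteLocallyFree
  choose m hm using fun i ↦ hη (F.e i)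
  let L (i : Fin n) : Γ(B.mod, U) →ₗ[Γ(Y, U)] Γ(Y, U) := ((F.φ i).app U le_rfl).comp η
  -- the projector onto the kernel of `η` that the lifted dual basis defines
  let π : Γ(B.mod, U) →ₗ[Γ(Y, U)] Γ(B.mod, U) := .id - ∑ i, (L i).smulRight (m i)
  have hπ (x) : π x = x - ∑ i, L i x • m i := by simp [π, LinearMap.sum_apply]
  have hηπ (x) : η (π x) = 0 := by
    rw [hπ, map_sub, sub_eq_zero, ← F.sum_self (η x), map_sum]
    exact Finset.sum_congr rfl fun i _ ↦ by rw [map_smul, hm]; rfl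
  have hπ₀ (x) : π x = 0 := by
    have h₁ : pbM u le_rfl (π x) = 0 :=
      (pr₁_unitPinch sq.w B (π x)).symm.trans ((congrArg _ (hηπ x)).trans (map_zero _))
    have h₂ (y) : pbM f le_rfl (π y) = 0 :=
      (pr₂_unitPinch sq.w B (π y)).symm.trans ((congrArg _ (hηπ y)).trans (map_zero _))
    have h₃ : π (π x) = π x := by
      rw [hπ (π x)]
      simp [L, hηπ]
    have h₄ : (RingHom.ker (appO u U) • (⊤ : Submodule Γ(Y, U) Γ(B.mod, U))).map π = ⊥ := by
      rw [Submodule.map_smul'', eq_bot_iff, Submodule.smul_le]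
      rintro i hi _ ⟨y, -, rfl⟩
      exact smul_eq_zero_of_pbM_eq_zero sq hU hB (h₂ y) hi
    have h₅ := Submodule.mem_map_of_mem (f := π) (mem_smul_top_of_pbM_eq_zero hU hB h₁)
    rwa [h₄, Submodule.mem_bot, h₃] at h₅
  obtain ⟨D, -⟩ := exists_dualBasis_of_sections hU hB m L fun x ↦
    (sub_eq_zero.mp ((hπ x).symm.trans (hπ₀ x))).symm
  exact ⟨U, n, hp, ⟨D⟩⟩

lemma IsAzumaya.of_pullback (sq : BicartesianSq w g f u) [IsClosedImmersion u]
    (hB : B.mod.IsQuasicoherent)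
    (hu : ((pullbackAlg u).obj B).IsAzumaya) (hf : ((pullbackAlg f).obj B).IsAzumaya) :
    B.IsAzumaya := by
  have := isIso_unitPinch sq B (isFiniteLocallyFree_of_pullback sq hB hu hf)
  exact (isAzumaya_pinch ((unpinch sq.w).obj B) sq hu hf).of_iso
    (asIso (unitPinch sq.w B)).symm

end Descent

end AlgSheaf

end Pinching

end

open Pinching

theorem mainTheorem2 {X' X Y' Y : Scheme.{u}} (w : X' ⟶ X) (g : X' ⟶ Y') (f : X ⟶ Y) (u : Y' ⟶ Y)
    (sq : BicartesianSq w g f u) [IsAffineHom f] [IsClosedImmersion u] :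
    (∃ (hg : ∀ B : AlgSheaf Y', B.IsAzumaya → ((AlgSheaf.pullbackAlg g).obj B).IsAzumaya)
      (hw : ∀ A : AlgSheaf X, A.IsAzumaya → ((AlgSheaf.pullbackAlg w).obj A).IsAzumaya)
      (hΨ : ∀ T : Limits.CategoricalPullback (pullbackAz g hg) (pullbackAz w hw),
        ((AlgSheaf.pinch sq.w).obj ((forgetAz hg hw).obj T)).IsAzumaya),
      (pinchAz sq.w hg hw hΨ).IsEquivalence) ∧
    ∀ B : AlgSheaf Y, B.mod.IsQuasicoherent →
      (B.IsAzumaya ↔ ((AlgSheaf.pullbackAlg u).obj B).IsAzumaya ∧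
        ((AlgSheaf.pullbackAlg f).obj B).IsAzumaya) := by
  refine ⟨⟨fun B hB ↦ hB.pullback g, fun A hA ↦ hA.pullback w,
    fun T ↦ AlgSheaf.isAzumaya_pinch _ sq T.fst.property T.snd.property,
    isEquivalence_pinchAz sq _ _ _⟩, fun B hB ↦ ⟨fun h ↦ ⟨h.pullback u, h.pullback f⟩, fun h ↦ ?_⟩⟩
  exact AlgSheaf.IsAzumaya.of_pullback sq hB h.1 h.2
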